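/- **Spectral data.** Let $\Gamma$ be a (possibly disconnected) complex curve whose irreducible components are $N$ projective lines $\Gamma_1,\dots,\Gamma_N$, with global coordinates $z_i$ on $\Gamma_i$, whose only singularities are finitely many ordinary double points, each of them an intersection point $a$ of two different components $\Gamma_i,\Gamma_j$ with the same coordinate $z_i(a)=z_j(a)$ on both. Put $P_i=\{z_i=\infty\}$ and $Q_i=\{z_i=0\}$, assume that these points are nonsingular, take $z_i^{-1}$ as the local parameter at $P_i$, and assume that $\sigma(z_i)=-z_i$ $(i=1,\dots,N)$ defines an involution $\sigma$ of $\Gamma$. Let $P=\sum P_i$, $Q=\sum Q_i$, let $D$ be an effective divisor and $R=R_1+\dots+R_l$ a sum of distinct points, both consisting of nonsingular points different from the $P_i$ and $Q_i$, and let $d_1,\dots,d_l\in\mathbb C$ be not all zero. Assume that there is a meromorphic differential $\Omega$ on $\Gamma$, regular at the double points (that is, it has simple poles with opposite residues at the two preimages of every double point), whose zero and pole divisors, which have no common points, are otherwise $$(\Omega)_0=D+\sigma D+P,\qquad (\Omega)_\infty=R+\sigma R+Q .$$ Let $U\subset\mathbb C^N$ be an open set such that for every $u\in U$ there is exactly one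 Baker--Akhiezer function $\psi(u,\cdot)$: a function on $\Gamma$, meromorphic on $\Gamma\setminus\{P_1,\dots,P_N\}$ with pole divisor at most $D$ (in particular with equal values at the two preimages of each double point), such that $\psi e^{-u^iz_i}$ is analytic near $P_i$ for all $i$, and $\psi(u,R_k)=d_k$ for $k=1,\dots,l$. Let $x^k(u)=\psi(u,Q_k)$, $\eta_{kl}=\delta_{kl}\operatorname{res}_{Q_k}\Omega$, $h_i(u)=\lim_{P\to P_i}\psi e^{-u^iz_i}$ and $H_i=\varepsilon_ih_i$, where $\Omega=(\varepsilon_i^2w+O(w^2))\,dw$, $w=z_i^{-1}$, near $P_i$. Let $V\subset U$ be the set of all $u\in U$ with $H_i(u)\ne0$ for all $i$. **Theorem.** 1) The set $V$ is open, the functions $x^k$ and $H_i$ are holomorphic on $V$, the constant matrix $\eta$ is nondegenerate, and on $V$ $$ds^2=\sum_{k,l}\eta_{kl}\,dx^kdx^l=\sum_iH_i^2\,(du^i)^2 .$$ This metric is a flat Egorov (Darboux--Egorov) metric: its Riemann curvature tensor vanishes and its rotation coefficients $\beta_{ij}=H_j^{-1}\partial H_i/\partial u^j$ are symmetric, $\beta_{ij}=\beta_{ji}$.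 It gives solutions of the associativity equations: near every point of $V$ the functions $x^1,\dots,x^N$ are local coordinates, and in these coordinates there is a function $F(x)$ such that $$c_{\alpha\beta\gamma}(x):=\sum_iH_i^2\frac{\partial u^i}{\partial x^\alpha}\frac{\partial u^i}{\partial x^\beta}\frac{\partial u^i}{\partial x^\gamma}=\frac{\partial^3F}{\partial x^\alpha\partial x^\beta\partial x^\gamma}$$ and, with $(\eta^{\lambda\mu})=\eta^{-1}$ and summation over $\lambda,\mu$, $$\frac{\partial^3F}{\partial x^\alpha\partial x^\beta\partial x^\lambda}\eta^{\lambda\mu}\frac{\partial^3F}{\partial x^\gamma\partial x^\delta\partial x^\mu}=\frac{\partial^3F}{\partial x^\gamma\partial x^\beta\partial x^\lambda}\eta^{\lambda\mu}\frac{\partial^3F}{\partial x^\alpha\partial x^\delta\partial x^\mu}\quad\text{for all }\alpha,\beta,\gamma,\delta .$$ 2) If moreover $\Gamma$ is connected and $\psi$ is normalized at a single point, i.e. $l=1$ and $\psi(u,r)=1$ with $R=r$, then the functions $c_{\alpha\beta\gamma}$ are homogeneous of degree $-1$, $$c_{\alpha\beta\gamma}(\lambda x)=\lambda^{-1}c_{\alpha\beta\gamma}(x),\qquad\lambda\neq0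 ,$$ for every branch of the (in general multivalued) inverse $u(x)$ of $x(u)$ with values in $V$, on an open subset of the $x$-space that contains the segment from $x$ to $\lambda x$. 3) If moreover the spectral data are real, i.e. $\Gamma$, $D$, $R$ and the numbers $d_k$ are invariant under the complex conjugations $z_i\mapsto\bar z_i$ of the components, and $\Omega$ goes to $\overline\Omega$, then $\eta$, the numbers $\varepsilon_i^2$ and, for $u\in V\cap\mathbb R^N$, the values $x^k(u)$ and $h_i(u)$ are real, and 1) and, under its assumptions, 2) hold over $\mathbb R$ on $V\cap\mathbb R^N$ for the pseudo-Riemannian metric $\sum_{k,l}\eta_{kl}dx^kdx^l=\sum_i e_iH_i^2(du^i)^2$, where $e_i=\operatorname{sign}\varepsilon_i^2=\pm1$ and $H_i=|\varepsilon_i^2|^{1/2}h_i$, with $e_iH_i^2$ in place of $H_i^2$, smooth in place of holomorphic, and with the Egorov condition $\beta_{ij}=e_ie_j\beta_{ji}$. -/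

import Mathlib

open Filter Topology
open scoped ContDiff ComplexConjugate

noncomputable section

namespace FiniteGap

/-! ### Meromorphic differentials on the projective line

A meromorphic differential on `ℂP¹` is `r(z) dz` with a rational function `r`. -/

/-- Order of `r(z) dz` at a finite point `a` (positive at zeros, negative at poles). -/
def diffOrd (r : RatFunc ℂ) (a : ℂ) : ℤ :=
  (r.num.rootMultiplicity a : ℤ) - (r.denom.rootMultiplicity a : ℤ)

/-- Order of `r(z) dz` at `z = ∞`; in the local parameter `w = 1/z` one has `dz = -w⁻² dw`. -/
def diffOrdInfty (r : RatFunc ℂ) : ℤ := -r.intDegree - 2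

/-- Residue of `r(z) dz` at `a`, for a differential with at most a simple pole at `a`. -/
def simpleResidue (r : RatFunc ℂ) (a : ℂ) : ℂ :=
  if r.denom.eval a = 0 then r.num.eval a / r.denom.derivative.eval a else 0

/-- If `r(z) dz` has a simple zero at `∞`, then `r(z) dz = (κ w + O(w²)) dw` in the local
parameter `w = 1/z`, with `κ` the number defined here. -/
def inftyCoeff (r : RatFunc ℂ) : ℂ := -(r.num.leadingCoeff / r.denom.leadingCoeff)

/-! ### Spectral data

The curve `Γ` is a union of `N` projective lines `Γ_i` with coordinates `z_i`; the marked points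
are `P_i = ∞` and `Q_i = 0` on `Γ_i`, the local parameter at `P_i` is `1 / z_i`, and the
involution is `z_i ↦ -z_i` on every component. -/

/-- Spectral data with `N` components and `l` normalization points. -/
structure SpectralData (N l : ℕ) where
  /-- `glue i j` is the set of the coordinates of the intersection points of `Γ_i` and `Γ_j`:
  for `a ∈ glue i j` the points `z_i = a` and `z_j = a` are identified. -/
  glue : Fin N → Fin N → Finset ℂ
  /-- the part of the pole divisor `D` on `Γ_i`, with multiplicities -/
  D : Fin N → Multiset ℂ
  /-- the normalization points: component and coordinate -/
  R : Fin l → Fin N × ℂ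
  /-- the normalization constants -/
  d : Fin l → ℂ
  /-- the differential: it is `Ω i (z_i) dz_i` on `Γ_i` -/
  Ω : Fin N → RatFunc ℂ
  glue_symm : ∀ i j, glue i j = glue j i
  glue_irrefl : ∀ i, glue i i = ∅
  /-- singular points are double points: no point is identified with two others -/
  glue_double : ∀ i j k, j ≠ k → Disjoint (glue i j) (glue i k)
  /-- the involution `z_i ↦ -z_i` descends to `Γ` -/
  glue_neg : ∀ i j, ∀ a ∈ glue i j, -a ∈ glue i j
  /-- the points `Q_i` are nonsingular -/
  glue_ne_zero : ∀ i j, ∀ a ∈ glue i j, a ≠ 0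
  R_injective : Function.Injective R
  R_ne_zero : ∀ k, (R k).2 ≠ 0
  R_not_glue : ∀ k j, (R k).2 ∉ glue (R k).1 j
  D_ne_zero : ∀ i, ∀ γ ∈ D i, γ ≠ 0
  D_not_glue : ∀ i j, ∀ γ ∈ D i, γ ∉ glue i j
  /-- zeros `D + σD + P` and poles `R + σR + Q` of the differential do not cancel -/
  D_not_R : ∀ k, (R k).2 ∉ D (R k).1 ∧ -(R k).2 ∉ D (R k).1
  /-- the normalization constants do not vanish simultaneously -/
  d_ne_zero : ∃ k, d k ≠ 0
  /-- On the finite part of `Γ_i` the divisor of the differential is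
  `D + σD - R - σR - Q_i`, minus a simple pole at every preimage of a singular point. -/
  Ω_ord : ∀ i a, diffOrd (Ω i) a =
    ((D i).count a : ℤ) + ((D i).count (-a) : ℤ)
      - (if ∃ k, R k = (i, a) then 1 else 0)
      - (if ∃ k, R k = (i, -a) then 1 else 0)
      - (if a = 0 then 1 else 0)
      - (if ∃ j, a ∈ glue i j then 1 else 0)
  /-- the differential has a simple zero at `P_i` -/
  Ω_ord_infty : ∀ i, diffOrdInfty (Ω i) = 1
  /-- regularity of the differential at the double points -/
  Ω_regular : ∀ i j, ∀ a ∈ glue i j, simpleResidue (Ω i) a + simpleResidue (Ω j) a = 0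

namespace SpectralData

variable {N l : ℕ} (S : SpectralData N l)

/-- The dual graph of the curve, without multiplicities: components that intersect. -/
def dualGraph : SimpleGraph (Fin N) where
  Adj i j := (S.glue i j).Nonempty
  symm := ⟨fun i j h => by rw [S.glue_symm j i]; exact h⟩
  loopless := ⟨fun i h => by rw [S.glue_irrefl i] at h; exact Finset.not_nonempty_empty h⟩

/-- The curve `Γ` is connected. -/
def CurveConnected : Prop := S.dualGraph.Connected

/-- `ψ` (with `ψ i` its restriction to `Γ_i`) is a Baker--Akhiezer function of the spectral data
for the parameter value `u`. Its values at the points of `D` are irrelevant. -/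
structure IsBakerAkhiezer (u : Fin N → ℂ) (ψ : Fin N → ℂ → ℂ) : Prop where
  /-- holomorphic on `Γ` outside of `P` and `D` -/
  analytic : ∀ i z, z ∉ S.D i → AnalyticAt ℂ (ψ i) z
  /-- meromorphic outside of `P` -/
  meromorphic : ∀ i z, MeromorphicAt (ψ i) z
  /-- the divisor of poles is at most `D` -/
  poles : ∀ i z, ((-((S.D i).count z : ℤ) : ℤ) : WithTop ℤ) ≤ meromorphicOrderAt (ψ i) z
  /-- `ψ exp (-uⁱ z_i)` is analytic near `P_i`, in the local parameter `w = 1 / z_i` -/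
  infinity : ∀ i, ∃ g : ℂ → ℂ, AnalyticAt ℂ g 0 ∧
    ∀ᶠ w in 𝓝[≠] (0 : ℂ), g w = ψ i w⁻¹ * Complex.exp (-(u i * w⁻¹))
  /-- `ψ` descends to the singular curve -/
  glue : ∀ i j, ∀ a ∈ S.glue i j, ψ i a = ψ j a
  /-- normalization -/
  norm : ∀ k, ψ (S.R k).1 (S.R k).2 = S.d k

/-- `ψ` is the unique Baker--Akhiezer function for the parameter value `u`. -/
def IsUniqueBakerAkhiezer (u : Fin N → ℂ) (ψ : Fin N → ℂ → ℂ) : Prop :=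
  S.IsBakerAkhiezer u ψ ∧
    ∀ φ, S.IsBakerAkhiezer u φ → ∀ i z, z ∉ S.D i → φ i z = ψ i z

/-- The constant flat metric `η_{kl} = δ_{kl} res_{Q_k} Ω`. -/
def eta : Matrix (Fin N) (Fin N) ℂ := Matrix.diagonal fun k => simpleResidue (S.Ω k) 0

/-- The numbers `ε_i²` with `Ω = (ε_i² w + O(w²)) dw`, `w = 1 / z_i`, near `P_i`. -/
def epsSq (i : Fin N) : ℂ := inftyCoeff (S.Ω i)

/-- The spectral data are invariant under the antiholomorphic involution `z_i ↦ conj z_i`. -/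
structure IsReal : Prop where
  glue : ∀ i j, ∀ a ∈ S.glue i j, conj a ∈ S.glue i j
  D : ∀ i, (S.D i).map (starRingEnd ℂ) = S.D i
  R : ∀ k, ∃ m, S.R m = ((S.R k).1, conj (S.R k).2) ∧ S.d m = conj (S.d k)
  Ω : ∀ i, (S.Ω i).num.map (starRingEnd ℂ) = (S.Ω i).num ∧
    (S.Ω i).denom.map (starRingEnd ℂ) = (S.Ω i).denom

end SpectralData

/-! ### Flat metrics, Egorov metrics and the associativity equations

Everything below is stated over `𝕜 = ℝ` (pseudo-Riemannian metrics) and `𝕜 = ℂ` (holomorphic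
metrics) at the same time. -/

section Metrics

variable {𝕜 : Type*} [RCLike 𝕜] {N : ℕ}

/-- Partial derivative `∂f/∂uⁱ` at `u`. -/
def pd (i : Fin N) (f : (Fin N → 𝕜) → 𝕜) (u : Fin N → 𝕜) : 𝕜 :=
  fderiv 𝕜 f u (Pi.single i 1)

/-- Christoffel symbols `Γ^k_{ij}` of the metric `g`. -/
def christoffel (g : (Fin N → 𝕜) → Matrix (Fin N) (Fin N) 𝕜) (k i j : Fin N)
    (u : Fin N → 𝕜) : 𝕜 :=
  2⁻¹ * ∑ m, (g u)⁻¹ k m *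
    (pd i (fun y => g y m j) u + pd j (fun y => g y m i) u - pd m (fun y => g y i j) u)

/-- Components `R^m_{kij}` of the Riemann curvature tensor of the metric `g`. -/
def riemann (g : (Fin N → 𝕜) → Matrix (Fin N) (Fin N) 𝕜) (m k i j : Fin N)
    (u : Fin N → 𝕜) : 𝕜 :=
  pd i (christoffel g m j k) u - pd j (christoffel g m i k) u +
    ∑ p, (christoffel g m i p u * christoffel g p j k u
      - christoffel g m j p u * christoffel g p i k u)

/-- The metric `g` has zero curvature on `U`. -/
def IsFlat (U : Set (Fin N → 𝕜)) (g : (Fin N → 𝕜) → Matrix (Fin N) (Fin N) 𝕜) : Prop :=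
  ∀ u ∈ U, ∀ m k i j, riemann g m k i j u = 0

/-- The diagonal metric `∑ e_i H_i² (duⁱ)²`. -/
def diagMetric (e : Fin N → 𝕜) (H : (Fin N → 𝕜) → Fin N → 𝕜) (u : Fin N → 𝕜) :
    Matrix (Fin N) (Fin N) 𝕜 :=
  Matrix.diagonal fun i => e i * H u i ^ 2

/-- Rotation coefficients `β_{ij} = H_j⁻¹ ∂H_i/∂u^j`. -/
def rotation (H : (Fin N → 𝕜) → Fin N → 𝕜) (i j : Fin N) (u : Fin N → 𝕜) : 𝕜 :=
  (H u j)⁻¹ * pd j (fun y => H y i) u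

/-- The metric `∑ e_i H_i² (duⁱ)²` satisfies the Egorov condition in the coordinates `u`. -/
def IsEgorov (U : Set (Fin N → 𝕜)) (e : Fin N → 𝕜) (H : (Fin N → 𝕜) → Fin N → 𝕜) : Prop :=
  ∀ u ∈ U, ∀ i j, rotation H i j u = e i * e j * rotation H j i u

/-- On the open set `U` the functions `H_i` are nowhere vanishing Lame coefficients of a flat
Egorov metric with the signs `e_i`, and this metric is the pullback of the constant
nondegenerate metric `η_{kl} dx^k dx^l` under the map `x`. -/
structure IsFlatEgorov (U : Set (Fin N → 𝕜)) (e : Fin N → 𝕜) (H : (Fin N → 𝕜) → Fin N → 𝕜)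
    (η : Matrix (Fin N) (Fin N) 𝕜) (x : (Fin N → 𝕜) → Fin N → 𝕜) : Prop where
  isOpen : IsOpen U
  sign : ∀ i, e i = 1 ∨ e i = -1
  smooth_H : ContDiffOn 𝕜 ∞ H U
  H_ne_zero : ∀ u ∈ U, ∀ i, H u i ≠ 0
  η_symm : η.IsSymm
  η_det : η.det ≠ 0
  smooth_x : ContDiffOn 𝕜 ∞ x U
  metric_eq : ∀ u ∈ U, ∀ i j,
    ∑ k, ∑ m, η k m * pd i (fun y => x y k) u * pd j (fun y => x y m) u = diagMetric e H u i j
  flat : IsFlat U (diagMetric e H)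
  egorov : IsEgorov U e H

/-- `v` expresses the coordinates `u ∈ U` through the coordinates `x` on the open set `W` of the
`x`-space: a smooth local inverse of `u ↦ x(u)`. -/
structure IsBranch (U : Set (Fin N → 𝕜)) (x : (Fin N → 𝕜) → Fin N → 𝕜)
    (W : Set (Fin N → 𝕜)) (v : (Fin N → 𝕜) → Fin N → 𝕜) : Prop where
  isOpen : IsOpen W
  smooth : ContDiffOn 𝕜 ∞ v W
  mapsTo : Set.MapsTo v W U
  rightInv : ∀ w ∈ W, x (v w) = w

/-- The correlators
`c_{αβγ}(x) = ∑_i e_i H_i² (∂uⁱ/∂x^α) (∂uⁱ/∂x^β) (∂uⁱ/∂x^γ)` with `u = v(x)`. -/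
def correlator (e : Fin N → 𝕜) (H : (Fin N → 𝕜) → Fin N → 𝕜) (v : (Fin N → 𝕜) → Fin N → 𝕜)
    (α β γ : Fin N) (w : Fin N → 𝕜) : 𝕜 :=
  ∑ i, e i * H (v w) i ^ 2 *
    pd α (fun y => v y i) w * pd β (fun y => v y i) w * pd γ (fun y => v y i) w

/-- Third partial derivative of `F`. -/
def pd3 (F : (Fin N → 𝕜) → 𝕜) (α β γ : Fin N) (w : Fin N → 𝕜) : 𝕜 :=
  pd α (pd β (pd γ F)) w

/-- `F` satisfies the associativity equations on `W` with the constant metric `η`. -/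
def SolvesAssociativity (W : Set (Fin N → 𝕜)) (η : Matrix (Fin N) (Fin N) 𝕜)
    (F : (Fin N → 𝕜) → 𝕜) : Prop :=
  ∀ w ∈ W, ∀ α β γ δ,
    ∑ p, ∑ q, pd3 F α β p w * η⁻¹ p q * pd3 F γ δ q w =
      ∑ p, ∑ q, pd3 F γ β p w * η⁻¹ p q * pd3 F α δ q w

/-- Near every point of `U` the functions `x` are coordinates in which the correlators are the
third derivatives of a solution `F` of the associativity equations. -/
def GivesAssociativity (U : Set (Fin N → 𝕜)) (e : Fin N → 𝕜) (H : (Fin N → 𝕜) → Fin N → 𝕜)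
    (η : Matrix (Fin N) (Fin N) 𝕜) (x : (Fin N → 𝕜) → Fin N → 𝕜) : Prop :=
  ∀ u ∈ U, ∃ (W : Set (Fin N → 𝕜)) (v : (Fin N → 𝕜) → Fin N → 𝕜) (F : (Fin N → 𝕜) → 𝕜),
    IsBranch U x W v ∧ x u ∈ W ∧ v (x u) = u ∧ ContDiffOn 𝕜 ∞ F W ∧
    (∀ w ∈ W, ∀ α β γ, pd3 F α β γ w = correlator e H v α β γ w) ∧
    SolvesAssociativity W η F

/-- The correlators are homogeneous of degree `-1`: `c(λ x) = λ⁻¹ c(x)` for every branch of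
`u(x)`. Since `u(x)` is multivalued in general, the points `x` and `λ x` are required to be
joined by a segment in the domain of the branch. -/
def CorrelatorsHomogeneous (U : Set (Fin N → 𝕜)) (e : Fin N → 𝕜)
    (H : (Fin N → 𝕜) → Fin N → 𝕜) (x : (Fin N → 𝕜) → Fin N → 𝕜) : Prop :=
  ∀ (W : Set (Fin N → 𝕜)) (v : (Fin N → 𝕜) → Fin N → 𝕜), IsBranch U x W v →
    ∀ w ∈ W, ∀ c : 𝕜, c ≠ 0 → segment ℝ w (c • w) ⊆ W →
      ∀ α β γ, correlator e H v α β γ (c • w) = c⁻¹ * correlator e H v α β γ w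

end Metrics

end FiniteGap

end

namespace FiniteGap

section Calculus

variable {𝕜 : Type*} [RCLike 𝕜] {N : ℕ} {U : Set (Fin N → 𝕜)} {u : Fin N → 𝕜}
  {f g : (Fin N → 𝕜) → 𝕜}

theorem fderiv_apply_eq_sum_pd (f : (Fin N → 𝕜) → 𝕜) (u w : Fin N → 𝕜) :
    fderiv 𝕜 f u w = ∑ i, w i * pd i f u := by
  conv_lhs => rw [pi_eq_sum_univ' w, map_sum]
  refine Finset.sum_congr rfl fun i _ => ?_
  rw [map_smul, smul_eq_mul, pd]

theorem pd_congr (i : Fin N) (h : f =ᶠ[𝓝 u] g) : pd i f u = pd i g u := by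
  rw [pd, pd, h.fderiv_eq]

theorem pd_congr_of_isOpen (hU : IsOpen U) (hu : u ∈ U) (i : Fin N) (h : ∀ y ∈ U, f y = g y) :
    pd i f u = pd i g u :=
  pd_congr i (eventually_of_mem (hU.mem_nhds hu) h)

theorem pd_add (i : Fin N) (hf : DifferentiableAt 𝕜 f u) (hg : DifferentiableAt 𝕜 g u) :
    pd i (fun y => f y + g y) u = pd i f u + pd i g u := by
  simp only [pd]
  rw [fderiv_fun_add hf hg]
  rfl

theorem pd_sub (i : Fin N) (hf : DifferentiableAt 𝕜 f u) (hg : DifferentiableAt 𝕜 g u) :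
    pd i (fun y => f y - g y) u = pd i f u - pd i g u := by
  simp only [pd]
  rw [fderiv_fun_sub hf hg]
  rfl

theorem pd_mul (i : Fin N) (hf : DifferentiableAt 𝕜 f u) (hg : DifferentiableAt 𝕜 g u) :
    pd i (fun y => f y * g y) u = pd i f u * g u + f u * pd i g u := by
  simp only [pd]
  rw [fderiv_fun_mul hf hg]
  simp [mul_comm, add_comm]

theorem pd_const_mul (i : Fin N) (c : 𝕜) (hf : DifferentiableAt 𝕜 f u) :
    pd i (fun y => c * f y) u = c * pd i f u := by
  simp only [pd]
  rw [fderiv_const_mul hf]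
  rfl

theorem pd_sum {ι : Type*} (s : Finset ι) {F : ι → (Fin N → 𝕜) → 𝕜} (i : Fin N)
    (hF : ∀ a ∈ s, DifferentiableAt 𝕜 (F a) u) :
    pd i (fun y => ∑ a ∈ s, F a y) u = ∑ a ∈ s, pd i (F a) u := by
  simp only [pd]
  rw [fderiv_fun_sum hF]
  simp

theorem pd_const (i : Fin N) (c : 𝕜) : pd i (fun _ => c) u = 0 := by
  simp [pd]

theorem pd_coord (i j : Fin N) : pd i (fun y : Fin N → 𝕜 => y j) u = if i = j then 1 else 0 := by
  have : HasFDerivAt (fun y : Fin N → 𝕜 => y j)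
    (ContinuousLinearMap.proj (R := 𝕜) (φ := fun _ : Fin N => 𝕜) j) u :=
    (ContinuousLinearMap.proj (R := 𝕜) (φ := fun _ : Fin N => 𝕜) j).hasFDerivAt
  rw [pd, this.fderiv]
  simp [Pi.single_apply, eq_comm]

theorem pd_linear (i : Fin N) (c : Fin N → 𝕜) :
    pd i (fun y : Fin N → 𝕜 => ∑ j, c j * y j) u = c i := by
  rw [pd_sum _ _ fun j _ => by fun_prop, Finset.sum_eq_single i]
  · rw [pd_const_mul i _ (by fun_prop), pd_coord, if_pos rfl, mul_one]
  · intro j _ hj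
    rw [pd_const_mul i _ (by fun_prop), pd_coord, if_neg hj.symm, mul_zero]
  · simp

theorem contDiffOn_pd (hU : IsOpen U) (hf : ContDiffOn 𝕜 ∞ f U) (i : Fin N) :
    ContDiffOn 𝕜 ∞ (pd i f) U :=
  ((contDiffOn_infty_iff_fderiv_of_isOpen hU).1 hf).2.clm_apply contDiffOn_const

theorem differentiableAt_of_contDiffOn {E : Type*} [NormedAddCommGroup E] [NormedSpace 𝕜 E]
    {f : (Fin N → 𝕜) → E} (hU : IsOpen U) (hf : ContDiffOn 𝕜 ∞ f U)
    (hu : u ∈ U) : DifferentiableAt 𝕜 f u :=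
  (hf.contDiffAt (hU.mem_nhds hu)).differentiableAt (by simp)

theorem pd_comm (hU : IsOpen U) (hf : ContDiffOn 𝕜 ∞ f U) (hu : u ∈ U) (i j : Fin N) :
    pd i (pd j f) u = pd j (pd i f) u := by
  have hs := (hf.contDiffAt (hU.mem_nhds hu)).isSymmSndFDerivAt
    (by rw [minSmoothness_of_isRCLikeNormedField]; exact WithTop.coe_le_coe.2 (le_top : (2 : ℕ∞) ≤ ⊤))
  have hd : DifferentiableAt 𝕜 (fderiv 𝕜 f) u :=
    differentiableAt_of_contDiffOn hU ((contDiffOn_infty_iff_fderiv_of_isOpen hU).1 hf).2 hu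
  have key : ∀ a b : Fin N, pd a (pd b f) u =
      fderiv 𝕜 (fderiv 𝕜 f) u (Pi.single a 1) (Pi.single b 1) := by
    intro a b
    change fderiv 𝕜 (fun y => fderiv 𝕜 f y (Pi.single b 1)) u (Pi.single a 1) = _
    rw [fderiv_clm_apply hd (differentiableAt_const _)]
    simp
  rw [key, key, hs.eq]

theorem pd_comp {v : (Fin N → 𝕜) → Fin N → 𝕜} {w : Fin N → 𝕜} (i : Fin N)
    (hf : DifferentiableAt 𝕜 f (v w)) (hv : DifferentiableAt 𝕜 v w) :
    pd i (fun y => f (v y)) w = ∑ j, pd j f (v w) * pd i (fun y => v y j) w := by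
  have hc : HasFDerivAt (fun y => f (v y)) ((fderiv 𝕜 f (v w)).comp (fderiv 𝕜 v w)) w :=
    hf.hasFDerivAt.comp w hv.hasFDerivAt
  rw [pd, hc.fderiv, ContinuousLinearMap.comp_apply, fderiv_apply_eq_sum_pd]
  refine Finset.sum_congr rfl fun j _ => ?_
  rw [mul_comm, pd]
  congr 1
  have h2 : HasFDerivAt (fun y => v y j)
      ((ContinuousLinearMap.proj (R := 𝕜) (φ := fun _ : Fin N => 𝕜) j).comp (fderiv 𝕜 v w)) w :=
    hasFDerivAt_pi'.1 hv.hasFDerivAt j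
  rw [pd, h2.fderiv]
  rfl

end Calculus

section Frames

variable {𝕜 : Type*} [RCLike 𝕜] {N : ℕ}

/-- A flat coordinate system `x` of the metric `∑ e_i H_i² (duⁱ)²` with the Christoffel symbols
`Γ`, and functions `f` whose covariant Hessians are `δ_{ij} ∂x/∂uⁱ`. -/
structure IsFlatFrame (U : Set (Fin N → 𝕜)) (e : Fin N → 𝕜) (H : (Fin N → 𝕜) → Fin N → 𝕜)
    (η : Matrix (Fin N) (Fin N) 𝕜) (x f : (Fin N → 𝕜) → Fin N → 𝕜)
    (Γ : Fin N → Fin N → Fin N → (Fin N → 𝕜) → 𝕜) : Prop where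
  isOpen : IsOpen U
  sign : ∀ i, e i = 1 ∨ e i = -1
  smooth_H : ContDiffOn 𝕜 ∞ H U
  H_ne_zero : ∀ u ∈ U, ∀ i, H u i ≠ 0
  η_symm : η.IsSymm
  η_det : η.det ≠ 0
  smooth_x : ContDiffOn 𝕜 ∞ x U
  smooth_f : ContDiffOn 𝕜 ∞ f U
  differentiable_Γ : ∀ k i j, DifferentiableOn 𝕜 (Γ k i j) U
  metric_eq : ∀ u ∈ U, ∀ i j,
    ∑ k, ∑ m, η k m * pd i (fun y => x y k) u * pd j (fun y => x y m) u = diagMetric e H u i j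
  gauss_x : ∀ u ∈ U, ∀ i j k, pd i (pd j fun y => x y k) u =
    ∑ p, Γ p i j u * pd p (fun y => x y k) u
  gauss_f : ∀ u ∈ U, ∀ i j k, pd i (pd j fun y => f y k) u =
    ∑ p, Γ p i j u * pd p (fun y => f y k) u + if i = j then pd i (fun y => x y k) u else 0

namespace IsFlatFrame

variable {U : Set (Fin N → 𝕜)} {e : Fin N → 𝕜} {H : (Fin N → 𝕜) → Fin N → 𝕜}
  {η : Matrix (Fin N) (Fin N) 𝕜} {x f : (Fin N → 𝕜) → Fin N → 𝕜}
  {Γ : Fin N → Fin N → Fin N → (Fin N → 𝕜) → 𝕜} {u : Fin N → 𝕜}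

theorem smooth_x_apply (F : IsFlatFrame U e H η x f Γ) (k : Fin N) :
    ContDiffOn 𝕜 ∞ (fun y => x y k) U := contDiffOn_pi.1 F.smooth_x k

theorem smooth_f_apply (F : IsFlatFrame U e H η x f Γ) (k : Fin N) :
    ContDiffOn 𝕜 ∞ (fun y => f y k) U := contDiffOn_pi.1 F.smooth_f k

/-- Jacobi matrix of the flat coordinates. -/
noncomputable def jac (x : (Fin N → 𝕜) → Fin N → 𝕜) (u : Fin N → 𝕜) : Matrix (Fin N) (Fin N) 𝕜 :=
  Matrix.of fun k i => pd i (fun y => x y k) u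

theorem sq_ne_zero (F : IsFlatFrame U e H η x f Γ) (hu : u ∈ U) (i : Fin N) :
    e i * H u i ^ 2 ≠ 0 := by
  have h1 := F.H_ne_zero u hu i
  rcases F.sign i with h | h <;> simp [h, h1]

theorem jac_metric (F : IsFlatFrame U e H η x f Γ) (hu : u ∈ U) :
    (jac x u).transpose * η * jac x u = diagMetric e H u := by
  ext i j
  rw [← F.metric_eq u hu, Matrix.mul_apply]
  simp only [Matrix.mul_apply, Finset.sum_mul]
  rw [Finset.sum_comm]
  refine Finset.sum_congr rfl fun k _ => Finset.sum_congr rfl fun m _ => ?_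
  simp only [jac, Matrix.transpose_apply, Matrix.of_apply]
  ring

theorem jac_det (F : IsFlatFrame U e H η x f Γ) (hu : u ∈ U) : (jac x u).det ≠ 0 := by
  intro h0
  have h1 := congrArg Matrix.det (F.jac_metric hu)
  rw [Matrix.det_mul, h0, mul_zero, diagMetric, Matrix.det_diagonal] at h1
  exact Finset.prod_ne_zero_iff.2 (fun i _ => F.sq_ne_zero hu i) h1.symm

theorem eq_zero_of_sum (F : IsFlatFrame U e H η x f Γ) (hu : u ∈ U) {c : Fin N → 𝕜}
    (hc : ∀ k, ∑ p, c p * pd p (fun y => x y k) u = 0) : c = 0 := by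
  refine Matrix.eq_zero_of_mulVec_eq_zero (F.jac_det hu) (funext fun k => ?_)
  rw [Matrix.mulVec, dotProduct, Pi.zero_apply, ← hc k]
  exact Finset.sum_congr rfl fun p _ => mul_comm _ _

theorem Γ_symm (F : IsFlatFrame U e H η x f Γ) (hu : u ∈ U) (p i j : Fin N) :
    Γ p i j u = Γ p j i u := by
  have := F.eq_zero_of_sum hu (c := fun p => Γ p i j u - Γ p j i u) fun k => by
    simp only [sub_mul, Finset.sum_sub_distrib]
    rw [← F.gauss_x u hu, ← F.gauss_x u hu, pd_comm F.isOpen (F.smooth_x_apply k) hu, sub_self]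
  exact sub_eq_zero.1 (congrFun this p)

theorem pd_metric (F : IsFlatFrame U e H η x f Γ) (hu : u ∈ U) (i m j : Fin N) :
    pd i (fun y => diagMetric e H y m j) u =
      ∑ p, Γ p i m u * diagMetric e H u p j + ∑ p, Γ p i j u * diagMetric e H u m p := by
  have hd : ∀ a k, DifferentiableAt 𝕜 (pd a fun y => x y k) u := fun a k =>
    differentiableAt_of_contDiffOn F.isOpen (contDiffOn_pd F.isOpen (F.smooth_x_apply k) a) hu
  rw [← pd_congr_of_isOpen F.isOpen hu i fun y hy => F.metric_eq y hy m j]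
  rw [pd_sum _ _ fun k _ => by fun_prop]
  simp only [← F.metric_eq u hu, Finset.mul_sum]
  rw [Finset.sum_comm (f := fun p k => ∑ a, Γ p i m u * _),
    Finset.sum_comm (f := fun p k => ∑ a, Γ p i j u * _), ← Finset.sum_add_distrib]
  refine Finset.sum_congr rfl fun k _ => ?_
  rw [pd_sum _ _ fun k _ => by fun_prop, Finset.sum_comm, Finset.sum_comm (s := Finset.univ)
    (f := fun p a => Γ p i j u * _), ← Finset.sum_add_distrib]
  refine Finset.sum_congr rfl fun l _ => ?_
  rw [pd_mul i (by fun_prop) (hd _ _), pd_const_mul i _ (hd _ _), F.gauss_x u hu, F.gauss_x u hu,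
    Finset.mul_sum, Finset.mul_sum, Finset.sum_mul]
  congr 1 <;> exact Finset.sum_congr rfl fun p _ => by ring

theorem christoffel_eq (F : IsFlatFrame U e H η x f Γ) (hu : u ∈ U) (k i j : Fin N) :
    christoffel (diagMetric e H) k i j u = Γ k i j u := by
  have hdet : IsUnit (diagMetric e H u).det := by
    rw [diagMetric, Matrix.det_diagonal, isUnit_iff_ne_zero]
    exact Finset.prod_ne_zero_iff.2 fun i _ => F.sq_ne_zero hu i
  have hsymm : ∀ a b, diagMetric e H u a b = diagMetric e H u b a := fun a b => by
    rw [diagMetric, ← Matrix.transpose_apply (Matrix.diagonal _), Matrix.diagonal_transpose]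
  have key : ∀ m, pd i (fun y => diagMetric e H y m j) u + pd j (fun y => diagMetric e H y m i) u
      - pd m (fun y => diagMetric e H y i j) u =
      2 * ∑ p, diagMetric e H u m p * Γ p i j u := by
    intro m
    rw [F.pd_metric hu, F.pd_metric hu, F.pd_metric hu]
    simp only [F.Γ_symm hu _ m i, F.Γ_symm hu _ m j, F.Γ_symm hu _ j i, hsymm i]
    rw [Finset.mul_sum]
    simp only [← Finset.sum_add_distrib, ← Finset.sum_sub_distrib]
    exact Finset.sum_congr rfl fun p _ => by ring
  rw [christoffel]
  simp only [key]
  have h2 : ((diagMetric e H u)⁻¹ * diagMetric e H u).mulVec (fun p => Γ p i j u) k = Γ k i j u := by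
    rw [Matrix.nonsing_inv_mul _ hdet, Matrix.one_mulVec]
  rw [← Matrix.mulVec_mulVec] at h2
  rw [← h2, Matrix.mulVec, dotProduct, Finset.mul_sum]
  refine Finset.sum_congr rfl fun m _ => ?_
  rw [Matrix.mulVec, dotProduct]
  ring

theorem isFlat (F : IsFlatFrame U e H η x f Γ) : IsFlat U (diagMetric e H) := by
  intro u hu m k i j
  have hd : ∀ a k, DifferentiableAt 𝕜 (pd a fun y => x y k) u := fun a k =>
    differentiableAt_of_contDiffOn F.isOpen (contDiffOn_pd F.isOpen (F.smooth_x_apply k) a) hu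
  have hΓ : ∀ k i j, DifferentiableAt 𝕜 (Γ k i j) u := fun k i j =>
    (F.differentiable_Γ k i j).differentiableAt (F.isOpen.mem_nhds hu)
  have third : ∀ i j k a, pd i (pd j (pd k fun y => x y a)) u =
      ∑ m, (pd i (Γ m j k) u + ∑ p, Γ m i p u * Γ p j k u) * pd m (fun y => x y a) u := by
    intro i j k a
    rw [pd_congr_of_isOpen F.isOpen hu i fun y hy => F.gauss_x y hy j k a,
      pd_sum _ _ fun p _ => (hΓ _ _ _).fun_mul (hd _ _)]
    simp only [add_mul, Finset.sum_add_distrib, Finset.sum_mul]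
    rw [Finset.sum_comm (s := Finset.univ) (f := fun m p => Γ m i p u * _ * _),
      ← Finset.sum_add_distrib]
    refine Finset.sum_congr rfl fun p _ => ?_
    rw [pd_mul i (hΓ _ _ _) (hd _ _), F.gauss_x u hu, Finset.mul_sum]
    congr 1
    exact Finset.sum_congr rfl fun q _ => by ring
  have h0 := F.eq_zero_of_sum hu (c := fun m => (pd i (Γ m j k) u + ∑ p, Γ m i p u * Γ p j k u) -
    (pd j (Γ m i k) u + ∑ p, Γ m j p u * Γ p i k u)) fun a => by
      simp only [sub_mul, Finset.sum_sub_distrib]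
      rw [← third, ← third, pd_comm F.isOpen (contDiffOn_pd F.isOpen (F.smooth_x_apply a) k) hu,
        sub_self]
  have h1 := congrFun h0 m
  simp only [Pi.zero_apply] at h1
  rw [riemann, pd_congr_of_isOpen F.isOpen hu i fun y hy => F.christoffel_eq hy m j k,
    pd_congr_of_isOpen F.isOpen hu j fun y hy => F.christoffel_eq hy m i k, ← h1]
  simp only [F.christoffel_eq hu, Finset.sum_sub_distrib]
  ring

theorem isFlatEgorov (F : IsFlatFrame U e H η x f Γ)
    (hE : ∀ u ∈ U, ∀ i j, e i * H u i * pd j (fun y => H y i) u =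
      e j * H u j * pd i (fun y => H y j) u) : IsFlatEgorov U e H η x where
  isOpen := F.isOpen
  sign := F.sign
  smooth_H := F.smooth_H
  H_ne_zero := F.H_ne_zero
  η_symm := F.η_symm
  η_det := F.η_det
  smooth_x := F.smooth_x
  metric_eq := F.metric_eq
  flat := F.isFlat
  egorov := by
    intro u hu i j
    have h1 := hE u hu i j
    have hi := F.H_ne_zero u hu i
    have hj := F.H_ne_zero u hu j
    have he : e i * e i = 1 := by rcases F.sign i with h | h <;> simp [h]
    rw [rotation, rotation]
    field_simp
    linear_combination e i * h1 - H u i * pd j (fun y => H y i) u * he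

end IsFlatFrame

end Frames

end FiniteGap

namespace FiniteGap

section Branches

variable {𝕜 : Type*} [RCLike 𝕜] {N : ℕ} {U W : Set (Fin N → 𝕜)}
  {x v : (Fin N → 𝕜) → Fin N → 𝕜} {w : Fin N → 𝕜}

namespace IsBranch

theorem smooth_apply (B : IsBranch U x W v) (k : Fin N) :
    ContDiffOn 𝕜 ∞ (fun y => v y k) W := contDiffOn_pi.1 B.smooth k

theorem pd_pd_comp (B : IsBranch U x W v) (hU : IsOpen U) {φ : (Fin N → 𝕜) → 𝕜}
    (hφ : ContDiffOn 𝕜 ∞ φ U) (hw : w ∈ W) (α β : Fin N) :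
    pd α (pd β fun y => φ (v y)) w =
      ∑ j, ((∑ i, pd i (pd j φ) (v w) * pd α (fun y => v y i) w) * pd β (fun y => v y j) w
        + pd j φ (v w) * pd α (pd β fun y => v y j) w) := by
  have hv : ∀ y ∈ W, DifferentiableAt 𝕜 v y := fun y hy =>
    differentiableAt_of_contDiffOn B.isOpen B.smooth hy
  have hpd : ∀ j, DifferentiableAt 𝕜 (pd j φ) (v w) := fun j =>
    differentiableAt_of_contDiffOn hU (contDiffOn_pd hU hφ j) (B.mapsTo hw)
  have hpv : ∀ j, DifferentiableAt 𝕜 (pd β fun y => v y j) w := fun j =>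
    differentiableAt_of_contDiffOn B.isOpen (contDiffOn_pd B.isOpen (B.smooth_apply j) β) hw
  have hc : ∀ j, DifferentiableAt 𝕜 (fun y => pd j φ (v y)) w := fun j => (hpd j).comp w (hv w hw)
  rw [pd_congr_of_isOpen B.isOpen hw α fun y hy =>
    pd_comp β (differentiableAt_of_contDiffOn hU hφ (B.mapsTo hy)) (hv y hy),
    pd_sum _ _ fun j _ => (hc j).fun_mul (hpv j)]
  refine Finset.sum_congr rfl fun j _ => ?_
  rw [pd_mul α (hc j) (hpv j), pd_comp α (hpd j) (hv w hw)]

theorem sum_pd_mul_pd (B : IsBranch U x W v) (hU : IsOpen U) (hx : ContDiffOn 𝕜 ∞ x U)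
    (hw : w ∈ W) (k β : Fin N) :
    ∑ j, pd j (fun y => x y k) (v w) * pd β (fun y => v y j) w = if β = k then 1 else 0 := by
  rw [← pd_comp β (differentiableAt_of_contDiffOn hU (contDiffOn_pi.1 hx k) (B.mapsTo hw))
    (differentiableAt_of_contDiffOn B.isOpen B.smooth hw),
    pd_congr_of_isOpen B.isOpen hw β (g := fun y => y k) fun y hy => by rw [B.rightInv y hy],
    pd_coord]

end IsBranch

theorem sum_comm_pairs {ι M : Type*} [Fintype ι] [AddCommMonoid M] (t : ι → ι → ι → ι → M) :
    ∑ p, ∑ q, ∑ j, ∑ i, t p q j i = ∑ i, ∑ j, ∑ p, ∑ q, t p q j i := by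
  calc _ = ∑ p, ∑ q, ∑ i, ∑ j, t p q j i := by
        refine Finset.sum_congr rfl fun p _ => Finset.sum_congr rfl fun q _ => Finset.sum_comm
    _ = ∑ p, ∑ i, ∑ q, ∑ j, t p q j i := Finset.sum_congr rfl fun p _ => Finset.sum_comm
    _ = ∑ i, ∑ p, ∑ j, ∑ q, t p q j i := by
        rw [Finset.sum_comm]
        refine Finset.sum_congr rfl fun i _ => Finset.sum_congr rfl fun p _ => Finset.sum_comm
    _ = _ := Finset.sum_congr rfl fun i _ => Finset.sum_comm

namespace IsFlatFrame

variable {e : Fin N → 𝕜} {H : (Fin N → 𝕜) → Fin N → 𝕜}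
  {η : Matrix (Fin N) (Fin N) 𝕜} {f : (Fin N → 𝕜) → Fin N → 𝕜}
  {Γ : Fin N → Fin N → Fin N → (Fin N → 𝕜) → 𝕜}

theorem jac_mul_jac (F : IsFlatFrame U e H η x f Γ) (B : IsBranch U x W v) (hw : w ∈ W) :
    jac x (v w) * jac v w = 1 := by
  ext k β
  rw [Matrix.mul_apply, Matrix.one_apply]
  simp only [jac, Matrix.of_apply]
  rw [B.sum_pd_mul_pd F.isOpen F.smooth_x hw]
  simp [eq_comm]

theorem sq_mul_pd (F : IsFlatFrame U e H η x f Γ) (B : IsBranch U x W v) (hw : w ∈ W)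
    (i γ : Fin N) : e i * H (v w) i ^ 2 * pd γ (fun y => v y i) w =
      ∑ m, η γ m * pd i (fun y => x y m) (v w) := by
  have h1 : diagMetric e H (v w) * jac v w = (jac x (v w)).transpose * η := by
    rw [← F.jac_metric (B.mapsTo hw), Matrix.mul_assoc, F.jac_mul_jac B hw, Matrix.mul_one]
  have h2 := congrFun (congrFun h1 i) γ
  rw [diagMetric, Matrix.diagonal_mul, Matrix.mul_apply] at h2
  simp only [jac, Matrix.of_apply, Matrix.transpose_apply] at h2
  rw [h2]
  refine Finset.sum_congr rfl fun m _ => ?_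
  rw [mul_comm, F.η_symm.apply]

theorem inv_metric (F : IsFlatFrame U e H η x f Γ) (B : IsBranch U x W v) (hw : w ∈ W) :
    (jac v w * η⁻¹ * (jac v w).transpose) * diagMetric e H (v w) = 1 := by
  have hη : IsUnit η.det := isUnit_iff_ne_zero.2 F.η_det
  have h1 := F.jac_mul_jac B hw
  have h2 : (jac v w).transpose * (jac x (v w)).transpose = 1 := by
    rw [← Matrix.transpose_mul, h1, Matrix.transpose_one]
  rw [← F.jac_metric (B.mapsTo hw)]
  calc _ = jac v w * η⁻¹ * ((jac v w).transpose * (jac x (v w)).transpose) * η * jac x (v w) := by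
        simp only [Matrix.mul_assoc]
    _ = jac v w * (η⁻¹ * η) * jac x (v w) := by
        rw [h2]; simp only [Matrix.mul_assoc, Matrix.one_mul]
    _ = 1 := by rw [Matrix.nonsing_inv_mul _ hη, Matrix.mul_one, mul_eq_one_comm.1 h1]

theorem pd_pd_f (F : IsFlatFrame U e H η x f Γ) (B : IsBranch U x W v) (hw : w ∈ W)
    (α β m : Fin N) : pd α (pd β fun y => f (v y) m) w =
      ∑ i, pd α (fun y => v y i) w * pd β (fun y => v y i) w * pd i (fun y => x y m) (v w) := by
  have hu := B.mapsTo hw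
  have expand : ∀ φ : Fin N → 𝕜,
      ∑ j, ((∑ i, (∑ p, Γ p i j (v w) * φ p) * pd α (fun y => v y i) w) *
        pd β (fun y => v y j) w + φ j * pd α (pd β fun y => v y j) w) =
      ∑ p, (∑ j, ∑ i, Γ p i j (v w) * pd α (fun y => v y i) w * pd β (fun y => v y j) w
        + pd α (pd β fun y => v y p) w) * φ p := by
    intro φ
    simp only [Finset.sum_add_distrib, add_mul, Finset.sum_mul]
    congr 1
    · rw [Finset.sum_comm (s := Finset.univ) (t := Finset.univ)
        (f := fun p j => ∑ i, Γ p i j (v w) * _ * _ * φ p)]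
      refine Finset.sum_congr rfl fun j _ => ?_
      rw [Finset.sum_comm]
      exact Finset.sum_congr rfl fun p _ => Finset.sum_congr rfl fun i _ => by ring
    · exact Finset.sum_congr rfl fun p _ => by ring
  have hz := F.eq_zero_of_sum hu (c := fun p => ∑ j, ∑ i, Γ p i j (v w) *
      pd α (fun y => v y i) w * pd β (fun y => v y j) w + pd α (pd β fun y => v y p) w) fun k => by
    rw [← expand]
    simp only [← F.gauss_x _ hu]
    rw [← B.pd_pd_comp F.isOpen (F.smooth_x_apply k) hw, pd_congr_of_isOpen B.isOpen hw α
      (g := fun _ => if β = k then 1 else 0) fun y hy => ?_, pd_const]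
    rw [pd_congr_of_isOpen B.isOpen hy β (g := fun y => y k) fun y hy => by rw [B.rightInv y hy],
      pd_coord]
  rw [B.pd_pd_comp F.isOpen (F.smooth_f_apply m) hw]
  simp only [F.gauss_f _ hu]
  have hsplit : ∀ j, (∑ i, (∑ p, Γ p i j (v w) * pd p (fun y => f y m) (v w) +
      if i = j then pd i (fun y => x y m) (v w) else 0) * pd α (fun y => v y i) w) *
        pd β (fun y => v y j) w + pd j (fun y => f y m) (v w) * pd α (pd β fun y => v y j) w =
      ((∑ i, (∑ p, Γ p i j (v w) * pd p (fun y => f y m) (v w)) * pd α (fun y => v y i) w) *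
        pd β (fun y => v y j) w + pd j (fun y => f y m) (v w) * pd α (pd β fun y => v y j) w) +
      pd α (fun y => v y j) w * pd β (fun y => v y j) w * pd j (fun y => x y m) (v w) := by
    intro j
    simp only [add_mul, Finset.sum_add_distrib, ite_mul, zero_mul, Finset.sum_ite_eq',
      Finset.mem_univ, if_true]
    ring
  simp only [hsplit]
  rw [Finset.sum_add_distrib, expand]
  have hz' := congrFun hz
  simp only [Pi.zero_apply] at hz'
  simp only [hz', zero_mul, Finset.sum_const_zero, zero_add]

theorem pd_pd_potential (F : IsFlatFrame U e H η x f Γ) (B : IsBranch U x W v) (hw : w ∈ W)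
    (α β γ : Fin N) : pd α (pd β fun y => ∑ m, η γ m * f (v y) m) w =
      correlator e H v α β γ w := by
  have hf : ∀ m, ContDiffOn 𝕜 ∞ (fun y => f (v y) m) W := fun m =>
    (F.smooth_f_apply m).comp B.smooth B.mapsTo
  have h1 : ∀ y ∈ W, pd β (fun y => ∑ m, η γ m * f (v y) m) y =
      ∑ m, η γ m * pd β (fun y => f (v y) m) y := fun y hy => by
    have hd : ∀ m, DifferentiableAt 𝕜 (fun y => f (v y) m) y := fun m =>
      differentiableAt_of_contDiffOn B.isOpen (hf m) hy
    rw [pd_sum _ _ fun m _ => (hd m).const_mul _]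
    exact Finset.sum_congr rfl fun m _ => pd_const_mul β _ (hd m)
  have hd : ∀ m, DifferentiableAt 𝕜 (pd β fun y => f (v y) m) w := fun m =>
    differentiableAt_of_contDiffOn B.isOpen (contDiffOn_pd B.isOpen (hf m) β) hw
  rw [pd_congr_of_isOpen B.isOpen hw α h1, pd_sum _ _ fun m _ => (hd m).const_mul _, correlator]
  simp only [pd_const_mul α _ (hd _), F.pd_pd_f B hw, Finset.mul_sum]
  rw [Finset.sum_comm]
  refine Finset.sum_congr rfl fun i _ => ?_
  have := F.sq_mul_pd B hw i γ
  rw [show e i * H (v w) i ^ 2 * pd α (fun y => v y i) w * pd β (fun y => v y i) w *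
    pd γ (fun y => v y i) w = pd α (fun y => v y i) w * pd β (fun y => v y i) w *
    (e i * H (v w) i ^ 2 * pd γ (fun y => v y i) w) by ring, this, Finset.mul_sum]
  exact Finset.sum_congr rfl fun m _ => by ring

theorem correlator_product (F : IsFlatFrame U e H η x f Γ) (B : IsBranch U x W v) (hw : w ∈ W)
    (α β γ δ : Fin N) :
    ∑ p, ∑ q, correlator e H v α β p w * η⁻¹ p q * correlator e H v γ δ q w =
      ∑ i, e i * H (v w) i ^ 2 * pd α (fun y => v y i) w * pd β (fun y => v y i) w *
        pd γ (fun y => v y i) w * pd δ (fun y => v y i) w := by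
  have hinv : ∀ i j, (∑ p, ∑ q, pd p (fun y => v y i) w * η⁻¹ p q * pd q (fun y => v y j) w) *
      (e j * H (v w) j ^ 2) = if i = j then 1 else 0 := by
    intro i j
    have h1 := congrFun (congrFun (F.inv_metric B hw) i) j
    rw [diagMetric, Matrix.mul_diagonal, Matrix.one_apply, Matrix.mul_apply] at h1
    rw [← h1, Finset.sum_comm]
    congr 1
    refine Finset.sum_congr rfl fun q _ => ?_
    rw [Matrix.mul_apply, Finset.sum_mul]
    rfl
  simp only [correlator]
  calc _ = ∑ i, ∑ j, (e i * H (v w) i ^ 2 * pd α (fun y => v y i) w * pd β (fun y => v y i) w *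
        pd γ (fun y => v y j) w * pd δ (fun y => v y j) w) * ((∑ p, ∑ q, pd p (fun y => v y i) w *
          η⁻¹ p q * pd q (fun y => v y j) w) * (e j * H (v w) j ^ 2)) := by
        simp only [Finset.sum_mul, Finset.mul_sum]
        rw [sum_comm_pairs]
        refine Finset.sum_congr rfl fun i _ => Finset.sum_congr rfl fun j _ =>
          Finset.sum_congr rfl fun p _ => Finset.sum_congr rfl fun q _ => by ring
    _ = _ := by
        simp only [hinv, mul_ite, mul_one, mul_zero, Finset.sum_ite_eq, Finset.mem_univ, if_true]

theorem exists_hasFDerivAt_equiv (F : IsFlatFrame U e H η x f Γ) {y : Fin N → 𝕜} (hy : y ∈ U) :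
    ∃ E : (Fin N → 𝕜) ≃L[𝕜] (Fin N → 𝕜), HasFDerivAt x (E : (Fin N → 𝕜) →L[𝕜] (Fin N → 𝕜)) y := by
  have hd := (differentiableAt_of_contDiffOn F.isOpen F.smooth_x hy).hasFDerivAt
  have hinj : Function.Injective (fderiv 𝕜 x y : (Fin N → 𝕜) →ₗ[𝕜] (Fin N → 𝕜)) := by
    rw [← LinearMap.ker_eq_bot, LinearMap.ker_eq_bot']
    intro c hc
    refine F.eq_zero_of_sum hy fun k => ?_
    rw [← fderiv_apply_eq_sum_pd, (hasFDerivAt_pi'.1 hd k).fderiv]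
    exact congrFun hc k
  refine ⟨(LinearEquiv.ofInjectiveEndo _ hinj).toContinuousLinearEquiv, ?_⟩
  have hE : ((LinearEquiv.ofInjectiveEndo _ hinj).toContinuousLinearEquiv :
      (Fin N → 𝕜) →L[𝕜] (Fin N → 𝕜)) = fderiv 𝕜 x y := ContinuousLinearMap.ext fun c => rfl
  rw [hE]
  exact hd

end IsFlatFrame

/-- A closed smooth form on a ball has a smooth potential. -/
theorem exists_potential {w₀ : Fin N → 𝕜} {r : ℝ} {p : Fin N → (Fin N → 𝕜) → 𝕜}
    (hp : ∀ k, ContDiffOn 𝕜 ∞ (p k) (Metric.ball w₀ r))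
    (hc : ∀ y ∈ Metric.ball w₀ r, ∀ i j, pd i (p j) y = pd j (p i) y) :
    ∃ Φ : (Fin N → 𝕜) → 𝕜, ContDiffOn 𝕜 ∞ Φ (Metric.ball w₀ r) ∧
      ∀ y ∈ Metric.ball w₀ r, ∀ k, pd k Φ y = p k y := by
  let π : Fin N → (Fin N → 𝕜) →L[𝕜] 𝕜 := fun k => ContinuousLinearMap.proj k
  let θ : (Fin N → 𝕜) → (Fin N → 𝕜) →L[𝕜] 𝕜 := fun y =>
    ∑ k, p k y • π k
  let θ' : (Fin N → 𝕜) → (Fin N → 𝕜) →L[𝕜] (Fin N → 𝕜) →L[𝕜] 𝕜 := fun y =>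
    ∑ k, (fderiv 𝕜 (p k) y).smulRight (π k)
  have hθ : ContDiffOn 𝕜 ∞ θ (Metric.ball w₀ r) :=
    ContDiffOn.sum fun k _ => (hp k).smul contDiffOn_const
  have hd : ∀ y ∈ Metric.ball w₀ r, HasFDerivAt θ (θ' y) y := fun y hy =>
    HasFDerivAt.fun_sum fun k _ =>
      (differentiableAt_of_contDiffOn Metric.isOpen_ball (hp k) hy).hasFDerivAt.smul_const (π k)
  have hdR : ∀ y ∈ Metric.ball w₀ r,
      HasFDerivWithinAt θ ((fun y => (θ' y).restrictScalars ℝ) y) (Metric.ball w₀ r) y :=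
    fun y hy => ((hd y hy).restrictScalars ℝ).hasFDerivWithinAt
  obtain ⟨Φ, hΦ⟩ :=
    (convex_ball w₀ r).exists_forall_hasFDerivWithinAt_of_hasFDerivWithinAt_symmetric hdR (by
      intro y hy a _ b _
      simp only [θ', π, ContinuousLinearMap.coe_restrictScalars', sum_apply,
        ContinuousLinearMap.smulRight_apply, smul_apply,
        ContinuousLinearMap.proj_apply, smul_eq_mul, fderiv_apply_eq_sum_pd, Finset.sum_mul]
      rw [Finset.sum_comm]
      refine Finset.sum_congr rfl fun i _ => Finset.sum_congr rfl fun j _ => ?_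
      rw [hc y hy i j]
      ring)
  have hΦ' : ∀ y ∈ Metric.ball w₀ r, HasFDerivAt Φ (θ y) y := fun y hy =>
    (hΦ y hy).hasFDerivAt (Metric.isOpen_ball.mem_nhds hy)
  refine ⟨Φ, (contDiffOn_infty_iff_fderiv_of_isOpen Metric.isOpen_ball).2
    ⟨fun y hy => (hΦ' y hy).differentiableAt.differentiableWithinAt,
      hθ.congr fun y hy => (hΦ' y hy).fderiv⟩, fun y hy k => ?_⟩
  rw [pd, (hΦ' y hy).fderiv]
  simp [θ, π, Pi.single_apply]

namespace IsFlatFrame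

variable {e : Fin N → 𝕜} {H : (Fin N → 𝕜) → Fin N → 𝕜}
  {η : Matrix (Fin N) (Fin N) 𝕜} {f : (Fin N → 𝕜) → Fin N → 𝕜}
  {Γ : Fin N → Fin N → Fin N → (Fin N → 𝕜) → 𝕜}

theorem exists_branch (F : IsFlatFrame U e H η x f Γ) {u : Fin N → 𝕜} (hu : u ∈ U) :
    ∃ (r : ℝ) (v : (Fin N → 𝕜) → Fin N → 𝕜), 0 < r ∧ IsBranch U x (Metric.ball (x u) r) v ∧
      v (x u) = u := by
  obtain ⟨E, hE⟩ := F.exists_hasFDerivAt_equiv hu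
  have hc : ContDiffAt 𝕜 ∞ x u := F.smooth_x.contDiffAt (F.isOpen.mem_nhds hu)
  let Ψ := hc.toOpenPartialHomeomorph x hE (by simp)
  have hΨ : (Ψ : (Fin N → 𝕜) → Fin N → 𝕜) = x := hc.toOpenPartialHomeomorph_coe hE (by simp)
  have hsrc : u ∈ Ψ.source := hc.mem_toOpenPartialHomeomorph_source hE (by simp)
  have hinv : Ψ.symm (x u) = u := by
    have := Ψ.left_inv hsrc
    rwa [hΨ] at this
  have htgt : x u ∈ Ψ.target := by
    have := Ψ.map_source hsrc
    rwa [hΨ] at this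
  have hopen : IsOpen (Ψ.target ∩ Ψ.symm ⁻¹' U) := Ψ.isOpen_inter_preimage_symm F.isOpen
  obtain ⟨r, hr, hball⟩ := Metric.isOpen_iff.1 hopen (x u) ⟨htgt, by rw [Set.mem_preimage, hinv]; exact hu⟩
  refine ⟨r, Ψ.symm, hr, ⟨Metric.isOpen_ball, ?_, fun y hy => (hball hy).2, fun y hy => ?_⟩, hinv⟩
  · intro y hy
    obtain ⟨E', hE'⟩ := F.exists_hasFDerivAt_equiv (hball hy).2
    refine (Ψ.contDiffAt_symm (hball hy).1 (f₀' := E') (by rw [hΨ]; exact hE') ?_).contDiffWithinAt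
    rw [hΨ]
    exact F.smooth_x.contDiffAt (F.isOpen.mem_nhds (hball hy).2)
  · have := Ψ.right_inv (hball hy).1
    rwa [hΨ] at this

theorem givesAssociativity (F : IsFlatFrame U e H η x f Γ) : GivesAssociativity U e H η x := by
  intro u hu
  obtain ⟨r, v, hr, B, hvu⟩ := F.exists_branch hu
  let W := Metric.ball (x u) r
  have hW : IsOpen W := Metric.isOpen_ball
  have hxu : x u ∈ W := Metric.mem_ball_self hr
  let p : Fin N → (Fin N → 𝕜) → 𝕜 := fun γ y => ∑ m, η γ m * f (v y) m
  have hp : ∀ γ, ContDiffOn 𝕜 ∞ (p γ) W := fun γ => ContDiffOn.sum fun m _ =>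
    contDiffOn_const.mul ((F.smooth_f_apply m).comp B.smooth B.mapsTo)
  have hpp : ∀ y ∈ W, ∀ α β γ, pd α (pd β (p γ)) y = correlator e H v α β γ y :=
    fun y hy α β γ => F.pd_pd_potential B hy α β γ
  have hpd : ∀ y ∈ W, ∀ β γ, DifferentiableAt 𝕜 (pd β (p γ)) y := fun y hy β γ =>
    differentiableAt_of_contDiffOn hW (contDiffOn_pd hW (hp γ) β) hy
  let K : Fin N → Fin N → 𝕜 := fun β γ => pd β (p γ) (x u) - pd γ (p β) (x u)
  have hK : ∀ y ∈ W, ∀ β γ, pd β (p γ) y - pd γ (p β) y = K β γ := by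
    intro y hy β γ
    refine hW.is_const_of_fderiv_eq_zero (𝕜 := 𝕜) (f := fun y => pd β (p γ) y - pd γ (p β) y)
      (convex_ball _ _).isPreconnected
      (fun z hz => ((hpd z hz β γ).sub (hpd z hz γ β)).differentiableWithinAt)
      (fun z hz => ?_) hy hxu
    ext c
    rw [fderiv_apply_eq_sum_pd]
    refine Finset.sum_eq_zero fun α _ => ?_
    rw [pd_sub α (hpd z hz β γ) (hpd z hz γ β), hpp z hz, hpp z hz, correlator, correlator,
      ← Finset.sum_sub_distrib, Finset.sum_eq_zero fun i _ => by ring, mul_zero]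
  let q : Fin N → (Fin N → 𝕜) → 𝕜 := fun γ y => p γ y - ∑ α, 2⁻¹ * K α γ * y α
  have hlin : ∀ γ, ContDiffOn 𝕜 ∞ (fun y : Fin N → 𝕜 => ∑ α, 2⁻¹ * K α γ * y α) W := fun γ => by
    fun_prop
  have hq : ∀ γ, ContDiffOn 𝕜 ∞ (q γ) W := fun γ => (hp γ).sub (hlin γ)
  have hpq : ∀ y ∈ W, ∀ β γ, pd β (q γ) y = pd β (p γ) y - 2⁻¹ * K β γ := by
    intro y hy β γ
    rw [pd_sub β (differentiableAt_of_contDiffOn hW (hp γ) hy)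
      (differentiableAt_of_contDiffOn hW (hlin γ) hy), pd_linear β fun α => 2⁻¹ * K α γ]
  obtain ⟨Φ, hΦ, hΦq⟩ := exists_potential hq fun y hy i j => by
    rw [hpq y hy, hpq y hy]
    have h1 := hK y hy i j
    have h2 : K j i = - K i j := by simp only [K]; ring
    rw [h2]
    linear_combination h1
  have hcorr : ∀ w ∈ W, ∀ α β γ, pd3 Φ α β γ w = correlator e H v α β γ w := by
    intro w hw α β γ
    rw [← hpp w hw, pd3]
    have h1 : ∀ y ∈ W, pd β (pd γ Φ) y = pd β (p γ) y - 2⁻¹ * K β γ := fun y hy => by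
      rw [pd_congr_of_isOpen hW hy β fun z hz => hΦq z hz γ, hpq y hy]
    rw [pd_congr_of_isOpen hW hw α h1, pd_sub α (hpd w hw β γ) (differentiableAt_const _),
      pd_const, sub_zero]
  refine ⟨W, v, Φ, B, hxu, hvu, hΦ, hcorr, fun w hw α β γ δ => ?_⟩
  simp only [hcorr w hw]
  rw [F.correlator_product B hw, F.correlator_product B hw]
  exact Finset.sum_congr rfl fun i _ => by ring

end IsFlatFrame

end Branches

end FiniteGap

namespace FiniteGap

section Homogeneity

variable {𝕜 : Type*} [RCLike 𝕜] {N : ℕ} {U W : Set (Fin N → 𝕜)}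
  {x v : (Fin N → 𝕜) → Fin N → 𝕜} {w : Fin N → 𝕜}

/-- Euler's relation of degree `a` at the point `w`. -/
def EulerAt (a : 𝕜) (φ : (Fin N → 𝕜) → 𝕜) (w : Fin N → 𝕜) : Prop :=
  DifferentiableAt 𝕜 φ w ∧ fderiv 𝕜 φ w w = a * φ w

theorem EulerAt.mul {a b : 𝕜} {φ χ : (Fin N → 𝕜) → 𝕜} (hφ : EulerAt a φ w) (hχ : EulerAt b χ w) :
    EulerAt (a + b) (fun y => φ y * χ y) w := by
  refine ⟨hφ.1.mul hχ.1, ?_⟩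
  rw [fderiv_fun_mul hφ.1 hχ.1]
  simp only [add_apply, smul_apply, smul_eq_mul, hφ.2, hχ.2]
  ring

theorem EulerAt.const (c : 𝕜) : EulerAt 0 (fun _ : Fin N → 𝕜 => c) w := by
  simp [EulerAt]

theorem EulerAt.sum {ι : Type*} {s : Finset ι} {a : 𝕜} {φ : ι → (Fin N → 𝕜) → 𝕜}
    (hφ : ∀ i ∈ s, EulerAt a (φ i) w) : EulerAt a (fun y => ∑ i ∈ s, φ i y) w := by
  refine ⟨DifferentiableAt.fun_sum fun i hi => (hφ i hi).1, ?_⟩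
  rw [fderiv_fun_sum fun i hi => (hφ i hi).1, sum_apply, Finset.mul_sum]
  exact Finset.sum_congr rfl fun i hi => (hφ i hi).2

/-- A function with Euler's relation of degree `-1` on a segment `[w, c w]` is homogeneous. -/
theorem apply_smul_of_eulerAt {φ : (Fin N → 𝕜) → 𝕜} {c : 𝕜} (hc : c ≠ 0)
    (hφ : ∀ y ∈ segment ℝ w (c • w), EulerAt (-1) φ y) : φ (c • w) = c⁻¹ * φ w := by
  let s : ℝ → 𝕜 := fun t => 1 + (t : 𝕜) * (c - 1)
  have hmem : ∀ t ∈ Set.Icc (0 : ℝ) 1, s t • w ∈ segment ℝ w (c • w) := by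
    intro t ht
    rw [segment_eq_image ℝ]
    refine ⟨t, ht, ?_⟩
    ext i
    simp only [s, Pi.add_apply, Pi.smul_apply, smul_eq_mul, RCLike.real_smul_eq_coe_mul]
    push_cast
    ring
  have hs : ∀ t, HasDerivAt s (c - 1) t := by
    intro t
    have h1 : HasDerivAt (fun t : ℝ => (t : 𝕜)) 1 t := by
      simpa using (RCLike.ofRealCLM (K := 𝕜)).hasDerivAt (x := t)
    simpa [s] using (h1.mul_const (c - 1)).const_add 1
  have hd : ∀ t ∈ Set.Icc (0 : ℝ) 1, HasDerivAt (fun t => s t * φ (s t • w)) 0 t := by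
    intro t ht
    obtain ⟨h1, h2⟩ := hφ _ (hmem t ht)
    have h3 : HasDerivAt (fun t => s t • w) ((c - 1) • w) t := (hs t).smul_const w
    have h1' : HasFDerivAt φ ((fderiv 𝕜 φ (s t • w)).restrictScalars ℝ) (s t • w) :=
      h1.hasFDerivAt.restrictScalars ℝ
    have h4 : HasDerivAt (fun t => φ (s t • w)) (fderiv 𝕜 φ (s t • w) ((c - 1) • w)) t :=
      HasFDerivAt.comp_hasDerivAt (f := fun t => s t • w) t h1' h3
    have h5 := (hs t).fun_mul h4
    rw [map_smul, smul_eq_mul] at h2 h5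
    rwa [show (c - 1) * φ (s t • w) + s t * ((c - 1) * fderiv 𝕜 φ (s t • w) w) = 0 by
      linear_combination (c - 1) * h2] at h5
  have h1 := constant_of_derivWithin_zero (f := fun t => s t * φ (s t • w)) (a := 0) (b := 1)
    (fun t ht => (hd t ht).differentiableAt.differentiableWithinAt)
    (fun t ht => ((hd t ⟨ht.1, ht.2.le⟩).hasDerivWithinAt).derivWithin
      (uniqueDiffOn_Icc zero_lt_one t ⟨ht.1, ht.2.le⟩)) 1 (by simp)
  simp only [s] at h1
  simp at h1
  rw [← h1]
  field_simp

namespace IsFlatFrame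

variable {e : Fin N → 𝕜} {H : (Fin N → 𝕜) → Fin N → 𝕜}
  {η : Matrix (Fin N) (Fin N) 𝕜} {f : (Fin N → 𝕜) → Fin N → 𝕜}
  {Γ : Fin N → Fin N → Fin N → (Fin N → 𝕜) → 𝕜}

/-- If the diagonal translation in the coordinates `u` multiplies both `x` and `H` by scalars,
then the correlators are homogeneous. -/
theorem correlatorsHomogeneous (F : IsFlatFrame U e H η x f Γ) {ρ : 𝕜} (hρ : ρ ≠ 0)
    (hx : ∀ u ∈ U, ∀ k, ∑ i, pd i (fun y => x y k) u = ρ * x u k)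
    (hH : ∀ u ∈ U, ∀ k, ∑ i, pd i (fun y => H y k) u = ρ * H u k) :
    CorrelatorsHomogeneous U e H x := by
  intro W v B w _ c hc hseg α β γ
  have euler_v : ∀ y ∈ W, ∀ i, ∑ α, y α * pd α (fun z => v z i) y = ρ⁻¹ := by
    intro y hy i
    have h1 : (jac x (v y)).mulVec (fun _ => 1) = ρ • y := by
      ext k
      have := hx (v y) (B.mapsTo hy) k
      rw [B.rightInv y hy] at this
      simp only [Matrix.mulVec, dotProduct, mul_one, jac, Matrix.of_apply, this, Pi.smul_apply,
        smul_eq_mul]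
    have h2 : (jac v y).mulVec (ρ • y) = fun _ => 1 := by
      rw [← h1, Matrix.mulVec_mulVec, mul_eq_one_comm.1 (F.jac_mul_jac B hy), Matrix.one_mulVec]
    have h3 := congrFun h2 i
    rw [Matrix.mulVec_smul, Pi.smul_apply, smul_eq_mul] at h3
    rw [← eq_inv_of_mul_eq_one_right h3]
    simp only [Matrix.mulVec, dotProduct, jac, Matrix.of_apply, mul_comm]
  have hv : ∀ y ∈ W, DifferentiableAt 𝕜 v y := fun y hy =>
    differentiableAt_of_contDiffOn B.isOpen B.smooth hy
  have hHd : ∀ u ∈ U, ∀ i, DifferentiableAt 𝕜 (fun z => H z i) u := fun u hu i =>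
    differentiableAt_of_contDiffOn F.isOpen (contDiffOn_pi.1 F.smooth_H i) hu
  have euler_H : ∀ y ∈ W, ∀ i, EulerAt 1 (fun z => H (v z) i) y := by
    intro y hy i
    have hu := B.mapsTo hy
    refine ⟨(hHd _ hu i).comp (f := v) y (hv y hy), ?_⟩
    rw [fderiv_apply_eq_sum_pd]
    simp only [pd_comp _ (hHd _ hu i) (hv y hy), Finset.mul_sum]
    rw [Finset.sum_comm]
    have : ∀ j, ∑ α, y α * (pd j (fun z => H z i) (v y) * pd α (fun z => v z j) y) =
        pd j (fun z => H z i) (v y) * ρ⁻¹ := fun j => by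
      rw [← euler_v y hy j, Finset.mul_sum]
      exact Finset.sum_congr rfl fun α _ => by ring
    simp only [this]
    rw [← Finset.sum_mul, hH _ hu]
    field_simp
  have euler_pd : ∀ y ∈ W, ∀ β i, EulerAt (-1) (pd β fun z => v z i) y := by
    intro y hy β i
    have hd : ∀ α, DifferentiableAt 𝕜 (pd α fun z => v z i) y := fun α =>
      differentiableAt_of_contDiffOn B.isOpen (contDiffOn_pd B.isOpen (B.smooth_apply i) α) hy
    refine ⟨hd β, ?_⟩
    have h1 := pd_congr_of_isOpen B.isOpen hy β fun z hz => euler_v z hz i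
    have hz : ∀ α, DifferentiableAt 𝕜 (fun z : Fin N → 𝕜 => z α) y := fun α => by fun_prop
    rw [pd_const, pd_sum _ _ fun α _ => (hz α).fun_mul (hd α)] at h1
    simp only [pd_mul β (hz _) (hd _), pd_coord, ite_mul, one_mul, zero_mul, Finset.sum_add_distrib, Finset.sum_ite_eq,
      Finset.mem_univ, if_true] at h1
    rw [fderiv_apply_eq_sum_pd]
    simp only [pd_comm B.isOpen (B.smooth_apply i) hy _ β]
    linear_combination h1
  refine apply_smul_of_eulerAt hc fun y hy => ?_
  have hy' := hseg hy
  unfold correlator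
  refine EulerAt.sum fun i _ => ?_
  have h2 := ((((EulerAt.const (w := y) (e i)).mul ((euler_H y hy' i).mul (euler_H y hy' i))).mul
    (euler_pd y hy' α i)).mul (euler_pd y hy' β i)).mul (euler_pd y hy' γ i)
  convert h2 using 1
  · ring
  · ext z
    ring

end IsFlatFrame

end Homogeneity

end FiniteGap

namespace FiniteGap

section Polynomials

open Polynomial Bornology

theorem eval_reflect_inv_mul_pow {p : ℂ[X]} {n : ℕ} (hp : p.natDegree ≤ n) {z : ℂ} (hz : z ≠ 0) :
    (reflect n p).eval z⁻¹ * z ^ n = p.eval z := by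
  let _ := invertibleOfNonzero hz
  have := eval₂_reflect_mul_pow (RingHom.id ℂ) z n p hp
  rwa [invOf_eq_inv] at this

theorem eval_zero_reflect (p : ℂ[X]) (n : ℕ) : (reflect n p).eval 0 = p.coeff n := by
  rw [← coeff_zero_eq_eval_zero, coeff_reflect, revAt_zero]

theorem eventually_ne_zero_cobounded : ∀ᶠ z : ℂ in cobounded ℂ, z ≠ 0 :=
  eventually_ne_cobounded 0

theorem tendsto_eval_div_pow {p : ℂ[X]} {n : ℕ} (hp : p.natDegree ≤ n) :
    Tendsto (fun z => p.eval z / z ^ n) (cobounded ℂ) (𝓝 (p.coeff n)) := by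
  have h1 : Tendsto (fun z : ℂ => (reflect n p).eval z⁻¹) (cobounded ℂ) (𝓝 (p.coeff n)) := by
    rw [← eval_zero_reflect]
    exact ((reflect n p).continuous.tendsto 0).comp tendsto_inv₀_cobounded
  refine h1.congr' ?_
  filter_upwards [eventually_ne_zero_cobounded] with z hz
  rw [← eval_reflect_inv_mul_pow hp hz]
  field_simp

/-- An entire function of polynomial growth is a polynomial. -/
theorem exists_polynomial_of_isBigO {n : ℕ} {F : ℂ → ℂ} (hF : Differentiable ℂ F)
    (hO : F =O[cobounded ℂ] fun z => z ^ n) :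
    ∃ p : ℂ[X], p.natDegree ≤ n ∧ ∀ z, F z = p.eval z := by
  induction n generalizing F with
  | zero =>
    simp only [pow_zero] at hO
    obtain ⟨c, hc⟩ := hO.bound
    obtain ⟨R, hR⟩ := (Metric.isBounded_iff_subset_closedBall 0).1
      (isBounded_def.2 (by rw [compl_compl]; exact hc) :
        IsBounded {z : ℂ | ‖F z‖ ≤ c * ‖(1 : ℂ)‖}ᶜ)
    obtain ⟨c', hc'⟩ := (isCompact_closedBall (0 : ℂ) R).exists_bound_of_continuousOn
      hF.continuous.continuousOn
    have hb : IsBounded (Set.range F) := by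
      refine (Metric.isBounded_iff_subset_closedBall 0).2 ⟨max (c * ‖(1 : ℂ)‖) c', ?_⟩
      rintro _ ⟨z, rfl⟩
      rw [mem_closedBall_zero_iff]
      by_cases hz : ‖F z‖ ≤ c * ‖(1 : ℂ)‖
      · exact hz.trans (le_max_left _ _)
      · exact (hc' z (hR hz)).trans (le_max_right _ _)
    exact ⟨C (F 0), by simp, fun z => by simpa using hF.apply_eq_apply_of_bounded hb z 0⟩
  | succ n ih =>
    have hG : Differentiable ℂ (dslope F 0) := by
      rw [← differentiableOn_univ, Complex.differentiableOn_dslope Filter.univ_mem]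
      exact hF.differentiableOn
    have hinf : (fun _ : ℂ => F 0) =O[cobounded ℂ] fun z : ℂ => z ^ (n + 1) := by
      refine Asymptotics.IsBigO.of_bound ‖F 0‖ ?_
      filter_upwards [tendsto_norm_cobounded_atTop.eventually_ge_atTop 1] with z h1
      rw [norm_pow]
      exact le_mul_of_one_le_right (norm_nonneg _) (one_le_pow₀ h1)
    have hGO : dslope F 0 =O[cobounded ℂ] fun z => z ^ n := by
      have h1 := (hO.sub hinf).mul (Asymptotics.isBigO_refl (fun z : ℂ => z⁻¹) (cobounded ℂ))
      refine (h1.congr' ?_ ?_)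
      · filter_upwards [eventually_ne_zero_cobounded] with z hz
        rw [dslope_of_ne _ hz, slope_def_field, sub_zero, div_eq_mul_inv]
      · filter_upwards [eventually_ne_zero_cobounded] with z hz
        rw [pow_succ, mul_assoc, mul_inv_cancel₀ hz, mul_one]
    obtain ⟨p, hp, hpe⟩ := ih hG hGO
    refine ⟨C (F 0) + X * p, ?_, fun z => ?_⟩
    · refine (natDegree_add_le _ _).trans (max_le (by simp) ?_)
      exact natDegree_mul_le.trans (by rw [natDegree_X]; omega)
    · rw [eval_add, eval_C, eval_mul, eval_X, ← hpe]
      have := sub_smul_dslope F 0 z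
      rw [sub_zero, smul_eq_mul] at this
      rw [this]
      ring

theorem meromorphicOrderAt_eval {p : ℂ[X]} (hp : p ≠ 0) (z : ℂ) :
    meromorphicOrderAt (fun y => p.eval y) z = ((p.rootMultiplicity z : ℤ) : WithTop ℤ) := by
  have ha : AnalyticAt ℂ (fun y => p.eval y) z := AnalyticOnNhd.eval_polynomial p z (Set.mem_univ z)
  rw [meromorphicOrderAt_eq_int_iff ha.meromorphicAt]
  obtain ⟨q, hq, hdvd⟩ := p.exists_eq_pow_rootMultiplicity_mul_and_not_dvd hp z
  refine ⟨fun y => q.eval y, AnalyticOnNhd.eval_polynomial q z (Set.mem_univ z), ?_, ?_⟩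
  · rwa [dvd_iff_isRoot] at hdvd
  · refine Eventually.of_forall fun y => ?_
    conv_lhs => rw [hq]
    simp

end Polynomials

namespace SpectralData

open Polynomial Bornology

variable {N l : ℕ} (S : SpectralData N l)

/-- The monic polynomial with the zero divisor `D` on the component `Γ_i`. -/
noncomputable def polePoly (i : Fin N) : ℂ[X] := ((S.D i).map fun γ => X - C γ).prod

theorem polePoly_monic (i : Fin N) : (S.polePoly i).Monic :=
  monic_multiset_prod_of_monic _ _ fun γ _ => monic_X_sub_C γ

theorem natDegree_polePoly (i : Fin N) : (S.polePoly i).natDegree = (S.D i).card :=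
  natDegree_multiset_prod_X_sub_C_eq_card _

theorem rootMultiplicity_polePoly (i : Fin N) (z : ℂ) :
    (S.polePoly i).rootMultiplicity z = (S.D i).count z := by
  rw [← count_roots, polePoly, roots_multiset_prod_X_sub_C]

theorem eval_polePoly_ne_zero {i : Fin N} {z : ℂ} (hz : z ∉ S.D i) :
    (S.polePoly i).eval z ≠ 0 := by
  intro h
  have h1 : z ∈ (S.polePoly i).roots := (mem_roots (S.polePoly_monic i).ne_zero).2 h
  rw [polePoly, roots_multiset_prod_X_sub_C] at h1
  exact hz h1

theorem coeff_polePoly_card (i : Fin N) : (S.polePoly i).coeff (S.D i).card = 1 := by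
  rw [← natDegree_polePoly]
  exact S.polePoly_monic i

theorem eventually_notMem_D (i : Fin N) : ∀ᶠ z in cobounded ℂ, z ∉ S.D i := by
  have h : ((S.D i).toFinset : Set ℂ)ᶜ ∈ cobounded ℂ :=
    isBounded_def.1 (S.D i).toFinset.finite_toSet.isBounded
  filter_upwards [h] with z hz
  simpa using hz

/-- The function on `Γ` that is `A_i / D_i · exp (uⁱ z_i)` on `Γ_i`. -/
noncomputable def wave (u : Fin N → ℂ) (A : Fin N → ℂ[X]) (i : Fin N) (z : ℂ) : ℂ :=
  (A i).eval z / (S.polePoly i).eval z * Complex.exp (u i * z)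

/-- The values of the wave function agree at the double points. -/
def IsWave (u : Fin N → ℂ) (A : Fin N → ℂ[X]) : Prop :=
  ∀ i j, ∀ a ∈ S.glue i j, S.wave u A i a = S.wave u A j a

theorem isBakerAkhiezer_wave {u : Fin N → ℂ} {A : Fin N → ℂ[X]}
    (hdeg : ∀ i, (A i).natDegree ≤ (S.D i).card) (hA : S.IsWave u A)
    (hnorm : ∀ k, S.wave u A (S.R k).1 (S.R k).2 = S.d k) :
    S.IsBakerAkhiezer u (S.wave u A) where
  analytic i z hz := by
    refine AnalyticAt.mul (AnalyticAt.div ?_ ?_ (S.eval_polePoly_ne_zero hz)) (by fun_prop)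
    · exact AnalyticOnNhd.eval_polynomial _ z (Set.mem_univ z)
    · exact AnalyticOnNhd.eval_polynomial _ z (Set.mem_univ z)
  meromorphic i z := by
    have h1 : ∀ p : ℂ[X], MeromorphicAt (fun y => p.eval y) z := fun p =>
      (AnalyticOnNhd.eval_polynomial p z (Set.mem_univ z)).meromorphicAt
    have h2 : AnalyticAt ℂ (fun y => Complex.exp (u i * y)) z := by fun_prop
    exact ((h1 _).div (h1 _)).mul h2.meromorphicAt
  poles i z := by
    have h1 : ∀ p : ℂ[X], AnalyticAt ℂ (fun y => p.eval y) z := fun p =>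
      AnalyticOnNhd.eval_polynomial p z (Set.mem_univ z)
    have h2 : AnalyticAt ℂ (fun y => Complex.exp (u i * y)) z := by fun_prop
    have h3 : meromorphicOrderAt (fun y => ((S.polePoly i).eval y)⁻¹) z =
        ((-((S.D i).count z : ℤ) : ℤ) : WithTop ℤ) := by
      rw [← rootMultiplicity_polePoly, WithTop.LinearOrderedAddCommGroup.coe_neg,
        ← meromorphicOrderAt_eval (S.polePoly_monic i).ne_zero]
      exact meromorphicOrderAt_inv
    have h4 : meromorphicOrderAt (S.wave u A i) z =
        meromorphicOrderAt (fun y => (A i).eval y * Complex.exp (u i * y)) z +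
          meromorphicOrderAt (fun y => ((S.polePoly i).eval y)⁻¹) z := by
      rw [← meromorphicOrderAt_mul ((h1 (A i)).fun_mul h2).meromorphicAt
        (h1 (S.polePoly i)).meromorphicAt.fun_inv]
      congr 1
      ext y
      simp only [wave, Pi.mul_apply]
      ring
    rw [h4, h3]
    exact le_add_of_nonneg_left ((h1 (A i)).mul h2).meromorphicOrderAt_nonneg
  infinity i := by
    refine ⟨fun w => (reflect (S.D i).card (A i)).eval w /
      (reflect (S.D i).card (S.polePoly i)).eval w, AnalyticAt.div ?_ ?_ ?_, ?_⟩
    · exact AnalyticOnNhd.eval_polynomial _ 0 (Set.mem_univ 0)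
    · exact AnalyticOnNhd.eval_polynomial _ 0 (Set.mem_univ 0)
    · rw [eval_zero_reflect, coeff_polePoly_card]
      exact one_ne_zero
    · filter_upwards [self_mem_nhdsWithin] with w hw
      have hw' : w⁻¹ ≠ 0 := inv_ne_zero hw
      have h1 := eval_reflect_inv_mul_pow (hdeg i) hw'
      have h2 := eval_reflect_inv_mul_pow (S.natDegree_polePoly i).le hw'
      rw [inv_inv] at h1 h2
      rw [wave, ← h1, ← h2, mul_div_mul_right _ _ (pow_ne_zero _ hw'), mul_assoc, ← Complex.exp_add,
        add_neg_cancel, Complex.exp_zero, mul_one]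
  glue i j a ha := hA i j a ha
  norm := hnorm

/-- Every Baker--Akhiezer function is a wave function. -/
theorem IsBakerAkhiezer.exists_wave {S : SpectralData N l} {u : Fin N → ℂ} {ψ : Fin N → ℂ → ℂ}
    (hψ : S.IsBakerAkhiezer u ψ) :
    ∃ A : Fin N → ℂ[X], (∀ i, (A i).natDegree ≤ (S.D i).card) ∧
      ∀ i z, z ∉ S.D i → ψ i z = S.wave u A i z := by
  have key : ∀ i, ∃ p : ℂ[X], p.natDegree ≤ (S.D i).card ∧
      ∀ z, z ∉ S.D i → ψ i z = p.eval z / (S.polePoly i).eval z * Complex.exp (u i * z) := by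
    intro i
    let G : ℂ → ℂ := fun z => ψ i z * ((S.polePoly i).eval z * Complex.exp (-(u i * z)))
    have hP : ∀ z, AnalyticAt ℂ (fun y => (S.polePoly i).eval y) z := fun z =>
      AnalyticOnNhd.eval_polynomial _ z (Set.mem_univ z)
    have hexp : ∀ z, AnalyticAt ℂ (fun y => Complex.exp (-(u i * y))) z := fun z => by fun_prop
    have hGm : MeromorphicOn G Set.univ := fun z _ =>
      (hψ.meromorphic i z).mul ((hP z).mul (hexp z)).meromorphicAt
    have hord : ∀ z, 0 ≤ meromorphicOrderAt G z := by
      intro z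
      have h1 : meromorphicOrderAt G z = meromorphicOrderAt (ψ i) z +
          (meromorphicOrderAt (fun y => (S.polePoly i).eval y) z +
            meromorphicOrderAt (fun y => Complex.exp (-(u i * y))) z) := by
        rw [← meromorphicOrderAt_mul (hP z).meromorphicAt (hexp z).meromorphicAt,
          ← meromorphicOrderAt_mul (hψ.meromorphic i z) ((hP z).mul (hexp z)).meromorphicAt]
        rfl
      rw [h1, meromorphicOrderAt_eval (S.polePoly_monic i).ne_zero, rootMultiplicity_polePoly]
      calc (0 : WithTop ℤ) = ((-((S.D i).count z : ℤ) : ℤ) : WithTop ℤ) +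
            ((((S.D i).count z : ℤ) : WithTop ℤ) + 0) := by
            rw [add_zero, ← WithTop.coe_add, neg_add_cancel]; rfl
        _ ≤ _ := by
            gcongr
            · exact hψ.poles i z
            · exact (hexp z).meromorphicOrderAt_nonneg
    let E := toMeromorphicNFOn G Set.univ
    have hE : ∀ z, AnalyticAt ℂ E z := fun z =>
      ((meromorphicNFOn_toMeromorphicNFOn G Set.univ)
        (Set.mem_univ z)).meromorphicOrderAt_nonneg_iff_analyticAt.1
        (by rw [meromorphicOrderAt_toMeromorphicNFOn hGm (Set.mem_univ z)]; exact hord z)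
    have hEG : ∀ z, z ∉ S.D i → E z = G z := by
      intro z hz
      have hGa : AnalyticAt ℂ G z := (hψ.analytic i z hz).mul ((hP z).mul (hexp z))
      rw [show E z = _ from toMeromorphicNFOn_eq_toMeromorphicNFAt hGm (Set.mem_univ z),
        toMeromorphicNFAt_eq_self.2 hGa.meromorphicNFAt]
    have hO : E =O[cobounded ℂ] fun z => z ^ (S.D i).card := by
      obtain ⟨g, hg, hge⟩ := hψ.infinity i
      have h1 : Tendsto (fun z : ℂ => g z⁻¹) (cobounded ℂ) (𝓝 (g 0)) :=
        hg.continuousAt.tendsto.comp tendsto_inv₀_cobounded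
      have h2 := h1.mul (tendsto_eval_div_pow (S.natDegree_polePoly i).le)
      have h3 := (h2.isBigO_one ℂ).mul
        (Asymptotics.isBigO_refl (fun z : ℂ => z ^ (S.D i).card) (cobounded ℂ))
      refine h3.congr' ?_ (Eventually.of_forall fun z => one_mul _)
      filter_upwards [tendsto_inv₀_cobounded'.eventually hge, S.eventually_notMem_D i,
        eventually_ne_zero_cobounded] with z h4 h5 h6
      rw [hEG z h5, h4, inv_inv]
      simp only [G]
      field_simp
    obtain ⟨p, hp, hpe⟩ := exists_polynomial_of_isBigO (fun z => (hE z).differentiableAt) hO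
    refine ⟨p, hp, fun z hz => ?_⟩
    rw [← hpe, hEG z hz]
    simp only [G]
    have := S.eval_polePoly_ne_zero hz
    rw [Complex.exp_neg]
    field_simp
  choose A hA1 hA2 using key
  exact ⟨A, hA1, hA2⟩

theorem coeff_card_eq_of_tendsto {u : Fin N → ℂ} {A : Fin N → ℂ[X]} {ψ : ℂ → ℂ} {i : Fin N}
    (hdeg : (A i).natDegree ≤ (S.D i).card) (hψ : ∀ z, z ∉ S.D i → ψ z = S.wave u A i z) {h : ℂ}
    (hh : Tendsto (fun z => ψ z * Complex.exp (-(u i * z))) (cobounded ℂ) (𝓝 h)) :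
    (A i).coeff (S.D i).card = h := by
  have h1 := (tendsto_eval_div_pow hdeg).div (tendsto_eval_div_pow (S.natDegree_polePoly i).le)
    (by rw [coeff_polePoly_card]; exact one_ne_zero)
  rw [coeff_polePoly_card, div_one] at h1
  refine tendsto_nhds_unique (h1.congr' ?_) hh
  filter_upwards [S.eventually_notMem_D i, eventually_ne_zero_cobounded] with z hz hz0
  rw [hψ z hz, wave, mul_assoc, ← Complex.exp_add, add_neg_cancel, Complex.exp_zero, mul_one,
    Pi.div_apply, div_div_div_cancel_right₀ (pow_ne_zero _ hz0)]

/-- There are no nonzero wave functions of degree at most `D` that vanish at `R`. -/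
theorem IsUniqueBakerAkhiezer.eq_zero {S : SpectralData N l} {u : Fin N → ℂ} {ψ : Fin N → ℂ → ℂ}
    (hψ : S.IsUniqueBakerAkhiezer u ψ) {B : Fin N → ℂ[X]}
    (hdeg : ∀ i, (B i).natDegree ≤ (S.D i).card) (hB : S.IsWave u B)
    (hR : ∀ k, (B (S.R k).1).eval (S.R k).2 = 0) : B = 0 := by
  obtain ⟨A, hA, hAψ⟩ := hψ.1.exists_wave
  have hadd : ∀ i z, S.wave u (fun i => A i + B i) i z = S.wave u A i z + S.wave u B i z := by
    intro i z
    simp only [wave, eval_add]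
    ring
  have hgl : ∀ i j a, a ∈ S.glue i j → a ∉ S.D i := fun i j a ha hD => S.D_not_glue i j a hD ha
  have hw : S.IsBakerAkhiezer u (S.wave u fun i => A i + B i) := by
    refine S.isBakerAkhiezer_wave (fun i => (natDegree_add_le _ _).trans (max_le (hA i) (hdeg i)))
      (fun i j a ha => ?_) fun k => ?_
    · rw [hadd, hadd, hB i j a ha, ← hAψ i a (hgl i j a ha),
        ← hAψ j a (hgl j i a (by rw [S.glue_symm]; exact ha)), hψ.1.glue i j a ha]
    · rw [hadd, ← hAψ _ _ (S.D_not_R k).1, hψ.1.norm, wave, hR, zero_div, zero_mul, add_zero]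
  funext i
  refine eq_of_infinite_eval_eq _ _ (Set.Infinite.mono (s := {z | z ∈ S.D i}ᶜ) (fun z hz => ?_) ?_)
  · have h1 := hψ.2 _ hw i z hz
    rw [hadd, hAψ i z hz, add_eq_left, wave, mul_eq_zero, div_eq_zero_iff] at h1
    simpa [S.eval_polePoly_ne_zero hz, Complex.exp_ne_zero] using h1
  · refine Set.Finite.infinite_compl ?_
    exact (S.D i).toFinset.finite_toSet.subset fun z hz => by simpa using hz

end SpectralData

end FiniteGap

namespace FiniteGap

section RootProducts

open Polynomial

/-- The monic polynomial with the given multiset of roots. -/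
noncomputable def rootProd (s : Multiset ℂ) : ℂ[X] := (s.map fun a => X - C a).prod

theorem rootProd_add (s t : Multiset ℂ) : rootProd (s + t) = rootProd s * rootProd t := by
  simp [rootProd]

theorem rootProd_monic (s : Multiset ℂ) : (rootProd s).Monic :=
  monic_multiset_prod_of_monic _ _ fun a _ => monic_X_sub_C a

theorem natDegree_rootProd (s : Multiset ℂ) : (rootProd s).natDegree = s.card :=
  natDegree_multiset_prod_X_sub_C_eq_card s

theorem eval_rootProd_eq_zero_iff (s : Multiset ℂ) (z : ℂ) : (rootProd s).eval z = 0 ↔ z ∈ s := by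
  rw [← IsRoot.def, ← mem_roots (rootProd_monic s).ne_zero, rootProd,
    roots_multiset_prod_X_sub_C]

theorem eval_rootProd_neg (s : Multiset ℂ) (z : ℂ) :
    (rootProd (s.map Neg.neg)).eval z = (-1) ^ s.card * (rootProd s).eval (-z) := by
  induction s using Multiset.induction with
  | empty => simp [rootProd]
  | cons a s ih =>
    simp only [rootProd, Multiset.map_cons, Multiset.prod_cons, eval_mul, eval_sub, eval_X, eval_C,
      Multiset.card_cons, pow_succ] at ih ⊢
    rw [ih]
    ring

theorem eq_C_mul_rootProd (p : ℂ[X]) : p = C p.leadingCoeff * rootProd p.roots :=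
  (C_leadingCoeff_mul_prod_multiset_X_sub_C (splits_iff_card_roots.1 (IsAlgClosed.splits p))).symm

theorem exists_eq_rootProd_mul {p : ℂ[X]} {s : Finset ℂ} (h : ∀ a ∈ s, p.eval a = 0) :
    ∃ q, p = rootProd s.val * q := by
  rcases eq_or_ne p 0 with rfl | hp
  · exact ⟨0, by simp⟩
  · refine (Multiset.prod_X_sub_C_dvd_iff_le_roots hp s.val).2 ?_
    rw [Multiset.le_iff_subset s.nodup]
    exact fun a ha => (mem_roots hp).2 (h a ha)

/-- The sum of the residues of `p / ∏ (z - a)` is minus its residue at infinity. -/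
theorem sum_div_derivative_rootProd {p : ℂ[X]} {s : Finset ℂ} (hp : p.degree < s.card) :
    ∑ a ∈ s, p.eval a / (rootProd s.val).derivative.eval a = p.coeff (s.card - 1) := by
  rw [Lagrange.coeff_eq_sum (v := id) Function.injective_id.injOn hp]
  refine Finset.sum_congr rfl fun a ha => ?_
  congr 1
  have h := Lagrange.eval_nodal_derivative_eval_node_eq (v := (id : ℂ → ℂ)) ha
  rw [Lagrange.eval_nodal] at h
  exact h

end RootProducts

namespace SpectralData

open Polynomial

variable {N l : ℕ} (S : SpectralData N l)

/-- The coordinates of the double points on `Γ_i`, together with `0`. -/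
noncomputable def nodes (i : Fin N) : Finset ℂ := insert 0 (Finset.univ.biUnion fun j => S.glue i j)

/-- The coordinates of the normalization points on `Γ_i`. -/
noncomputable def normPts (i : Fin N) : Finset ℂ :=
  (Finset.univ.filter fun k => (S.R k).1 = i).image fun k => (S.R k).2

theorem mem_nodes {i : Fin N} {a : ℂ} : a ∈ S.nodes i ↔ a = 0 ∨ ∃ j, a ∈ S.glue i j := by
  simp [nodes]

theorem mem_normPts {i : Fin N} {a : ℂ} : a ∈ S.normPts i ↔ ∃ k, S.R k = (i, a) := by
  simp [normPts, Prod.ext_iff]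

theorem neg_mem_nodes {i : Fin N} {a : ℂ} (ha : a ∈ S.nodes i) : -a ∈ S.nodes i := by
  rw [mem_nodes] at ha ⊢
  rcases ha with rfl | ⟨j, hj⟩
  · simp
  · exact Or.inr ⟨j, S.glue_neg i j a hj⟩

theorem notMem_D_of_mem_nodes {i : Fin N} {a : ℂ} (ha : a ∈ S.nodes i) : a ∉ S.D i := by
  rw [mem_nodes] at ha
  rcases ha with rfl | ⟨j, hj⟩
  · exact fun h => S.D_ne_zero i 0 h rfl
  · exact fun h => S.D_not_glue i j a h hj

theorem notMem_normPts_of_mem_nodes {i : Fin N} {a : ℂ} (ha : a ∈ S.nodes i) :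
    a ∉ S.normPts i := by
  rw [mem_normPts]
  rintro ⟨k, hk⟩
  rw [mem_nodes] at ha
  rcases ha with rfl | ⟨j, hj⟩
  · exact S.R_ne_zero k (by rw [hk])
  · exact S.R_not_glue k j (by rw [hk]; exact hj)

theorem num_ne_zero (i : Fin N) : (S.Ω i).num ≠ 0 := by
  intro h
  have h1 := S.Ω_ord_infty i
  rw [RatFunc.num_eq_zero_iff.1 h] at h1
  simp [diffOrdInfty] at h1

/-- The zeros of the differential on `Γ_i` are `D + σD`, its poles are `R + σR` and the nodes. -/
theorem roots_num_add (i : Fin N) :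
    (S.Ω i).num.roots + ((S.normPts i).val + (S.normPts i).val.map Neg.neg + (S.nodes i).val) =
      (S.Ω i).denom.roots + (S.D i + (S.D i).map Neg.neg) := by
  ext a
  have hneg : ∀ s : Multiset ℂ, (s.map Neg.neg).count a = s.count (-a) := fun s => by
    conv_lhs => rw [← neg_neg a]
    exact Multiset.count_map_eq_count' _ _ neg_injective _
  have hR : ∀ b, (S.normPts i).val.count b = if ∃ k, S.R k = (i, b) then 1 else 0 := fun b => by
    rw [Multiset.count_eq_of_nodup (S.normPts i).nodup]
    simp only [Finset.mem_val, mem_normPts]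
  have hZ : (S.nodes i).val.count a =
      (if a = 0 then 1 else 0) + (if ∃ j, a ∈ S.glue i j then 1 else 0) := by
    rw [Multiset.count_eq_of_nodup (S.nodes i).nodup]
    simp only [Finset.mem_val, mem_nodes]
    by_cases h0 : a = 0
    · have h1 : ¬ ∃ j, a ∈ S.glue i j := fun ⟨j, hj⟩ => S.glue_ne_zero i j a hj h0
      simp [h0, h0 ▸ h1]
    · simp [h0]
  have h := S.Ω_ord i a
  simp only [diffOrd] at h
  simp only [Multiset.count_add, hneg, count_roots, hR, hZ]
  zify
  linarith

theorem two_mul_card_normPts (i : Fin N) :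
    2 * (S.normPts i).card + (S.nodes i).card = 2 * (S.D i).card + 3 := by
  have h1 := congrArg Multiset.card (S.roots_num_add i)
  have hs : ∀ p : ℂ[X], p.roots.card = p.natDegree := fun p =>
    splits_iff_card_roots.1 (IsAlgClosed.splits p)
  simp only [Multiset.card_add, Multiset.card_map, hs, Finset.card_val] at h1
  have h2 := S.Ω_ord_infty i
  simp only [diffOrdInfty, RatFunc.intDegree] at h2
  omega

theorem num_mul_rootProd (i : Fin N) :
    (S.Ω i).num * (rootProd ((S.normPts i).val + (S.normPts i).val.map Neg.neg) *
      rootProd (S.nodes i).val) =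
    C (-S.epsSq i) * ((S.Ω i).denom * rootProd (S.D i + (S.D i).map Neg.neg)) := by
  have hd : (S.Ω i).denom.leadingCoeff = 1 := (S.Ω i).monic_denom
  rw [epsSq, inftyCoeff, hd, div_one, neg_neg]
  conv_lhs => rw [eq_C_mul_rootProd (S.Ω i).num]
  conv_rhs => rw [eq_C_mul_rootProd (S.Ω i).denom, hd, C_1, one_mul]
  rw [mul_assoc, ← rootProd_add, ← rootProd_add, ← rootProd_add, S.roots_num_add]

theorem epsSq_ne_zero (i : Fin N) : S.epsSq i ≠ 0 := by
  have hd : (S.Ω i).denom.leadingCoeff = 1 := (S.Ω i).monic_denom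
  rw [epsSq, inftyCoeff, hd, div_one, neg_ne_zero, leadingCoeff_ne_zero]
  exact S.num_ne_zero i

theorem derivative_nodes_ne_zero {i : Fin N} {a : ℂ} (ha : a ∈ S.nodes i) :
    (rootProd (S.nodes i).val).derivative.eval a ≠ 0 := by
  have h := Lagrange.eval_nodal_derivative_eval_node_eq (v := (id : ℂ → ℂ)) ha
  rw [Lagrange.eval_nodal] at h
  refine fun h0 => ?_
  have h1 := h.symm.trans h0
  rw [Finset.prod_eq_zero_iff] at h1
  obtain ⟨b, hb, hab⟩ := h1
  exact (Finset.mem_erase.1 hb).1 (sub_eq_zero.1 hab).symm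

theorem simpleResidue_eq {i : Fin N} {a : ℂ} (ha : a ∈ S.nodes i) :
    simpleResidue (S.Ω i) a ≠ 0 ∧ simpleResidue (S.Ω i) a =
      -S.epsSq i * ((-1) ^ (S.D i).card * ((S.polePoly i).eval a * (S.polePoly i).eval (-a))) /
      ((-1) ^ (S.normPts i).card * ((rootProd (S.normPts i).val).eval a *
        (rootProd (S.normPts i).val).eval (-a)) *
        (rootProd (S.nodes i).val).derivative.eval a) := by
  have ha' := S.neg_mem_nodes ha
  have hG0 : (rootProd (S.nodes i).val).eval a = 0 := (eval_rootProd_eq_zero_iff _ _).2 ha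
  have hG1 := S.derivative_nodes_ne_zero ha
  have hD : (rootProd (S.D i + (S.D i).map Neg.neg)).eval a =
      (-1) ^ (S.D i).card * ((S.polePoly i).eval a * (S.polePoly i).eval (-a)) := by
    rw [rootProd_add, eval_mul, eval_rootProd_neg]
    change (S.polePoly i).eval a * (_ * (S.polePoly i).eval (-a)) = _
    ring
  have hR : (rootProd ((S.normPts i).val + (S.normPts i).val.map Neg.neg)).eval a =
      (-1) ^ (S.normPts i).card * ((rootProd (S.normPts i).val).eval a *
        (rootProd (S.normPts i).val).eval (-a)) := by
    rw [rootProd_add, eval_mul, eval_rootProd_neg, Finset.card_val]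
    ring
  have hD0 : (rootProd (S.D i + (S.D i).map Neg.neg)).eval a ≠ 0 := by
    rw [hD]
    exact mul_ne_zero (pow_ne_zero _ (by norm_num)) (mul_ne_zero
      (S.eval_polePoly_ne_zero (S.notMem_D_of_mem_nodes ha))
      (S.eval_polePoly_ne_zero (S.notMem_D_of_mem_nodes ha')))
  have hR0 : (rootProd ((S.normPts i).val + (S.normPts i).val.map Neg.neg)).eval a ≠ 0 := by
    rw [hR]
    refine mul_ne_zero (pow_ne_zero _ (by norm_num)) (mul_ne_zero ?_ ?_)
    · exact fun h => S.notMem_normPts_of_mem_nodes ha ((eval_rootProd_eq_zero_iff _ _).1 h)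
    · exact fun h => S.notMem_normPts_of_mem_nodes ha' ((eval_rootProd_eq_zero_iff _ _).1 h)
  have hε := S.epsSq_ne_zero i
  have hden : (S.Ω i).denom.eval a = 0 := by
    have h1 := congrArg (eval a) (S.num_mul_rootProd i)
    simp only [eval_mul, hG0, mul_zero, eval_C] at h1
    simpa [hε, hD0] using h1.symm
  have hder : (S.Ω i).num.eval a * ((rootProd ((S.normPts i).val +
      (S.normPts i).val.map Neg.neg)).eval a * (rootProd (S.nodes i).val).derivative.eval a) =
      -S.epsSq i * ((S.Ω i).denom.derivative.eval a *
        (rootProd (S.D i + (S.D i).map Neg.neg)).eval a) := by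
    have h1 := congrArg (fun p => eval a (derivative p)) (S.num_mul_rootProd i)
    simpa only [derivative_mul, eval_add, eval_mul, hG0, hden, mul_zero, zero_mul, add_zero,
      zero_add, eval_C, derivative_C, eval_zero] using h1
  have hnum : (S.Ω i).num.eval a ≠ 0 := by
    intro h0
    obtain ⟨p, q, hpq⟩ := (S.Ω i).isCoprime_num_denom
    have h1 := congrArg (eval a) hpq
    simp [h0, hden] at h1
  have hder0 : (S.Ω i).denom.derivative.eval a ≠ 0 := by
    intro h0
    rw [h0, zero_mul, mul_zero] at hder
    exact mul_ne_zero hnum (mul_ne_zero hR0 hG1) hder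
  rw [simpleResidue, if_pos hden]
  refine ⟨div_ne_zero hnum hder0, ?_⟩
  rw [← hD, ← hR, div_eq_div_iff hder0 (mul_ne_zero hR0 hG1), hder]
  ring

theorem zero_mem_nodes (i : Fin N) : (0 : ℂ) ∈ S.nodes i := S.mem_nodes.2 (Or.inl rfl)

theorem coeff_rootProd_mul_comp_neg (s : Multiset ℂ) (q : ℂ[X]) {m : ℕ} (hq : q.natDegree ≤ m) :
    (rootProd s * (rootProd s).comp (-X) * q).coeff (2 * s.card + m) =
      (-1) ^ s.card * q.coeff m := by
  have h1 : (rootProd s).comp (-X) = C ((-1) ^ s.card) * rootProd (s.map Neg.neg) := by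
    refine Polynomial.funext fun z => ?_
    rw [eval_comp, eval_neg, eval_X, eval_mul, eval_C, eval_rootProd_neg, ← mul_assoc, ← mul_pow]
    simp
  rw [h1, show rootProd s * (C ((-1) ^ s.card) * rootProd (s.map Neg.neg)) * q =
    C ((-1) ^ s.card) * (rootProd (s + s.map Neg.neg) * q) by rw [rootProd_add]; ring, coeff_C_mul]
  have h2 : (rootProd (s + s.map Neg.neg)).natDegree = 2 * s.card := by
    rw [natDegree_rootProd, Multiset.card_add, Multiset.card_map, two_mul]
  rw [coeff_mul_add_eq_of_natDegree_le h2.le hq]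
  congr 1
  rw [← h2]
  change (rootProd (s + s.map Neg.neg)).leadingCoeff * _ = _
  rw [rootProd_monic, one_mul]

/-- The residue theorem on the component `Γ_i`. -/
theorem sum_residues (i : Fin N) {A B : ℂ[X]} (hA : ∀ a ∈ S.normPts i, A.eval a = 0)
    (hB : ∀ a ∈ S.normPts i, B.eval a = 0) (hdeg : A.natDegree + B.natDegree ≤ 2 * (S.D i).card + 2) :
    ∑ a ∈ S.nodes i, simpleResidue (S.Ω i) a * (A.eval a / (S.polePoly i).eval a *
      (B.eval (-a) / (S.polePoly i).eval (-a))) =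
    (-1) ^ ((S.D i).card + 1) * S.epsSq i * (A * B.comp (-X)).coeff (2 * (S.D i).card + 2) := by
  obtain ⟨A', rfl⟩ := exists_eq_rootProd_mul hA
  obtain ⟨B', rfl⟩ := exists_eq_rootProd_mul hB
  set P := rootProd (S.normPts i).val with hP
  set r := (S.normPts i).card with hr
  have hcard := S.two_mul_card_normPts i
  have hPd : P.natDegree = r := natDegree_rootProd _
  have hq : A' * B'.comp (-X) = 0 ∨ (A' * B'.comp (-X)).natDegree + 2 * r ≤ 2 * (S.D i).card + 2 := by
    rcases eq_or_ne A' 0 with rfl | hA'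
    · simp
    rcases eq_or_ne B' 0 with rfl | hB'
    · simp
    right
    rw [(rootProd_monic _).natDegree_mul' hA', (rootProd_monic _).natDegree_mul' hB', ← hP, hPd] at hdeg
    have h1 : (A' * B'.comp (-X)).natDegree ≤ A'.natDegree + B'.natDegree := by
      refine natDegree_mul_le.trans ?_
      rw [natDegree_comp, natDegree_neg, natDegree_X, mul_one]
    omega
  have hq1 : (A' * B'.comp (-X)).natDegree ≤ (S.nodes i).card - 1 := by
    rcases hq with h | h
    · simp [h]
    · omega
  have hpos : 0 < (S.nodes i).card := Finset.card_pos.2 ⟨0, S.zero_mem_nodes i⟩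
  have hq2 : (A' * B'.comp (-X)).degree < (S.nodes i).card := by
    refine degree_le_natDegree.trans_lt ?_
    exact_mod_cast lt_of_le_of_lt hq1 (by omega)
  have hcoeff : (P * A' * (P * B').comp (-X)).coeff (2 * (S.D i).card + 2) =
      (-1) ^ r * (A' * B'.comp (-X)).coeff ((S.nodes i).card - 1) := by
    have h1 := coeff_rootProd_mul_comp_neg (S.normPts i).val _ hq1
    rw [Finset.card_val] at h1
    rw [← h1, mul_comp]
    congr 1
    · rw [← hP]; ring
    · omega
  rw [hcoeff, ← sum_div_derivative_rootProd hq2, Finset.mul_sum, Finset.mul_sum]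
  refine Finset.sum_congr rfl fun a ha => ?_
  have ha' := S.neg_mem_nodes ha
  have h1 := S.eval_polePoly_ne_zero (S.notMem_D_of_mem_nodes ha)
  have h2 := S.eval_polePoly_ne_zero (S.notMem_D_of_mem_nodes ha')
  have h3 : P.eval a ≠ 0 := fun h =>
    S.notMem_normPts_of_mem_nodes ha ((eval_rootProd_eq_zero_iff _ _).1 h)
  have h4 : P.eval (-a) ≠ 0 := fun h =>
    S.notMem_normPts_of_mem_nodes ha' ((eval_rootProd_eq_zero_iff _ _).1 h)
  have h5 := S.derivative_nodes_ne_zero ha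
  have h6 : ((-1 : ℂ) ^ r) * (-1) ^ r = 1 := by rw [← mul_pow]; simp
  have h7 : ((-1 : ℂ) ^ r) ≠ 0 := pow_ne_zero _ (by norm_num)
  rw [(S.simpleResidue_eq ha).2]
  simp only [eval_mul, eval_comp, eval_neg, eval_X]
  rw [← hP, ← hr]
  field_simp
  have h8 : ((-1 : ℂ) ^ r) ^ 2 = 1 := by rw [sq, h6]
  rw [h8]
  ring

/-- The residue theorem on `Γ` for the product of a wave function and a reflected wave function
with the differential. -/
theorem sum_eta_mul_wave {u : Fin N → ℂ} {A B : Fin N → ℂ[X]} (hA : S.IsWave u A)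
    (hB : S.IsWave u B) (hAR : ∀ k, (A (S.R k).1).eval (S.R k).2 = 0)
    (hBR : ∀ k, (B (S.R k).1).eval (S.R k).2 = 0)
    (hdeg : ∀ i, (A i).natDegree + (B i).natDegree ≤ 2 * (S.D i).card + 2) :
    ∑ i, S.eta i i * (S.wave u A i 0 * S.wave u B i 0) =
      ∑ i, (-1) ^ ((S.D i).card + 1) * S.epsSq i *
        (A i * (B i).comp (-X)).coeff (2 * (S.D i).card + 2) := by
  have hAR' : ∀ i, ∀ a ∈ S.normPts i, (A i).eval a = 0 := fun i a ha => by
    obtain ⟨k, hk⟩ := S.mem_normPts.1 ha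
    simpa [hk] using hAR k
  have hBR' : ∀ i, ∀ a ∈ S.normPts i, (B i).eval a = 0 := fun i a ha => by
    obtain ⟨k, hk⟩ := S.mem_normPts.1 ha
    simpa [hk] using hBR k
  let T : Fin N → ℂ → ℂ := fun i a =>
    simpleResidue (S.Ω i) a * (S.wave u A i a * S.wave u B i (-a))
  have hT : ∀ i a, T i a = simpleResidue (S.Ω i) a * ((A i).eval a / (S.polePoly i).eval a *
      ((B i).eval (-a) / (S.polePoly i).eval (-a))) := by
    intro i a
    have : Complex.exp (u i * a) * Complex.exp (u i * -a) = 1 := by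
      rw [← Complex.exp_add]; simp
    simp only [T, wave]
    linear_combination (simpleResidue (S.Ω i) a * ((A i).eval a / (S.polePoly i).eval a *
      ((B i).eval (-a) / (S.polePoly i).eval (-a)))) * this
  have hanti : ∀ i j, ∑ a ∈ S.glue i j, T i a = -∑ a ∈ S.glue j i, T j a := by
    intro i j
    rw [S.glue_symm j i, ← Finset.sum_neg_distrib]
    refine Finset.sum_congr rfl fun a ha => ?_
    simp only [T]
    rw [hA i j a ha, hB i j (-a) (S.glue_neg i j a ha), eq_neg_of_add_eq_zero_left (S.Ω_regular i j a ha),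
      neg_mul]
  have hzero : ∑ i, ∑ j, ∑ a ∈ S.glue i j, T i a = 0 := by
    have h1 : ∑ i, ∑ j, ∑ a ∈ S.glue i j, T i a = -∑ i, ∑ j, ∑ a ∈ S.glue i j, T i a := by
      conv_rhs => rw [Finset.sum_comm, ← Finset.sum_neg_distrib]
      refine Finset.sum_congr rfl fun i _ => ?_
      rw [← Finset.sum_neg_distrib]
      exact Finset.sum_congr rfl fun j _ => hanti i j
    exact self_eq_neg.1 h1
  have hcomp : ∀ i, ∑ a ∈ S.nodes i, T i a = T i 0 + ∑ j, ∑ a ∈ S.glue i j, T i a := by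
    intro i
    rw [nodes, Finset.sum_insert, Finset.sum_biUnion]
    · exact fun j _ k _ hjk => S.glue_double i j k hjk
    · simp only [Finset.mem_biUnion, Finset.mem_univ, true_and, not_exists]
      exact fun j hj => S.glue_ne_zero i j 0 hj rfl
  have hsum : ∀ i, T i 0 + ∑ j, ∑ a ∈ S.glue i j, T i a = (-1) ^ ((S.D i).card + 1) *
      S.epsSq i * (A i * (B i).comp (-X)).coeff (2 * (S.D i).card + 2) := by
    intro i
    rw [← hcomp, ← S.sum_residues i (hAR' i) (hBR' i) (hdeg i)]
    exact Finset.sum_congr rfl fun a _ => hT i a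
  rw [← Finset.sum_congr rfl fun i _ => hsum i, Finset.sum_add_distrib, hzero, add_zero]
  refine Finset.sum_congr rfl fun i _ => ?_
  simp only [T, neg_zero, eta, Matrix.diagonal_apply_eq]

theorem eta_det_ne_zero : S.eta.det ≠ 0 := by
  rw [eta, Matrix.det_diagonal]
  exact Finset.prod_ne_zero_iff.2 fun i _ => (S.simpleResidue_eq (S.zero_mem_nodes i)).1

end SpectralData

end FiniteGap

namespace FiniteGap

section LinearSystems

variable {E : Type*} [NormedAddCommGroup E] [NormedSpace ℂ E] {u₀ : E}

theorem contDiffAt_det {J : Type*} [Fintype J] [DecidableEq J] {K : E → Matrix J J ℂ}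
    (hK : ∀ r c, ContDiffAt ℂ ∞ (fun u => K u r c) u₀) : ContDiffAt ℂ ∞ (fun u => (K u).det) u₀ := by
  simp only [Matrix.det_apply']
  exact ContDiffAt.sum fun σ _ => contDiffAt_const.mul (contDiffAt_prod fun i _ => hK _ _)

/-- The solution of an injective linear system is a smooth function of the matrix. -/
theorem contDiffAt_of_mulVec_eq {I J : Type*} [Fintype I] [DecidableEq I] [Fintype J]
    [DecidableEq J] {M : E → Matrix I J ℂ} (hM : ∀ r c, ContDiffAt ℂ ∞ (fun u => M u r c) u₀)
    (hinj : ∀ c, (M u₀).mulVec c = 0 → c = 0) {a : E → J → ℂ} {b : I → ℂ}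
    (ha : ∀ᶠ u in 𝓝 u₀, (M u).mulVec (a u) = b) (j : J) : ContDiffAt ℂ ∞ (fun u => a u j) u₀ := by
  obtain ⟨g, hg⟩ := LinearMap.exists_leftInverse_of_injective (Matrix.mulVecLin (M u₀))
    (LinearMap.ker_eq_bot'.2 hinj)
  let L : Matrix J I ℂ := LinearMap.toMatrix' g
  have hL : L * M u₀ = 1 := by
    rw [← LinearMap.toMatrix'_id, ← hg, LinearMap.toMatrix'_comp]
    congr 1
    exact (LinearMap.toMatrix'_toLin' (M u₀)).symm
  let K : E → Matrix J J ℂ := fun u => L * M u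
  have hK : ∀ r c, ContDiffAt ℂ ∞ (fun u => K u r c) u₀ := fun r c => by
    simp only [K, Matrix.mul_apply]
    exact ContDiffAt.sum fun i _ => contDiffAt_const.mul (hM i c)
  have hdet := contDiffAt_det hK
  have hdet0 : (K u₀).det ≠ 0 := by
    rw [show K u₀ = 1 from hL, Matrix.det_one]
    exact one_ne_zero
  have hadj : ∀ r c, ContDiffAt ℂ ∞ (fun u => (K u).adjugate r c) u₀ := by
    intro r c
    simp only [Matrix.adjugate_apply]
    refine contDiffAt_det fun r' c' => ?_
    simp only [Matrix.updateRow_apply]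
    split_ifs
    · exact contDiffAt_const
    · exact hK _ _
  have hsol : ContDiffAt ℂ ∞
      (fun u => ((K u).det)⁻¹ * ∑ k, (K u).adjugate j k * (L.mulVec b) k) u₀ :=
    (hdet.inv hdet0).mul (ContDiffAt.sum fun k _ => (hadj j k).mul contDiffAt_const)
  refine hsol.congr_of_eventuallyEq ?_
  filter_upwards [ha, hdet.continuousAt.eventually_ne hdet0] with u hu hd
  have h1 : (K u).adjugate.mulVec (L.mulVec b) = (K u).det • a u := by
    have h3 : (K u).adjugate * K u = (K u).det • 1 := Matrix.adjugate_mul _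
    rw [← hu, Matrix.mulVec_mulVec (a u) L, Matrix.mulVec_mulVec, h3, Matrix.smul_mulVec,
      Matrix.one_mulVec]
  have h2 := congrFun h1 j
  rw [Pi.smul_apply, smul_eq_mul] at h2
  rw [eq_inv_mul_iff_mul_eq₀ hd, ← h2]
  rfl

end LinearSystems

namespace SpectralData

open Polynomial

variable {N l : ℕ} (S : SpectralData N l)

theorem contDiff_wave (B : Fin N → ℂ[X]) (i : Fin N) (z : ℂ) :
    ContDiff ℂ ∞ fun u : Fin N → ℂ => S.wave u B i z := by
  unfold wave
  fun_prop

theorem wave_add (u : Fin N → ℂ) (A B : Fin N → ℂ[X]) (i : Fin N) (z : ℂ) :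
    S.wave u (A + B) i z = S.wave u A i z + S.wave u B i z := by
  simp only [wave, Pi.add_apply, eval_add]
  ring

theorem wave_smul (u : Fin N → ℂ) (c : ℂ) (A : Fin N → ℂ[X]) (i : Fin N) (z : ℂ) :
    S.wave u (c • A) i z = c * S.wave u A i z := by
  simp only [wave, Pi.smul_apply, eval_smul, smul_eq_mul]
  ring

/-- Indices of the linear equations for a wave function: double points and normalization. -/
abbrev Equation : Type := (Σ i : Fin N, Σ j : Fin N, {a // a ∈ S.glue i j}) ⊕ Fin l

/-- Indices of the coefficients of a wave function. -/
abbrev Unknown : Type := Σ i : Fin N, Fin ((S.D i).card + 1)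

/-- The left-hand sides of the linear equations for a wave function. -/
noncomputable def equations (u : Fin N → ℂ) : (Fin N → ℂ[X]) →ₗ[ℂ] (S.Equation → ℂ) where
  toFun A := Sum.elim (fun e => S.wave u A e.1 e.2.2 - S.wave u A e.2.1 e.2.2)
    fun k => S.wave u A (S.R k).1 (S.R k).2
  map_add' A B := by
    ext (e | k)
    · simp only [Sum.elim_inl, Pi.add_apply, wave_add]
      ring
    · simp only [Sum.elim_inr, Pi.add_apply, wave_add]
  map_smul' c A := by
    ext (e | k)
    · simp only [Sum.elim_inl, Pi.smul_apply, wave_smul, smul_eq_mul, RingHom.id_apply]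
      ring
    · simp only [Sum.elim_inr, Pi.smul_apply, wave_smul, smul_eq_mul, RingHom.id_apply]

/-- The wave function whose only coefficient is the given one. -/
noncomputable def unitWave (c : S.Unknown) : Fin N → ℂ[X] := Pi.single c.1 (monomial c.2 1)

/-- The polynomials with the given coefficients. -/
noncomputable def ofCoeffs (c : S.Unknown → ℂ) : Fin N → ℂ[X] := ∑ j, c j • S.unitWave j

theorem ofCoeffs_apply (c : S.Unknown → ℂ) (i : Fin N) :
    S.ofCoeffs c i = ∑ t : Fin ((S.D i).card + 1), monomial t (c ⟨i, t⟩) := by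
  simp only [ofCoeffs, Finset.sum_apply, Fintype.sum_sigma, Pi.smul_apply, unitWave]
  rw [Finset.sum_eq_single i]
  · refine Finset.sum_congr rfl fun t _ => ?_
    rw [Pi.single_eq_same, smul_monomial, smul_eq_mul, mul_one]
  · intro m _ hm
    refine Finset.sum_eq_zero fun t _ => ?_
    rw [Pi.single_eq_of_ne hm.symm, smul_zero]
  · simp

theorem natDegree_ofCoeffs (c : S.Unknown → ℂ) (i : Fin N) :
    (S.ofCoeffs c i).natDegree ≤ (S.D i).card := by
  rw [ofCoeffs_apply]
  refine natDegree_sum_le_of_forall_le _ _ fun t _ => (natDegree_monomial_le _).trans ?_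
  exact Nat.lt_succ_iff.1 t.2

theorem coeff_ofCoeffs (c : S.Unknown → ℂ) (i : Fin N) (t : Fin ((S.D i).card + 1)) :
    (S.ofCoeffs c i).coeff t = c ⟨i, t⟩ := by
  rw [ofCoeffs_apply, finsetSum_coeff, Finset.sum_eq_single t]
  · rw [coeff_monomial, if_pos rfl]
  · intro s _ hs
    rw [coeff_monomial, if_neg fun h => hs (Fin.ext h)]
  · simp

theorem ofCoeffs_coeff {A : Fin N → ℂ[X]} (hA : ∀ i, (A i).natDegree ≤ (S.D i).card) :
    S.ofCoeffs (fun j => (A j.1).coeff j.2) = A := by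
  funext i
  ext t
  by_cases ht : t ≤ (S.D i).card
  · exact S.coeff_ofCoeffs _ i ⟨t, Nat.lt_succ_iff.2 ht⟩
  · rw [coeff_eq_zero_of_natDegree_lt ((S.natDegree_ofCoeffs _ i).trans_lt (not_le.1 ht)),
      coeff_eq_zero_of_natDegree_lt ((hA i).trans_lt (not_le.1 ht))]

/-- The matrix of the linear system for the coefficients of a wave function. -/
noncomputable def systemMatrix (u : Fin N → ℂ) : Matrix S.Equation S.Unknown ℂ :=
  Matrix.of fun e j => S.equations u (S.unitWave j) e

theorem systemMatrix_mulVec (u : Fin N → ℂ) (c : S.Unknown → ℂ) :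
    (S.systemMatrix u).mulVec c = S.equations u (S.ofCoeffs c) := by
  ext e
  rw [ofCoeffs, map_sum, Finset.sum_apply, Matrix.mulVec, dotProduct]
  refine Finset.sum_congr rfl fun j _ => ?_
  rw [map_smul, Pi.smul_apply, smul_eq_mul, mul_comm]
  rfl

theorem contDiff_systemMatrix (e : S.Equation) (j : S.Unknown) :
    ContDiff ℂ ∞ fun u => S.systemMatrix u e j := by
  rcases e with e | k
  · exact (S.contDiff_wave _ _ _).sub (S.contDiff_wave _ _ _)
  · exact S.contDiff_wave _ _ _

/-- The coefficients of the Baker--Akhiezer function are holomorphic functions of `u`. -/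
theorem exists_smooth_wave {U : Set (Fin N → ℂ)} (hU : IsOpen U)
    {ψ : (Fin N → ℂ) → Fin N → ℂ → ℂ} (hψ : ∀ u ∈ U, S.IsUniqueBakerAkhiezer u (ψ u)) :
    ∃ A : (Fin N → ℂ) → Fin N → ℂ[X], (∀ u i, (A u i).natDegree ≤ (S.D i).card) ∧
      (∀ u ∈ U, ∀ i z, z ∉ S.D i → ψ u i z = S.wave u (A u) i z) ∧
      ∀ i t, ContDiffOn ℂ ∞ (fun u => (A u i).coeff t) U := by
  have hex : ∀ u, ∃ A : Fin N → ℂ[X], (∀ i, (A i).natDegree ≤ (S.D i).card) ∧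
      (u ∈ U → ∀ i z, z ∉ S.D i → ψ u i z = S.wave u A i z) := by
    intro u
    by_cases hu : u ∈ U
    · obtain ⟨A, h1, h2⟩ := (hψ u hu).1.exists_wave
      exact ⟨A, h1, fun _ => h2⟩
    · exact ⟨0, by simp, fun h => absurd h hu⟩
  choose A hdeg hA using hex
  refine ⟨A, hdeg, hA, fun i t => ?_⟩
  by_cases ht : t ≤ (S.D i).card
  swap
  · refine contDiffOn_const (c := 0) |>.congr fun u _ => ?_
    exact coeff_eq_zero_of_natDegree_lt ((hdeg u i).trans_lt (not_le.1 ht))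
  intro u₀ hu₀
  have hsys : ∀ᶠ u in 𝓝 u₀, (S.systemMatrix u).mulVec (fun j => (A u j.1).coeff j.2) =
      Sum.elim (fun _ => (0 : ℂ)) S.d := by
    filter_upwards [hU.mem_nhds hu₀] with u hu
    rw [systemMatrix_mulVec, S.ofCoeffs_coeff (hdeg u)]
    ext (⟨i, j, a, ha⟩ | k)
    · change S.wave u (A u) i a - S.wave u (A u) j a = 0
      rw [← hA u hu i a fun h => S.D_not_glue i j a h ha,
        ← hA u hu j a fun h => S.D_not_glue j i a h (by rw [S.glue_symm]; exact ha),
        (hψ u hu).1.glue i j a ha, sub_self]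
    · change S.wave u (A u) _ _ = S.d k
      rw [← hA u hu _ _ (S.D_not_R k).1, (hψ u hu).1.norm]
  refine (contDiffAt_of_mulVec_eq (fun r c => (S.contDiff_systemMatrix r c).contDiffAt) ?_ hsys
    ⟨i, ⟨t, Nat.lt_succ_iff.2 ht⟩⟩).contDiffWithinAt
  intro c hc
  rw [systemMatrix_mulVec] at hc
  have h0 := (hψ u₀ hu₀).eq_zero (S.natDegree_ofCoeffs c)
    (fun i j a ha => sub_eq_zero.1 (congrFun hc (Sum.inl ⟨i, j, a, ha⟩))) fun k => by
      have h1 : S.wave u₀ (S.ofCoeffs c) _ _ = 0 := congrFun hc (Sum.inr k)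
      rw [wave, mul_eq_zero, div_eq_zero_iff] at h1
      simpa [S.eval_polePoly_ne_zero (S.D_not_R k).1, Complex.exp_ne_zero] using h1
  ext j
  rw [← S.coeff_ofCoeffs c j.1 j.2, h0]
  simp

end SpectralData

end FiniteGap

namespace FiniteGap

open Polynomial

theorem coeff_comp_neg_X (p : ℂ[X]) (n : ℕ) : (p.comp (-X)).coeff n = p.coeff n * (-1) ^ n := by
  rw [show (-X : ℂ[X]) = C (-1) * X by simp, comp_C_mul_X_coeff]

section Families

variable {N : ℕ}

/-- A family of polynomials of degree at most `K` with smooth coefficients on `U`. -/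
structure IsSmoothFamily (U : Set (Fin N → ℂ)) (K : ℕ) (A : (Fin N → ℂ) → Fin N → ℂ[X]) :
    Prop where
  natDegree_le : ∀ u m, (A u m).natDegree ≤ K
  smooth : ∀ m t, ContDiffOn ℂ ∞ (fun u => (A u m).coeff t) U

/-- The coefficientwise derivative `exp (-u z) ∂/∂u^j (A exp (u z))` of a family of wave
functions with polynomials of degree at most `K`. -/
noncomputable def waveDeriv (K : ℕ) (j : Fin N) (A : (Fin N → ℂ) → Fin N → ℂ[X]) (u : Fin N → ℂ)
    (m : Fin N) : ℂ[X] :=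
  ∑ t ∈ Finset.range (K + 1), monomial t (pd j (fun y => (A y m).coeff t) u) +
    if m = j then X * A u m else 0

variable {U : Set (Fin N → ℂ)} {K : ℕ} {A : (Fin N → ℂ) → Fin N → ℂ[X]} {u : Fin N → ℂ}

namespace IsSmoothFamily

theorem coeff_waveDeriv (hA : IsSmoothFamily U K A) (u : Fin N → ℂ) (j m : Fin N) (t : ℕ) :
    (waveDeriv K j A u m).coeff t =
      pd j (fun y => (A y m).coeff t) u + if m = j then (X * A u m).coeff t else 0 := by
  have h1 : (∑ s ∈ Finset.range (K + 1), monomial s (pd j (fun y => (A y m).coeff s) u)).coeff t =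
      pd j (fun y => (A y m).coeff t) u := by
    simp only [finsetSum_coeff, coeff_monomial, Finset.sum_ite_eq', Finset.mem_range]
    split_ifs with ht
    · rfl
    · have h2 : (fun y => (A y m).coeff t) = fun _ => 0 := funext fun y =>
        coeff_eq_zero_of_natDegree_lt ((hA.natDegree_le y m).trans_lt (by omega))
      rw [h2, pd_const]
  rw [waveDeriv, coeff_add, h1]
  congr 1
  split_ifs <;> simp

theorem natDegree_waveDeriv_le (hA : IsSmoothFamily U K A) (u : Fin N → ℂ) (j m : Fin N) {d : ℕ}
    (hd : ∀ y, (A y m).natDegree ≤ d) :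
    (waveDeriv K j A u m).natDegree ≤ d + if m = j then 1 else 0 := by
  rw [natDegree_le_iff_coeff_eq_zero]
  intro t ht
  have h2 : (fun y => (A y m).coeff t) = fun _ => 0 := funext fun y =>
    coeff_eq_zero_of_natDegree_lt ((hd y).trans_lt (by omega))
  rw [hA.coeff_waveDeriv, h2, pd_const, zero_add]
  split_ifs with hm
  · rw [if_pos hm] at ht
    obtain ⟨s, rfl⟩ : ∃ s, t = s + 1 := ⟨t - 1, by omega⟩
    rw [coeff_X_mul]
    exact coeff_eq_zero_of_natDegree_lt ((hd u).trans_lt (by omega))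
  · rfl

theorem waveDeriv (hU : IsOpen U) (hA : IsSmoothFamily U K A) (j : Fin N) :
    IsSmoothFamily U (K + 1) (waveDeriv K j A) where
  natDegree_le u m := (hA.natDegree_waveDeriv_le u j m fun y => hA.natDegree_le y m).trans
    (by split_ifs <;> omega)
  smooth m t := by
    simp only [hA.coeff_waveDeriv]
    refine (contDiffOn_pd hU (hA.smooth m t) j).add ?_
    split_ifs
    · cases t with
      | zero => simpa using contDiffOn_const
      | succ t => simpa only [coeff_X_mul] using hA.smooth m t
    · exact contDiffOn_const

theorem differentiableAt_coeff (hU : IsOpen U) (hA : IsSmoothFamily U K A) (hu : u ∈ U)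
    (m : Fin N) (t : ℕ) : DifferentiableAt ℂ (fun y => (A y m).coeff t) u :=
  differentiableAt_of_contDiffOn hU (hA.smooth m t) hu

theorem contDiffOn_eval (hA : IsSmoothFamily U K A) (m : Fin N) (z : ℂ) :
    ContDiffOn ℂ ∞ (fun y => (A y m).eval z) U := by
  simp only [eval_eq_sum_range' (Nat.lt_succ_of_le (hA.natDegree_le _ m))]
  exact ContDiffOn.sum fun t _ => (hA.smooth m t).mul contDiffOn_const

theorem pd_eval (hU : IsOpen U) (hA : IsSmoothFamily U K A) (hu : u ∈ U) (j m : Fin N) (z : ℂ) :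
    pd j (fun y => (A y m).eval z) u + (if m = j then z * (A u m).eval z else 0) =
      (FiniteGap.waveDeriv K j A u m).eval z := by
  have hd := hA.differentiableAt_coeff hU hu
  simp only [eval_eq_sum_range' (Nat.lt_succ_of_le (hA.natDegree_le _ m))]
  rw [FiniteGap.waveDeriv, eval_add, eval_finsetSum, pd_sum _ _ fun t _ => (hd m t).mul_const _]
  congr 1
  · refine Finset.sum_congr rfl fun t _ => ?_
    rw [eval_monomial, mul_comm, ← pd_const_mul j _ (hd m t)]
    simp only [mul_comm]
  · split_ifs
    · rw [eval_mul, eval_X, eval_eq_sum_range' (Nat.lt_succ_of_le (hA.natDegree_le u m))]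
    · simp

end IsSmoothFamily

end Families

namespace SpectralData

variable {N l : ℕ} (S : SpectralData N l)
  {U : Set (Fin N → ℂ)} {K : ℕ} {A : (Fin N → ℂ) → Fin N → ℂ[X]} {u : Fin N → ℂ}

theorem contDiffOn_wave (hA : IsSmoothFamily U K A) (m : Fin N) (z : ℂ) :
    ContDiffOn ℂ ∞ (fun y => S.wave y (A y) m z) U := by
  unfold wave
  exact ((hA.contDiffOn_eval m z).div_const _).mul (by fun_prop)

theorem pd_wave (hU : IsOpen U) (hA : IsSmoothFamily U K A) (hu : u ∈ U) (j m : Fin N) (z : ℂ) :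
    pd j (fun y => S.wave y (A y) m z) u = S.wave u (waveDeriv K j A u) m z := by
  have h1 : DifferentiableAt ℂ (fun y => (A y m).eval z) u :=
    differentiableAt_of_contDiffOn hU (hA.contDiffOn_eval m z) hu
  have h2 : DifferentiableAt ℂ (fun y : Fin N → ℂ => Complex.exp (y m * z)) u := by fun_prop
  have h3 : pd j (fun y : Fin N → ℂ => Complex.exp (y m * z)) u =
      (if m = j then z else 0) * Complex.exp (u m * z) := by
    have hc : HasFDerivAt (fun y : Fin N → ℂ => y m * z)
        (z • ContinuousLinearMap.proj (R := ℂ) (φ := fun _ : Fin N => ℂ) m) u :=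
      (ContinuousLinearMap.proj (R := ℂ) (φ := fun _ : Fin N => ℂ) m).hasFDerivAt.mul_const z
    rw [pd, hc.cexp.fderiv]
    simp [Pi.single_apply, mul_comm]
  have h4 : (fun y => S.wave y (A y) m z) = fun y => ((S.polePoly m).eval z)⁻¹ *
      ((A y m).eval z * Complex.exp (y m * z)) := by
    ext y
    rw [wave]
    ring
  rw [h4, pd_const_mul j _ (h1.fun_mul h2), pd_mul j h1 h2, h3, wave, ← hA.pd_eval hU hu]
  split_ifs <;> ring

/-- The `z`-derivative at `z = 0` of the wave function with the polynomial `p` on `Γ_m`. -/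
noncomputable def slopeAtZero (u : Fin N → ℂ) (m : Fin N) (p : ℂ[X]) : ℂ :=
  ((S.polePoly m).eval 0)⁻¹ * (p.coeff 1 + u m * p.coeff 0)

theorem contDiffOn_slopeAtZero (hA : IsSmoothFamily U K A) (m : Fin N) :
    ContDiffOn ℂ ∞ (fun y => S.slopeAtZero y m (A y m)) U := by
  unfold slopeAtZero
  exact contDiffOn_const.mul ((hA.smooth m 1).add (ContDiffOn.mul (by fun_prop) (hA.smooth m 0)))

theorem pd_slopeAtZero (hU : IsOpen U) (hA : IsSmoothFamily U K A) (hu : u ∈ U) (j m : Fin N) :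
    pd j (fun y => S.slopeAtZero y m (A y m)) u = S.slopeAtZero u m (waveDeriv K j A u m) := by
  have hd := hA.differentiableAt_coeff hU hu m
  have hc : DifferentiableAt ℂ (fun y : Fin N → ℂ => y m) u := by fun_prop
  unfold slopeAtZero
  rw [pd_const_mul j _ ((hd 1).fun_add (hc.fun_mul (hd 0))), pd_add j (hd 1) (hc.fun_mul (hd 0)),
    pd_mul j hc (hd 0), pd_coord, hA.coeff_waveDeriv, hA.coeff_waveDeriv]
  by_cases hm : m = j
  · subst hm
    simp [coeff_X_mul]
    left
    ring
  · simp [hm, Ne.symm hm]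

theorem IsWave.waveDeriv (hU : IsOpen U) (hA : IsSmoothFamily U K A)
    (hw : ∀ y ∈ U, S.IsWave y (A y)) (hu : u ∈ U) (j : Fin N) :
    S.IsWave u (waveDeriv K j A u) := by
  intro m m' a ha
  rw [← S.pd_wave hU hA hu, ← S.pd_wave hU hA hu]
  exact pd_congr_of_isOpen hU hu j fun y hy => hw y hy m m' a ha

theorem eval_waveDeriv_eq_zero (hU : IsOpen U) (hA : IsSmoothFamily U K A) {c : ℂ} {k : Fin l}
    (hw : ∀ y ∈ U, S.wave y (A y) (S.R k).1 (S.R k).2 = c) (hu : u ∈ U) (j : Fin N) :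
    (waveDeriv K j A u (S.R k).1).eval (S.R k).2 = 0 := by
  have h1 := S.pd_wave hU hA hu j (S.R k).1 (S.R k).2
  rw [pd_congr_of_isOpen hU hu j hw, pd_const, wave, eq_comm, mul_eq_zero, div_eq_zero_iff] at h1
  simpa [S.eval_polePoly_ne_zero (S.D_not_R k).1, Complex.exp_ne_zero] using h1

/-- The polynomials `A` of the Baker--Akhiezer functions on an open set `V` on which their
leading coefficients `h` do not vanish. -/
structure IsWaveFamily (V : Set (Fin N → ℂ)) (h : (Fin N → ℂ) → Fin N → ℂ)
    (A : (Fin N → ℂ) → Fin N → ℂ[X]) : Prop where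
  isOpen : IsOpen V
  natDegree_le : ∀ u m, (A u m).natDegree ≤ (S.D m).card
  smooth : ∀ m t, ContDiffOn ℂ ∞ (fun u => (A u m).coeff t) V
  isWave : ∀ u ∈ V, S.IsWave u (A u)
  norm : ∀ u ∈ V, ∀ k, S.wave u (A u) (S.R k).1 (S.R k).2 = S.d k
  lead : ∀ u ∈ V, ∀ m, (A u m).coeff (S.D m).card = h u m
  unique : ∀ u ∈ V, ∀ B : Fin N → ℂ[X], (∀ m, (B m).natDegree ≤ (S.D m).card) → S.IsWave u B →
    (∀ k, (B (S.R k).1).eval (S.R k).2 = 0) → B = 0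
  h_ne_zero : ∀ u ∈ V, ∀ m, h u m ≠ 0

/-- A bound for the degrees of the polynomials of the Baker--Akhiezer functions. -/
noncomputable def degBound : ℕ := ∑ i, (S.D i).card

theorem card_le_degBound (m : Fin N) : (S.D m).card ≤ S.degBound :=
  Finset.single_le_sum (f := fun i => (S.D i).card) (fun _ _ => Nat.zero_le _) (Finset.mem_univ m)

/-- The first derivatives of the Baker--Akhiezer functions. -/
noncomputable def firstDeriv (A : (Fin N → ℂ) → Fin N → ℂ[X]) (j : Fin N) :
    (Fin N → ℂ) → Fin N → ℂ[X] := waveDeriv S.degBound j A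

/-- The second derivatives of the Baker--Akhiezer functions. -/
noncomputable def secondDeriv (A : (Fin N → ℂ) → Fin N → ℂ[X]) (i j : Fin N) :
    (Fin N → ℂ) → Fin N → ℂ[X] := waveDeriv (S.degBound + 1) i (S.firstDeriv A j)

/-- The second derivatives of the Baker--Akhiezer functions without the terms of the highest
degree. -/
noncomputable def reducedDeriv (A : (Fin N → ℂ) → Fin N → ℂ[X]) (i j : Fin N) (u : Fin N → ℂ)
    (m : Fin N) : ℂ[X] :=
  S.secondDeriv A i j u m - if i = j then X * S.firstDeriv A i u m else 0

/-- The coefficients in the expansion of the second derivatives through the first ones. -/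
noncomputable def gaussCoeff (h : (Fin N → ℂ) → Fin N → ℂ) (A : (Fin N → ℂ) → Fin N → ℂ[X])
    (k i j : Fin N) (u : Fin N → ℂ) : ℂ :=
  (S.reducedDeriv A i j u k).coeff ((S.D k).card + 1) / h u k

namespace IsWaveFamily

variable {S} {V : Set (Fin N → ℂ)} {h : (Fin N → ℂ) → Fin N → ℂ}

theorem isSmoothFamily (F : S.IsWaveFamily V h A) : IsSmoothFamily V S.degBound A where
  natDegree_le u m := (F.natDegree_le u m).trans (S.card_le_degBound m)
  smooth := F.smooth

theorem isSmoothFamily_firstDeriv (F : S.IsWaveFamily V h A) (j : Fin N) :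
    IsSmoothFamily V (S.degBound + 1) (S.firstDeriv A j) := F.isSmoothFamily.waveDeriv F.isOpen j

theorem isSmoothFamily_secondDeriv (F : S.IsWaveFamily V h A) (i j : Fin N) :
    IsSmoothFamily V (S.degBound + 1 + 1) (S.secondDeriv A i j) :=
  (F.isSmoothFamily_firstDeriv j).waveDeriv F.isOpen i

theorem isWave_firstDeriv (F : S.IsWaveFamily V h A) (hu : u ∈ V) (j : Fin N) :
    S.IsWave u (S.firstDeriv A j u) := IsWave.waveDeriv S F.isOpen F.isSmoothFamily F.isWave hu j

theorem isWave_secondDeriv (F : S.IsWaveFamily V h A) (hu : u ∈ V) (i j : Fin N) :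
    S.IsWave u (S.secondDeriv A i j u) :=
  IsWave.waveDeriv S F.isOpen (F.isSmoothFamily_firstDeriv j)
    (fun _ hy => F.isWave_firstDeriv hy j) hu i

theorem eval_firstDeriv (F : S.IsWaveFamily V h A) (hu : u ∈ V) (j : Fin N) (k : Fin l) :
    (S.firstDeriv A j u (S.R k).1).eval (S.R k).2 = 0 :=
  S.eval_waveDeriv_eq_zero F.isOpen F.isSmoothFamily (fun y hy => F.norm y hy k) hu j

theorem eval_secondDeriv (F : S.IsWaveFamily V h A) (hu : u ∈ V) (i j : Fin N) (k : Fin l) :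
    (S.secondDeriv A i j u (S.R k).1).eval (S.R k).2 = 0 :=
  S.eval_waveDeriv_eq_zero F.isOpen (F.isSmoothFamily_firstDeriv j) (c := 0)
    (fun y hy => by rw [wave, F.eval_firstDeriv hy, zero_div, zero_mul]) hu i

theorem natDegree_firstDeriv (F : S.IsWaveFamily V h A) (u : Fin N → ℂ) (j m : Fin N) :
    (S.firstDeriv A j u m).natDegree ≤ (S.D m).card + if m = j then 1 else 0 :=
  F.isSmoothFamily.natDegree_waveDeriv_le u j m fun y => F.natDegree_le y m

theorem natDegree_firstDeriv_le (F : S.IsWaveFamily V h A) (u : Fin N → ℂ) (j m : Fin N) :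
    (S.firstDeriv A j u m).natDegree ≤ (S.D m).card + 1 :=
  (F.natDegree_firstDeriv u j m).trans (by split_ifs <;> omega)

theorem coeff_firstDeriv_card_succ (F : S.IsWaveFamily V h A) (hu : u ∈ V) (j m : Fin N) :
    (S.firstDeriv A j u m).coeff ((S.D m).card + 1) = if m = j then h u m else 0 := by
  have h2 : (fun y => (A y m).coeff ((S.D m).card + 1)) = fun _ => 0 := funext fun y =>
    coeff_eq_zero_of_natDegree_lt ((F.natDegree_le y m).trans_lt (by omega))
  rw [firstDeriv, F.isSmoothFamily.coeff_waveDeriv, h2, pd_const, zero_add, coeff_X_mul,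
    F.lead u hu]

theorem coeff_firstDeriv_card (F : S.IsWaveFamily V h A) (hu : u ∈ V) (j m : Fin N) :
    (S.firstDeriv A j u m).coeff (S.D m).card =
      pd j (fun y => h y m) u + if m = j then (X * A u m).coeff (S.D m).card else 0 := by
  rw [firstDeriv, F.isSmoothFamily.coeff_waveDeriv,
    pd_congr_of_isOpen F.isOpen hu j fun y hy => F.lead y hy m]

theorem smooth_h (F : S.IsWaveFamily V h A) (m : Fin N) : ContDiffOn ℂ ∞ (fun y => h y m) V :=
  (F.smooth m _).congr fun y hy => (F.lead y hy m).symm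

theorem contDiffOn_coeff_reducedDeriv (F : S.IsWaveFamily V h A) (i j m : Fin N) (t : ℕ) :
    ContDiffOn ℂ ∞ (fun y => (S.reducedDeriv A i j y m).coeff t) V := by
  simp only [reducedDeriv, coeff_sub]
  refine ((F.isSmoothFamily_secondDeriv i j).smooth m t).sub ?_
  split_ifs
  · cases t with
    | zero => simpa using contDiffOn_const
    | succ t => simpa only [coeff_X_mul] using (F.isSmoothFamily_firstDeriv i).smooth m t
  · exact contDiffOn_const

theorem coeff_reducedDeriv_eq_zero (F : S.IsWaveFamily V h A) (i j m : Fin N) {t : ℕ}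
    (ht : (S.D m).card + 1 < t) : (S.reducedDeriv A i j u m).coeff t = 0 := by
  have h2 : (fun y => (S.firstDeriv A j y m).coeff t) = fun _ => 0 := funext fun y =>
    coeff_eq_zero_of_natDegree_lt ((F.natDegree_firstDeriv_le y j m).trans_lt ht)
  obtain ⟨s, rfl⟩ : ∃ s, t = s + 1 := ⟨t - 1, by omega⟩
  have hs : ∀ k, m ≠ k → (S.firstDeriv A k u m).coeff s = 0 := fun k hk =>
    coeff_eq_zero_of_natDegree_lt ((F.natDegree_firstDeriv u k m).trans_lt
      (by rw [if_neg hk]; omega))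
  rw [reducedDeriv, coeff_sub, secondDeriv, (F.isSmoothFamily_firstDeriv j).coeff_waveDeriv, h2,
    pd_const, zero_add, coeff_X_mul]
  by_cases hij : i = j
  · subst hij
    by_cases hm : m = i
    · simp [hm]
    · simp [hm, hs i hm]
  · by_cases hm : m = i
    · subst hm
      simp [hij, hs j hij]
    · simp [hm, hij]

/-- The second derivatives of the Baker--Akhiezer function are combinations of the first ones. -/
theorem secondDeriv_eq (F : S.IsWaveFamily V h A) (hu : u ∈ V) (i j m : Fin N) :
    S.secondDeriv A i j u m = ∑ k, C (S.gaussCoeff h A k i j u) * S.firstDeriv A k u m +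
      if i = j then X * S.firstDeriv A i u m else 0 := by
  have h0 := F.unique u hu (fun m => S.reducedDeriv A i j u m -
    ∑ k, C (S.gaussCoeff h A k i j u) * S.firstDeriv A k u m) ?_ ?_ ?_
  · have h1 := congrFun h0 m
    rw [Pi.zero_apply, sub_eq_zero] at h1
    rw [← h1, reducedDeriv, sub_add_cancel]
  · intro m
    rw [natDegree_le_iff_coeff_eq_zero]
    intro t ht
    rw [coeff_sub, finsetSum_coeff]
    simp only [coeff_C_mul]
    rcases (Nat.succ_le_of_lt ht).eq_or_lt with rfl | ht'
    · simp only [Nat.succ_eq_add_one, F.coeff_firstDeriv_card_succ hu, mul_ite, mul_zero,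
        Finset.sum_ite_eq, Finset.mem_univ, if_true]
      rw [gaussCoeff, div_mul_cancel₀ _ (F.h_ne_zero u hu m), sub_self]
    · rw [F.coeff_reducedDeriv_eq_zero i j m ht', zero_sub, neg_eq_zero]
      refine Finset.sum_eq_zero fun k _ => ?_
      rw [coeff_eq_zero_of_natDegree_lt ((F.natDegree_firstDeriv_le u k m).trans_lt ht'), mul_zero]
  · have hw : ∀ m z, S.wave u (fun m => S.reducedDeriv A i j u m -
        ∑ k, C (S.gaussCoeff h A k i j u) * S.firstDeriv A k u m) m z =
        S.wave u (S.secondDeriv A i j u) m z - (if i = j then z else 0) *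
          S.wave u (S.firstDeriv A i u) m z -
        ∑ k, S.gaussCoeff h A k i j u * S.wave u (S.firstDeriv A k u) m z := by
      intro m z
      simp only [wave, reducedDeriv, eval_sub, eval_finsetSum, eval_mul, eval_C]
      rw [show ∑ k, S.gaussCoeff h A k i j u * (eval z (S.firstDeriv A k u m) /
        eval z (S.polePoly m) * Complex.exp (u m * z)) =
        (∑ k, S.gaussCoeff h A k i j u * eval z (S.firstDeriv A k u m)) /
        eval z (S.polePoly m) * Complex.exp (u m * z) by
          rw [Finset.sum_div, Finset.sum_mul]
          exact Finset.sum_congr rfl fun k _ => by ring]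
      split_ifs
      · rw [eval_mul, eval_X]
        ring
      · rw [eval_zero]
        ring
    intro m m' a ha
    simp only [hw, F.isWave_secondDeriv hu i j m m' a ha, F.isWave_firstDeriv hu _ m m' a ha]
  · intro k
    simp only [reducedDeriv, eval_sub, eval_finsetSum, eval_mul, eval_C, F.eval_firstDeriv hu,
      F.eval_secondDeriv hu, mul_zero, Finset.sum_const_zero, sub_zero, zero_sub, neg_eq_zero]
    split_ifs
    · rw [eval_mul, F.eval_firstDeriv hu, mul_zero]
    · exact eval_zero

theorem sum_eta_firstDeriv (F : S.IsWaveFamily V h A) (hu : u ∈ V) (i j : Fin N) :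
    ∑ k, S.eta k k * (S.wave u (S.firstDeriv A i u) k 0 * S.wave u (S.firstDeriv A j u) k 0) =
      if i = j then S.epsSq i * h u i ^ 2 else 0 := by
  rw [S.sum_eta_mul_wave (F.isWave_firstDeriv hu i) (F.isWave_firstDeriv hu j)
    (F.eval_firstDeriv hu i) (F.eval_firstDeriv hu j) fun m => by
      have h1 := F.natDegree_firstDeriv_le u i m
      have h2 := F.natDegree_firstDeriv_le u j m
      omega]
  have hc : ∀ m, (S.firstDeriv A i u m * (S.firstDeriv A j u m).comp (-X)).coeff
      (2 * (S.D m).card + 2) = (if m = i then h u m else 0) *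
        ((if m = j then h u m else 0) * (-1) ^ ((S.D m).card + 1)) := by
    intro m
    rw [show 2 * (S.D m).card + 2 = ((S.D m).card + 1) + ((S.D m).card + 1) by ring,
      coeff_mul_add_eq_of_natDegree_le (F.natDegree_firstDeriv_le u i m) (by
        rw [natDegree_comp, natDegree_neg, natDegree_X, mul_one]
        exact F.natDegree_firstDeriv_le u j m),
      coeff_comp_neg_X, F.coeff_firstDeriv_card_succ hu, F.coeff_firstDeriv_card_succ hu]
  simp only [hc]
  rw [Finset.sum_eq_single i]
  · have : ((-1 : ℂ) ^ ((S.D i).card + 1)) * (-1) ^ ((S.D i).card + 1) = 1 := by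
      rw [← mul_pow]; simp
    rw [if_pos rfl]
    split_ifs
    · linear_combination S.epsSq i * h u i ^ 2 * this
    · simp
  · intro m _ hm
    simp [hm]
  · simp

theorem egorov (F : S.IsWaveFamily V h A) (hu : u ∈ V) (i j : Fin N) :
    S.epsSq i * h u i * pd j (fun y => h y i) u = S.epsSq j * h u j * pd i (fun y => h y j) u := by
  rcases eq_or_ne i j with rfl | hij
  · rfl
  have hX : S.IsWave u fun m => X * S.firstDeriv A i u m := by
    have hw : ∀ m z, S.wave u (fun m => X * S.firstDeriv A i u m) m z =
        z * S.wave u (S.firstDeriv A i u) m z := fun m z => by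
      simp only [wave, eval_mul, eval_X]
      ring
    intro m m' a ha
    rw [hw, hw, F.isWave_firstDeriv hu i m m' a ha]
  have hXd : ∀ m, (X * S.firstDeriv A i u m).natDegree ≤
      (S.D m).card + (if m = i then 1 else 0) + 1 := fun m => by
    have h1 := F.natDegree_firstDeriv u i m
    refine natDegree_mul_le.trans ?_
    rw [natDegree_X]
    omega
  have hj : ∀ m, ((S.firstDeriv A j u m).comp (-X)).natDegree ≤
      (S.D m).card + if m = j then 1 else 0 := fun m => by
    rw [natDegree_comp, natDegree_neg, natDegree_X, mul_one]
    exact F.natDegree_firstDeriv u j m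
  have h1 := S.sum_eta_mul_wave hX (F.isWave_firstDeriv hu j)
    (fun k => by rw [eval_mul, F.eval_firstDeriv hu, mul_zero]) (F.eval_firstDeriv hu j) fun m => by
      have h1 := hXd m
      have h2 := F.natDegree_firstDeriv u j m
      have h3 : ¬ (m = i ∧ m = j) := fun ⟨a, b⟩ => hij (a.symm.trans b)
      split_ifs at h1 h2 <;> omega
  have hl : ∑ m, S.eta m m * (S.wave u (fun m => X * S.firstDeriv A i u m) m 0 *
      S.wave u (S.firstDeriv A j u) m 0) = 0 :=
    Finset.sum_eq_zero fun m _ => by simp [wave]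
  have hc : ∀ m, (X * S.firstDeriv A i u m * (S.firstDeriv A j u m).comp (-X)).coeff
      (2 * (S.D m).card + 2) =
      (if m = i then h u i * (pd j (fun y => h y i) u * (-1) ^ (S.D i).card) else 0) +
      (if m = j then pd i (fun y => h y j) u * (h u j * (-1) ^ ((S.D j).card + 1)) else 0) := by
    intro m
    by_cases hmi : m = i
    · subst hmi
      have h2 := hXd m
      have h3 := hj m
      rw [if_pos rfl] at h2
      rw [if_neg hij] at h3
      rw [show 2 * (S.D m).card + 2 = ((S.D m).card + 1 + 1) + ((S.D m).card + 0) by ring,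
        coeff_mul_add_eq_of_natDegree_le h2 h3, coeff_X_mul, coeff_comp_neg_X, add_zero,
        F.coeff_firstDeriv_card_succ hu, F.coeff_firstDeriv_card hu, if_pos rfl, if_neg hij,
        if_pos rfl, if_neg hij, add_zero, add_zero]
    · have h2 := hXd m
      rw [if_neg hmi] at h2
      have h3 : ((S.firstDeriv A j u m).comp (-X)).natDegree ≤ (S.D m).card + 1 :=
        (hj m).trans (by split_ifs <;> omega)
      rw [show 2 * (S.D m).card + 2 = ((S.D m).card + 0 + 1) + ((S.D m).card + 1) by ring,
        coeff_mul_add_eq_of_natDegree_le h2 h3, coeff_X_mul, coeff_comp_neg_X, Nat.add_zero,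
        F.coeff_firstDeriv_card_succ hu, F.coeff_firstDeriv_card hu, if_neg hmi, if_neg hmi,
        zero_add, add_zero]
      by_cases hmj : m = j
      · subst hmj
        simp
      · simp [hmj]
  rw [hl] at h1
  simp only [hc, mul_add, mul_ite, mul_zero, Finset.sum_add_distrib, Finset.sum_ite_eq',
    Finset.mem_univ, if_true] at h1
  have e1 : ∀ n : ℕ, ((-1 : ℂ) ^ n) * (-1) ^ n = 1 := fun n => by rw [← mul_pow]; simp
  have e2 := e1 (S.D i).card
  have e3 := e1 ((S.D j).card + 1)
  rw [pow_succ (-1 : ℂ) (S.D i).card] at h1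
  linear_combination h1 - S.epsSq i * h u i * pd j (fun y => h y i) u * e2 +
    S.epsSq j * h u j * pd i (fun y => h y j) u * e3

end IsWaveFamily

end SpectralData

end FiniteGap

namespace FiniteGap

open Polynomial

namespace SpectralData

variable {N l : ℕ} {S : SpectralData N l} {A : (Fin N → ℂ) → Fin N → ℂ[X]} {u : Fin N → ℂ}
  {V : Set (Fin N → ℂ)} {h x : (Fin N → ℂ) → Fin N → ℂ}

namespace IsWaveFamily

theorem pd_value (F : S.IsWaveFamily V h A) (hx : ∀ u ∈ V, ∀ k, x u k = S.wave u (A u) k 0)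
    (hu : u ∈ V) (j k : Fin N) :
    pd j (fun y => x y k) u = S.wave u (S.firstDeriv A j u) k 0 := by
  rw [pd_congr_of_isOpen F.isOpen hu j fun y hy => hx y hy k,
    S.pd_wave F.isOpen F.isSmoothFamily hu]
  rfl

theorem pd_pd_value (F : S.IsWaveFamily V h A) (hx : ∀ u ∈ V, ∀ k, x u k = S.wave u (A u) k 0)
    (hu : u ∈ V) (i j k : Fin N) :
    pd i (pd j fun y => x y k) u = S.wave u (S.secondDeriv A i j u) k 0 := by
  rw [pd_congr_of_isOpen F.isOpen hu i fun y hy => F.pd_value hx hy j k,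
    S.pd_wave F.isOpen (F.isSmoothFamily_firstDeriv j) hu]
  rfl

theorem pd_slope (F : S.IsWaveFamily V h A) (hu : u ∈ V) (j k : Fin N) :
    pd j (fun y => S.slopeAtZero y k (A y k)) u = S.slopeAtZero u k (S.firstDeriv A j u k) :=
  S.pd_slopeAtZero F.isOpen F.isSmoothFamily hu j k

theorem pd_pd_slope (F : S.IsWaveFamily V h A) (hu : u ∈ V) (i j k : Fin N) :
    pd i (pd j fun y => S.slopeAtZero y k (A y k)) u =
      S.slopeAtZero u k (S.secondDeriv A i j u k) := by
  rw [pd_congr_of_isOpen F.isOpen hu i fun y hy => F.pd_slope hy j k,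
    S.pd_slopeAtZero F.isOpen (F.isSmoothFamily_firstDeriv j) hu]
  rfl

theorem isFlatFrame (F : S.IsWaveFamily V h A) (hx : ∀ u ∈ V, ∀ k, x u k = S.wave u (A u) k 0)
    {ε : Fin N → ℂ} (hε : ∀ i, ε i ^ 2 = S.epsSq i) :
    IsFlatFrame V (fun _ => 1) (fun u i => ε i * h u i) S.eta x
      (fun u k => S.slopeAtZero u k (A u k)) (S.gaussCoeff h A) where
  isOpen := F.isOpen
  sign _ := Or.inl rfl
  smooth_H := contDiffOn_pi.2 fun i => contDiffOn_const.mul (F.smooth_h i)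
  H_ne_zero u hu i := by
    refine mul_ne_zero (fun h0 => S.epsSq_ne_zero i ?_) (F.h_ne_zero u hu i)
    rw [← hε, h0]
    simp
  η_symm := by
    rw [Matrix.IsSymm, eta, Matrix.diagonal_transpose]
  η_det := S.eta_det_ne_zero
  smooth_x := contDiffOn_pi.2 fun k =>
    (S.contDiffOn_wave F.isSmoothFamily k 0).congr fun u hu => hx u hu k
  smooth_f := contDiffOn_pi.2 fun k => S.contDiffOn_slopeAtZero F.isSmoothFamily k
  differentiable_Γ k i j := by
    unfold gaussCoeff
    exact ((F.contDiffOn_coeff_reducedDeriv i j k _).div (F.smooth_h k)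
      fun u hu => F.h_ne_zero u hu k).differentiableOn (by simp)
  metric_eq u hu i j := by
    simp only [F.pd_value hx hu]
    rw [diagMetric, Matrix.diagonal_apply, one_mul, mul_pow, hε, ← F.sum_eta_firstDeriv hu i j]
    refine Finset.sum_congr rfl fun k _ => ?_
    rw [Finset.sum_eq_single k]
    · ring
    · intro m _ hm
      rw [eta, Matrix.diagonal_apply_ne _ hm.symm]
      ring
    · simp
  gauss_x u hu i j k := by
    rw [F.pd_pd_value hx hu]
    simp only [F.pd_value hx hu, wave, F.secondDeriv_eq hu, mul_zero, Complex.exp_zero, mul_one]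
    have h0 : eval 0 (if i = j then X * S.firstDeriv A i u k else 0) = 0 := by
      split_ifs <;> simp
    simp only [eval_add, h0, add_zero, eval_finsetSum, eval_mul, eval_C, Finset.sum_div, mul_div_assoc]
  gauss_f u hu i j k := by
    rw [F.pd_pd_slope hu]
    simp only [F.pd_value hx hu, F.pd_slope hu, F.secondDeriv_eq hu]
    simp only [wave, mul_zero, Complex.exp_zero, mul_one, slopeAtZero, coeff_add, finsetSum_coeff, coeff_C_mul,
      Finset.mul_sum, mul_add, Finset.sum_add_distrib]
    have h0 : ∀ p : ℂ[X], (if i = j then X * p else 0).coeff 0 = 0 := fun p => by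
      split_ifs <;> simp
    have h1 : ∀ p : ℂ[X], (if i = j then X * p else 0).coeff 1 = if i = j then p.eval 0 else 0 :=
      fun p => by
        split_ifs
        · rw [coeff_X_mul, coeff_zero_eq_eval_zero]
        · simp
    rw [h0, h1]
    have h2 : (if i = j then eval 0 (S.firstDeriv A i u k) / eval 0 (S.polePoly k) else 0) =
        (eval 0 (S.polePoly k))⁻¹ * if i = j then eval 0 (S.firstDeriv A i u k) else 0 := by
      split_ifs <;> ring
    rw [h2]
    have e1 : ∀ p, (eval 0 (S.polePoly k))⁻¹ * (S.gaussCoeff h A p i j u *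
        (S.firstDeriv A p u k).coeff 1) = S.gaussCoeff h A p i j u *
        ((eval 0 (S.polePoly k))⁻¹ * (S.firstDeriv A p u k).coeff 1) := fun p => by ring
    have e2 : ∀ p, (eval 0 (S.polePoly k))⁻¹ * (u k * (S.gaussCoeff h A p i j u *
        (S.firstDeriv A p u k).coeff 0)) = S.gaussCoeff h A p i j u *
        ((eval 0 (S.polePoly k))⁻¹ * (u k * (S.firstDeriv A p u k).coeff 0)) := fun p => by ring
    simp only [e1, e2]
    ring

/-- Translations along the diagonal multiply `x` and `h` by scalars if there is only one
normalization point. -/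
theorem sum_pd_eq (F : S.IsWaveFamily V h A) (hx : ∀ u ∈ V, ∀ k, x u k = S.wave u (A u) k 0)
    {r : ℂ} (hr : ∀ k, (S.R k).2 = r) (hu : u ∈ V) (m : Fin N) :
    ∑ i, pd i (fun y => x y m) u = -r * x u m ∧ ∑ i, pd i (fun y => h y m) u = -r * h u m := by
  have h0 := F.unique u hu (fun m => ∑ i, S.firstDeriv A i u m - X * A u m + C r * A u m) ?_ ?_ ?_
  · have hm : ∑ i, S.firstDeriv A i u m - X * A u m + C r * A u m = 0 := congrFun h0 m
    constructor
    · have h1 := congrArg (eval 0) hm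
      simp only [eval_add, eval_sub, eval_finsetSum, eval_mul, eval_X, zero_mul, eval_C, sub_zero,
        eval_zero] at h1
      simp only [F.pd_value hx hu, hx u hu, wave, mul_zero, Complex.exp_zero, mul_one]
      rw [← Finset.sum_div, eq_neg_of_add_eq_zero_left h1]
      ring
    · have h1 := congrArg (fun p => coeff p (S.D m).card) hm
      simp only [coeff_add, coeff_sub, finsetSum_coeff, F.coeff_firstDeriv_card hu, coeff_C_mul,
        F.lead u hu, Finset.sum_add_distrib, Finset.sum_ite_eq, Finset.mem_univ, if_true,
        coeff_zero] at h1
      linear_combination h1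
  · intro m
    rw [natDegree_le_iff_coeff_eq_zero]
    intro t ht
    obtain ⟨s, rfl⟩ : ∃ s, t = s + 1 := ⟨t - 1, by omega⟩
    have h1 : (A u m).coeff (s + 1) = 0 :=
      coeff_eq_zero_of_natDegree_lt ((F.natDegree_le u m).trans_lt ht)
    simp only [coeff_add, coeff_sub, finsetSum_coeff, coeff_C_mul, coeff_X_mul, h1, mul_zero,
      add_zero]
    rcases (Nat.le_of_lt_succ ht).eq_or_lt with hs | hs
    · rw [← hs]
      simp only [F.coeff_firstDeriv_card_succ hu, F.lead u hu, Finset.sum_ite_eq, Finset.mem_univ,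
        if_true, sub_self]
    · rw [coeff_eq_zero_of_natDegree_lt ((F.natDegree_le u m).trans_lt hs), sub_zero]
      exact Finset.sum_eq_zero fun i _ =>
        coeff_eq_zero_of_natDegree_lt ((F.natDegree_firstDeriv_le u i m).trans_lt (by omega))
  · have hw : ∀ m z, S.wave u (fun m => ∑ i, S.firstDeriv A i u m - X * A u m + C r * A u m) m z =
        ∑ i, S.wave u (S.firstDeriv A i u) m z - z * S.wave u (A u) m z +
          r * S.wave u (A u) m z := by
      intro m z
      simp only [wave, eval_add, eval_sub, eval_finsetSum, eval_mul, eval_X, eval_C]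
      rw [← Finset.sum_mul, ← Finset.sum_div]
      ring
    intro m m' a ha
    simp only [hw, F.isWave_firstDeriv hu _ m m' a ha, F.isWave u hu m m' a ha]
  · intro k
    simp only [eval_add, eval_sub, eval_finsetSum, eval_mul, eval_X, eval_C, F.eval_firstDeriv hu,
      Finset.sum_const_zero]
    rw [hr]
    ring

end IsWaveFamily

end SpectralData

end FiniteGap

namespace FiniteGap

section RealPoints

variable {N : ℕ} {V : Set (Fin N → ℂ)} {φ : (Fin N → ℂ) → ℂ}

/-- The inclusion of the real points. -/
noncomputable def ofRealVec : (Fin N → ℝ) →L[ℝ] (Fin N → ℂ) :=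
  ContinuousLinearMap.pi fun i => Complex.ofRealCLM.comp (ContinuousLinearMap.proj i)

theorem ofRealVec_apply (u : Fin N → ℝ) : ofRealVec u = fun i => (u i : ℂ) := rfl

theorem ofRealVec_single (i : Fin N) : ofRealVec (Pi.single i (1 : ℝ)) = Pi.single i (1 : ℂ) := by
  ext j
  by_cases h : j = i
  · subst h
    simp [ofRealVec_apply]
  · simp [ofRealVec_apply, h]

theorem pd_comp_ofRealVec (L : ℂ →L[ℝ] ℝ) {u : Fin N → ℝ} (hφ : DifferentiableAt ℂ φ (ofRealVec u))
    (i : Fin N) : pd i (fun y => L (φ (ofRealVec y))) u = L (pd i φ (ofRealVec u)) := by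
  have h1 : HasFDerivAt φ ((fderiv ℂ φ (ofRealVec u)).restrictScalars ℝ) (ofRealVec u) :=
    hφ.hasFDerivAt.restrictScalars ℝ
  have h2 : HasFDerivAt (fun y => L (φ (ofRealVec y)))
      (L.comp (((fderiv ℂ φ (ofRealVec u)).restrictScalars ℝ).comp ofRealVec)) u :=
    L.hasFDerivAt.comp u (h1.comp u ofRealVec.hasFDerivAt)
  rw [pd, h2.fderiv, pd, ← ofRealVec_single]
  rfl

theorem pd_re {u : Fin N → ℝ} (hφ : DifferentiableAt ℂ φ (ofRealVec u)) (i : Fin N) :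
    pd i (fun y => (φ (ofRealVec y)).re) u = (pd i φ (ofRealVec u)).re :=
  pd_comp_ofRealVec Complex.reCLM hφ i

theorem contDiffOn_re (hφ : ContDiffOn ℂ ∞ φ V) :
    ContDiffOn ℝ ∞ (fun y => (φ (ofRealVec y)).re) (ofRealVec ⁻¹' V) :=
  Complex.reCLM.contDiff.comp_contDiffOn
    ((hφ.restrict_scalars ℝ).comp ofRealVec.contDiff.contDiffOn fun _ hy => hy)

theorem isOpen_realPoints (hV : IsOpen V) :
    IsOpen (ofRealVec ⁻¹' V : Set (Fin N → ℝ)) := hV.preimage ofRealVec.continuous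

/-- Derivatives in real directions of a holomorphic function with real values at the real points
are real. -/
theorem pd_im_eq_zero (hV : IsOpen V) (hφ : ContDiffOn ℂ ∞ φ V)
    (hr : ∀ u : Fin N → ℝ, ofRealVec u ∈ V → (φ (ofRealVec u)).im = 0) {u : Fin N → ℝ}
    (hu : ofRealVec u ∈ V) (i : Fin N) : (pd i φ (ofRealVec u)).im = 0 := by
  have h1 : pd i (fun y => (φ (ofRealVec y)).im) u = (pd i φ (ofRealVec u)).im :=
    pd_comp_ofRealVec Complex.imCLM (differentiableAt_of_contDiffOn hV hφ hu) i
  rwa [pd_congr_of_isOpen (isOpen_realPoints hV) hu i (g := fun _ => 0) fun y hy => hr y hy,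
    pd_const, eq_comm] at h1

/-- The partial derivative of the restriction to the real points, as a complex number. -/
theorem pd_eq_ofReal (hV : IsOpen V) (hφ : ContDiffOn ℂ ∞ φ V)
    (hr : ∀ u : Fin N → ℝ, ofRealVec u ∈ V → (φ (ofRealVec u)).im = 0) {u : Fin N → ℝ}
    (hu : ofRealVec u ∈ V) (i : Fin N) :
    pd i φ (ofRealVec u) = ((pd i (fun y => (φ (ofRealVec y)).re) u : ℝ) : ℂ) := by
  rw [pd_re (differentiableAt_of_contDiffOn hV hφ hu)]
  exact Complex.ext rfl (by rw [pd_im_eq_zero hV hφ hr hu]; simp)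

theorem pd_pd_re (hV : IsOpen V) (hφ : ContDiffOn ℂ ∞ φ V) {u : Fin N → ℝ}
    (hu : ofRealVec u ∈ V) (i j : Fin N) :
    pd i (pd j fun y => (φ (ofRealVec y)).re) u = (pd i (pd j φ) (ofRealVec u)).re := by
  rw [← pd_re (differentiableAt_of_contDiffOn hV (contDiffOn_pd hV hφ j) hu)]
  exact pd_congr_of_isOpen (isOpen_realPoints hV) hu i fun y hy =>
    pd_re (differentiableAt_of_contDiffOn hV hφ hy) j

end RealPoints

section Conjugation

open Polynomial

theorem eval_conj_map (p : ℂ[X]) (z : ℂ) :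
    (p.map (starRingEnd ℂ)).eval (conj z) = conj (p.eval z) := by
  rw [eval_map, eval₂_hom]

theorem conj_eval_of_map_eq {p : ℂ[X]} (hp : p.map (starRingEnd ℂ) = p) (z : ℂ) :
    conj (p.eval z) = p.eval (conj z) := by
  rw [← eval_conj_map, hp]

theorem conj_coeff_of_map_eq {p : ℂ[X]} (hp : p.map (starRingEnd ℂ) = p) (n : ℕ) :
    conj (p.coeff n) = p.coeff n := by
  conv_rhs => rw [← hp, coeff_map]

end Conjugation

namespace SpectralData

open Polynomial

variable {N l : ℕ} {S : SpectralData N l} {A : (Fin N → ℂ) → Fin N → ℂ[X]}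
  {V : Set (Fin N → ℂ)} {h x : (Fin N → ℂ) → Fin N → ℂ}

namespace IsReal

theorem conj_simpleResidue_zero (hS : S.IsReal) (i : Fin N) :
    conj (simpleResidue (S.Ω i) 0) = simpleResidue (S.Ω i) 0 := by
  obtain ⟨hn, hd⟩ := hS.Ω i
  have hd' : (S.Ω i).denom.derivative.map (starRingEnd ℂ) = (S.Ω i).denom.derivative := by
    rw [← derivative_map, hd]
  rw [simpleResidue]
  split_ifs
  · rw [map_div₀, conj_eval_of_map_eq hn, conj_eval_of_map_eq hd', map_zero]
  · simp

theorem eta_im (hS : S.IsReal) (k m : Fin N) : (S.eta k m).im = 0 := by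
  rw [eta, Matrix.diagonal_apply]
  split_ifs
  · exact Complex.conj_eq_iff_im.1 (hS.conj_simpleResidue_zero k)
  · rfl

theorem epsSq_im (hS : S.IsReal) (k : Fin N) : (S.epsSq k).im = 0 := by
  obtain ⟨hn, hd⟩ := hS.Ω k
  refine Complex.conj_eq_iff_im.1 ?_
  rw [epsSq, inftyCoeff, map_neg, map_div₀, leadingCoeff, leadingCoeff, conj_coeff_of_map_eq hn,
    conj_coeff_of_map_eq hd]

theorem map_polePoly (hS : S.IsReal) (i : Fin N) :
    (S.polePoly i).map (starRingEnd ℂ) = S.polePoly i := by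
  conv_rhs => rw [polePoly, ← hS.D i, Multiset.map_map]
  rw [polePoly, Polynomial.map_multiset_prod, Multiset.map_map]
  simp

theorem conj_wave (hS : S.IsReal) (u : Fin N → ℝ) (B : Fin N → ℂ[X]) (m : Fin N) (z : ℂ) :
    S.wave (ofRealVec u) (fun m => (B m).map (starRingEnd ℂ)) m (conj z) =
      conj (S.wave (ofRealVec u) B m z) := by
  simp only [wave, map_mul, map_div₀, ← Complex.exp_conj, ofRealVec_apply, Complex.conj_ofReal]
  rw [eval_conj_map, conj_eval_of_map_eq (hS.map_polePoly m)]

end IsReal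

namespace IsWaveFamily

theorem map_conj (F : S.IsWaveFamily V h A) (hS : S.IsReal) {u : Fin N → ℝ} (hu : ofRealVec u ∈ V)
    (m : Fin N) : (A (ofRealVec u) m).map (starRingEnd ℂ) = A (ofRealVec u) m := by
  have hsub : ∀ m z, S.wave (ofRealVec u) (fun m => (A (ofRealVec u) m).map (starRingEnd ℂ) -
      A (ofRealVec u) m) m z = conj (S.wave (ofRealVec u) (A (ofRealVec u)) m (conj z)) -
      S.wave (ofRealVec u) (A (ofRealVec u)) m z := by
    intro m z
    rw [← hS.conj_wave, Complex.conj_conj]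
    simp only [wave, eval_sub]
    ring
  have h0 := F.unique _ hu (fun m => (A (ofRealVec u) m).map (starRingEnd ℂ) -
    A (ofRealVec u) m) (fun m => ?_) (fun i j a ha => ?_) fun k => ?_
  · exact sub_eq_zero.1 (congrFun h0 m)
  · refine (natDegree_sub_le _ _).trans (max_le (natDegree_map_le.trans ?_) ?_) <;>
      exact F.natDegree_le _ m
  · rw [hsub, hsub, F.isWave _ hu i j a ha, F.isWave _ hu i j _ (hS.glue i j a ha)]
  · obtain ⟨k', h1, h2⟩ := hS.R k
    have h3 := F.norm _ hu k'
    rw [h1, h2] at h3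
    have h4 := hsub (S.R k).1 (S.R k).2
    rw [h3, Complex.conj_conj, F.norm _ hu k, sub_self, wave, mul_eq_zero, div_eq_zero_iff] at h4
    simpa [S.eval_polePoly_ne_zero (S.D_not_R k).1, Complex.exp_ne_zero] using h4

theorem h_im (F : S.IsWaveFamily V h A) (hS : S.IsReal) {u : Fin N → ℝ} (hu : ofRealVec u ∈ V)
    (m : Fin N) : (h (ofRealVec u) m).im = 0 := by
  refine Complex.conj_eq_iff_im.1 ?_
  rw [← F.lead _ hu, conj_coeff_of_map_eq (F.map_conj hS hu m)]

theorem value_im (F : S.IsWaveFamily V h A) (hS : S.IsReal)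
    (hx : ∀ u ∈ V, ∀ k, x u k = S.wave u (A u) k 0) {u : Fin N → ℝ} (hu : ofRealVec u ∈ V)
    (m : Fin N) : (x (ofRealVec u) m).im = 0 := by
  refine Complex.conj_eq_iff_im.1 ?_
  rw [hx _ hu, ← hS.conj_wave, map_zero]
  simp only [wave, F.map_conj hS hu]

theorem slope_im (F : S.IsWaveFamily V h A) (hS : S.IsReal) {u : Fin N → ℝ} (hu : ofRealVec u ∈ V)
    (m : Fin N) : (S.slopeAtZero (ofRealVec u) m (A (ofRealVec u) m)).im = 0 := by
  refine Complex.conj_eq_iff_im.1 ?_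
  have hc := conj_coeff_of_map_eq (F.map_conj hS hu m)
  rw [slopeAtZero, map_mul, map_inv₀, map_add, map_mul, hc, hc,
    conj_eval_of_map_eq (hS.map_polePoly m), map_zero, ofRealVec_apply, Complex.conj_ofReal]

theorem isFlatFrame_real (F : S.IsWaveFamily V h A) (hS : S.IsReal)
    (hx : ∀ u ∈ V, ∀ k, x u k = S.wave u (A u) k 0) :
    IsFlatFrame (ofRealVec ⁻¹' V) (fun i => Real.sign (S.epsSq i).re)
      (fun u i => √|(S.epsSq i).re| * (h (ofRealVec u) i).re) (S.eta.map Complex.re)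
      (fun u k => (x (ofRealVec u) k).re)
      (fun u k => (S.slopeAtZero (ofRealVec u) k (A (ofRealVec u) k)).re)
      (fun k i j u => (S.gaussCoeff h A k i j (ofRealVec u)).re) := by
  choose ε hε using fun i => IsAlgClosed.exists_pow_nat_eq (S.epsSq i) two_pos
  have G := F.isFlatFrame hx hε
  have hV := F.isOpen
  have hsq : ∀ i, S.epsSq i = ((S.epsSq i).re : ℂ) := fun i =>
    Complex.ext rfl (by simp [hS.epsSq_im])
  have hsq0 : ∀ i, (S.epsSq i).re ≠ 0 := fun i h0 => S.epsSq_ne_zero i (by rw [hsq, h0]; simp)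
  have hη : ∀ k m, S.eta k m = (((S.eta.map Complex.re) k m : ℝ) : ℂ) := fun k m =>
    Complex.ext rfl (by simp [hS.eta_im])
  have hhr : ∀ u : Fin N → ℝ, ofRealVec u ∈ V → ∀ i, h (ofRealVec u) i =
      ((h (ofRealVec u) i).re : ℂ) := fun u hu i => Complex.ext rfl (by simp [F.h_im hS hu])
  have hpx : ∀ u : Fin N → ℝ, ofRealVec u ∈ V → ∀ i k, pd i (fun y => x y k) (ofRealVec u) =
      ((pd i (fun y => (x (ofRealVec y) k).re) u : ℝ) : ℂ) := fun u hu i k =>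
    pd_eq_ofReal (φ := fun y => x y k) hV (G.smooth_x_apply k)
      (fun u hu => F.value_im hS hx hu k) hu i
  have hpf : ∀ u : Fin N → ℝ, ofRealVec u ∈ V → ∀ i k,
      pd i (fun y => S.slopeAtZero y k (A y k)) (ofRealVec u) =
      ((pd i (fun y => (S.slopeAtZero (ofRealVec y) k (A (ofRealVec y) k)).re) u : ℝ) : ℂ) :=
    fun u hu i k => pd_eq_ofReal (φ := fun y => S.slopeAtZero y k (A y k)) hV (G.smooth_f_apply k)
      (fun u hu => F.slope_im hS hu k) hu i
  refine
    { isOpen := isOpen_realPoints hV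
      sign := fun i => (Real.sign_apply_eq_of_ne_zero _ (hsq0 i)).symm
      smooth_H := contDiffOn_pi.2 fun i => contDiffOn_const.mul (contDiffOn_re (F.smooth_h i))
      H_ne_zero := fun u hu i => ?_
      η_symm := ?_
      η_det := ?_
      smooth_x := contDiffOn_pi.2 fun k => contDiffOn_re (G.smooth_x_apply k)
      smooth_f := contDiffOn_pi.2 fun k => contDiffOn_re (G.smooth_f_apply k)
      differentiable_Γ := fun k i j => ?_
      metric_eq := fun u hu i j => ?_
      gauss_x := fun u hu i j k => ?_
      gauss_f := fun u hu i j k => ?_ }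
  · refine mul_ne_zero (Real.sqrt_ne_zero'.2 (abs_pos.2 (hsq0 i))) fun h0 => ?_
    exact F.h_ne_zero _ hu i (by rw [hhr u hu, h0]; simp)
  · rw [eta, Matrix.diagonal_map Complex.zero_re, Matrix.IsSymm, Matrix.diagonal_transpose]
  · have h1 := S.eta_det_ne_zero
    rw [show S.eta = (S.eta.map Complex.re).map Complex.ofRealHom from Matrix.ext hη,
      ← RingHom.mapMatrix_apply, ← RingHom.map_det] at h1
    exact fun h0 => h1 (by rw [h0, map_zero])
  · exact Complex.reCLM.differentiable.comp_differentiableOn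
      (((G.differentiable_Γ k i j).restrictScalars ℝ).comp
        ofRealVec.differentiable.differentiableOn fun _ hy => hy)
  · have h1 := G.metric_eq _ hu i j
    rw [diagMetric, Matrix.diagonal_apply, one_mul, mul_pow, hε, hsq, hhr u hu] at h1
    simp only [hη, hpx u hu] at h1
    have h2 : Real.sign (S.epsSq i).re * |(S.epsSq i).re| = (S.epsSq i).re := by
      rcases lt_or_gt_of_ne (hsq0 i) with h | h
      · rw [Real.sign_of_neg h, abs_of_neg h]; ring
      · rw [Real.sign_of_pos h, abs_of_pos h, one_mul]
    rw [diagMetric, Matrix.diagonal_apply, mul_pow, Real.sq_sqrt (abs_nonneg _), ← mul_assoc, h2]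
    apply Complex.ofReal_injective
    rw [apply_ite Complex.ofReal]
    push_cast
    exact h1
  · rw [pd_pd_re (φ := fun y => x y k) hV (G.smooth_x_apply k) hu, G.gauss_x _ hu, Complex.re_sum]
    refine Finset.sum_congr rfl fun p _ => ?_
    rw [hpx u hu, Complex.re_mul_ofReal]
  · rw [pd_pd_re (φ := fun y => S.slopeAtZero y k (A y k)) hV (G.smooth_f_apply k) hu,
      G.gauss_f _ hu, Complex.add_re, Complex.re_sum]
    congr 1
    · refine Finset.sum_congr rfl fun p _ => ?_
      rw [hpf u hu, Complex.re_mul_ofReal]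
    · split_ifs
      · rw [hpx u hu, Complex.ofReal_re]
      · rfl

theorem isFlatEgorov (F : S.IsWaveFamily V h A) (hx : ∀ u ∈ V, ∀ k, x u k = S.wave u (A u) k 0)
    {ε : Fin N → ℂ} (hε : ∀ i, ε i ^ 2 = S.epsSq i) :
    IsFlatEgorov V (fun _ => 1) (fun u i => ε i * h u i) S.eta x := by
  refine (F.isFlatFrame hx hε).isFlatEgorov fun u hu i j => ?_
  have hd : ∀ m, DifferentiableAt ℂ (fun y => h y m) u := fun m =>
    differentiableAt_of_contDiffOn F.isOpen (F.smooth_h m) hu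
  rw [pd_const_mul j _ (hd i), pd_const_mul i _ (hd j)]
  have h1 := F.egorov hu i j
  rw [← hε, ← hε] at h1
  linear_combination h1

theorem pd_re_h (F : S.IsWaveFamily V h A) {u : Fin N → ℝ} (hu : ofRealVec u ∈ V) (i m : Fin N) :
    pd i (fun y => √|(S.epsSq m).re| * (h (ofRealVec y) m).re) u =
      √|(S.epsSq m).re| * (pd i (fun y => h y m) (ofRealVec u)).re := by
  have hd : DifferentiableAt ℝ (fun y => (h (ofRealVec y) m).re) u :=
    differentiableAt_of_contDiffOn (isOpen_realPoints F.isOpen) (contDiffOn_re (F.smooth_h m)) hu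
  rw [pd_const_mul i _ hd, pd_re (φ := fun y => h y m)
    (differentiableAt_of_contDiffOn F.isOpen (F.smooth_h m) hu)]

theorem isFlatEgorov_real (F : S.IsWaveFamily V h A) (hS : S.IsReal)
    (hx : ∀ u ∈ V, ∀ k, x u k = S.wave u (A u) k 0) :
    IsFlatEgorov (ofRealVec ⁻¹' V) (fun i => Real.sign (S.epsSq i).re)
      (fun u i => √|(S.epsSq i).re| * (h (ofRealVec u) i).re) (S.eta.map Complex.re)
      (fun u k => (x (ofRealVec u) k).re) := by
  refine (F.isFlatFrame_real hS hx).isFlatEgorov fun u hu i j => ?_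
  rw [F.pd_re_h hu, F.pd_re_h hu]
  have h2 : ∀ i, Real.sign (S.epsSq i).re * (√|(S.epsSq i).re| * √|(S.epsSq i).re|) =
      (S.epsSq i).re := fun i => by
    rw [Real.mul_self_sqrt (abs_nonneg _)]
    rcases lt_trichotomy (S.epsSq i).re 0 with h | h | h
    · rw [Real.sign_of_neg h, abs_of_neg h]; ring
    · simp [h]
    · rw [Real.sign_of_pos h, abs_of_pos h, one_mul]
  have h1 := congrArg Complex.re (F.egorov hu i j)
  simp only [Complex.mul_re, Complex.mul_im, F.h_im hS hu, hS.epsSq_im, zero_mul, mul_zero,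
    sub_zero, add_zero] at h1
  linear_combination h1 + (h (ofRealVec u) i).re * (pd j (fun y => h y i) (ofRealVec u)).re * h2 i -
    (h (ofRealVec u) j).re * (pd i (fun y => h y j) (ofRealVec u)).re * h2 j

theorem correlatorsHomogeneous (F : S.IsWaveFamily V h A)
    (hx : ∀ u ∈ V, ∀ k, x u k = S.wave u (A u) k 0) {ε : Fin N → ℂ}
    (hε : ∀ i, ε i ^ 2 = S.epsSq i) {r : ℂ} (hr0 : r ≠ 0) (hr : ∀ k, (S.R k).2 = r) :
    CorrelatorsHomogeneous V (fun _ => 1) (fun u i => ε i * h u i) x := by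
  refine (F.isFlatFrame hx hε).correlatorsHomogeneous (neg_ne_zero.2 hr0)
    (fun u hu k => (F.sum_pd_eq hx hr hu k).1) fun u hu k => ?_
  have hd : DifferentiableAt ℂ (fun y => h y k) u :=
    differentiableAt_of_contDiffOn F.isOpen (F.smooth_h k) hu
  simp only [pd_const_mul _ _ hd]
  rw [← Finset.mul_sum, (F.sum_pd_eq hx hr hu k).2]
  ring

theorem correlatorsHomogeneous_real (F : S.IsWaveFamily V h A) (hS : S.IsReal)
    (hx : ∀ u ∈ V, ∀ k, x u k = S.wave u (A u) k 0) {r : ℝ} (hr0 : r ≠ 0)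
    (hr : ∀ k, (S.R k).2 = (r : ℂ)) :
    CorrelatorsHomogeneous (ofRealVec ⁻¹' V) (fun i => Real.sign (S.epsSq i).re)
      (fun u i => √|(S.epsSq i).re| * (h (ofRealVec u) i).re)
      (fun u k => (x (ofRealVec u) k).re) := by
  have hxs : ∀ k, ContDiffOn ℂ ∞ (fun y => x y k) V := fun k =>
    (S.contDiffOn_wave F.isSmoothFamily k 0).congr fun u hu => hx u hu k
  refine (F.isFlatFrame_real hS hx).correlatorsHomogeneous (neg_ne_zero.2 hr0)
    (fun u hu k => ?_) fun u hu k => ?_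
  · have h1 := congrArg Complex.re (F.sum_pd_eq hx hr hu k).1
    rw [Complex.re_sum, ← Complex.ofReal_neg, Complex.re_ofReal_mul] at h1
    rw [← h1]
    exact Finset.sum_congr rfl fun i _ => pd_re (φ := fun y => x y k)
      (differentiableAt_of_contDiffOn F.isOpen (hxs k) hu) i
  · have h1 := congrArg Complex.re (F.sum_pd_eq hx hr hu k).2
    rw [Complex.re_sum, ← Complex.ofReal_neg, Complex.re_ofReal_mul] at h1
    simp only [F.pd_re_h hu]
    rw [← Finset.mul_sum, h1]
    ring

end IsWaveFamily

/-- The Baker--Akhiezer functions form a wave family where their leading coefficients do not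
vanish. -/
theorem exists_isWaveFamily (S : SpectralData N l) {U : Set (Fin N → ℂ)} (hU : IsOpen U)
    {ψ : (Fin N → ℂ) → Fin N → ℂ → ℂ} (hψ : ∀ u ∈ U, S.IsUniqueBakerAkhiezer u (ψ u))
    (hh : ∀ u ∈ U, ∀ i, Tendsto (fun z => ψ u i z * Complex.exp (-(u i * z)))
      (Bornology.cobounded ℂ) (𝓝 (h u i))) :
    ∃ A : (Fin N → ℂ) → Fin N → ℂ[X], S.IsWaveFamily {u | u ∈ U ∧ ∀ i, h u i ≠ 0} h A ∧
      ∀ u ∈ U, ∀ k, ψ u k 0 = S.wave u (A u) k 0 := by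
  obtain ⟨A, hdeg, hA, hsm⟩ := S.exists_smooth_wave hU hψ
  have hlead : ∀ u ∈ U, ∀ m, (A u m).coeff (S.D m).card = h u m := fun u hu m =>
    S.coeff_card_eq_of_tendsto (hdeg u m) (hA u hu m) (hh u hu m)
  refine ⟨A, ⟨?_, hdeg, fun m t => (hsm m t).mono fun u hu => hu.1, fun u hu i j a ha => ?_,
    fun u hu k => ?_, fun u hu => hlead u hu.1, fun u hu B => (hψ u hu.1).eq_zero,
    fun u hu => hu.2⟩, fun u hu k => hA u hu k 0 fun h0 => S.D_ne_zero k 0 h0 rfl⟩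
  · rw [isOpen_iff_mem_nhds]
    rintro u ⟨hu, hu0⟩
    have h1 : ∀ᶠ y in 𝓝 u, ∀ i, (A y i).coeff (S.D i).card ≠ 0 := eventually_all.2 fun i =>
      (differentiableAt_of_contDiffOn hU (hsm i _) hu).continuousAt.eventually_ne
        (by rw [hlead u hu]; exact hu0 i)
    filter_upwards [h1, hU.mem_nhds hu] with y hy hyU
    exact ⟨hyU, fun i => by rw [← hlead y hyU]; exact hy i⟩
  · rw [← hA u hu.1 i a fun h0 => S.D_not_glue i j a h0 ha,
      ← hA u hu.1 j a fun h0 => S.D_not_glue j i a h0 (by rw [S.glue_symm]; exact ha),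
      (hψ u hu.1).1.glue i j a ha]
  · rw [← hA u hu.1 _ _ (S.D_not_R k).1, (hψ u hu.1).1.norm]

end SpectralData

end FiniteGap

/-- `U` is an open set of parameters `u ∈ ℂ^N` for which the Baker--Akhiezer function `ψ` exists
and is unique, `h_i` is the limit of `ψ exp (-uⁱ z_i)` at `P_i`, `H_i = ε_i h_i`, and
`x^k(u) = ψ(u, Q_k)`. All claims concern the set `V` of those `u ∈ U` at which the metric
`∑ H_i² (duⁱ)²` is nondegenerate; `V'` is the set of its real points. -/
theorem theorem5 {N l : ℕ} (S : FiniteGap.SpectralData N l)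
    (U : Set (Fin N → ℂ)) (hU : IsOpen U)
    (ψ : (Fin N → ℂ) → Fin N → ℂ → ℂ)
    (hψ : ∀ u ∈ U, S.IsUniqueBakerAkhiezer u (ψ u))
    (h : (Fin N → ℂ) → Fin N → ℂ)
    (hh : ∀ u ∈ U, ∀ i, Tendsto (fun z => ψ u i z * Complex.exp (-(u i * z)))
      (Bornology.cobounded ℂ) (𝓝 (h u i)))
    (ε : Fin N → ℂ) (hε : ∀ i, ε i ^ 2 = S.epsSq i)
    (V : Set (Fin N → ℂ)) (hV : V = {u | u ∈ U ∧ ∀ i, h u i ≠ 0})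
    (V' : Set (Fin N → ℝ)) (hV' : V' = {u | (fun i => (u i : ℂ)) ∈ V}) :
    -- the holomorphic metric
    (FiniteGap.IsFlatEgorov V (fun _ => 1) (fun u i => ε i * h u i) S.eta (fun u k => ψ u k 0) ∧
      FiniteGap.GivesAssociativity V (fun _ => 1) (fun u i => ε i * h u i) S.eta
        (fun u k => ψ u k 0) ∧
      (S.CurveConnected → l = 1 → (∀ k, S.d k = 1) →
        FiniteGap.CorrelatorsHomogeneous V (fun _ => 1) (fun u i => ε i * h u i)
          (fun u k => ψ u k 0))) ∧
    -- the real metric, for real spectral data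
    (S.IsReal →
      (∀ k, (S.eta k k).im = 0 ∧ (S.epsSq k).im = 0) ∧
      (∀ u ∈ V', ∀ k, (ψ (fun i => (u i : ℂ)) k 0).im = 0 ∧ (h (fun i => (u i : ℂ)) k).im = 0) ∧
      FiniteGap.IsFlatEgorov V' (fun i => Real.sign (S.epsSq i).re)
        (fun u i => √|(S.epsSq i).re| * (h (fun j => (u j : ℂ)) i).re)
        (S.eta.map Complex.re) (fun u k => (ψ (fun j => (u j : ℂ)) k 0).re) ∧
      FiniteGap.GivesAssociativity V' (fun i => Real.sign (S.epsSq i).re)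
        (fun u i => √|(S.epsSq i).re| * (h (fun j => (u j : ℂ)) i).re)
        (S.eta.map Complex.re) (fun u k => (ψ (fun j => (u j : ℂ)) k 0).re) ∧
      (S.CurveConnected → l = 1 → (∀ k, S.d k = 1) →
        FiniteGap.CorrelatorsHomogeneous V' (fun i => Real.sign (S.epsSq i).re)
          (fun u i => √|(S.epsSq i).re| * (h (fun j => (u j : ℂ)) i).re)
          (fun u k => (ψ (fun j => (u j : ℂ)) k 0).re))) := by
  subst hV hV'
  obtain ⟨A, F, hA⟩ := S.exists_isWaveFamily hU hψ hh
  have hx : ∀ u ∈ {u | u ∈ U ∧ ∀ i, h u i ≠ 0}, ∀ k, ψ u k 0 = S.wave u (A u) k 0 :=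
    fun u hu k => hA u hu.1 k
  refine ⟨⟨F.isFlatEgorov (x := fun u k => ψ u k 0) hx hε,
    (F.isFlatFrame (x := fun u k => ψ u k 0) hx hε).givesAssociativity, fun _ hl _ => ?_⟩,
    fun hS => ⟨fun k => ⟨hS.eta_im k k, hS.epsSq_im k⟩,
      fun u hu k => ⟨F.value_im (x := fun u k => ψ u k 0) hS hx hu k, F.h_im hS hu k⟩,
      F.isFlatEgorov_real (x := fun u k => ψ u k 0) hS hx,
      (F.isFlatFrame_real (x := fun u k => ψ u k 0) hS hx).givesAssociativity, fun _ hl _ => ?_⟩⟩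
  · subst hl
    exact F.correlatorsHomogeneous (x := fun u k => ψ u k 0) hx hε (S.R_ne_zero 0)
      fun k => by rw [Subsingleton.elim k 0]
  · subst hl
    obtain ⟨m, hm, -⟩ := hS.R 0
    have him : (S.R 0).2.im = 0 := by
      rw [Subsingleton.elim m 0] at hm
      exact Complex.conj_eq_iff_im.1 (congrArg Prod.snd hm).symm
    have hre : (S.R 0).2 = ((S.R 0).2.re : ℂ) := Complex.ext rfl (by simp [him])
    refine F.correlatorsHomogeneous_real (x := fun u k => ψ u k 0) (r := (S.R 0).2.re) hS hx
      (fun h0 => S.R_ne_zero 0 ?_) fun k => ?_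
    · rw [hre, h0, Complex.ofReal_zero]
    · rw [Subsingleton.elim k 0]
      exact hre
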